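/- Let $\mathbf k$ be a commutative $\mathbb Q$-algebra and $A$ a unital associative $\mathbf k$-algebra such that $\mathbf k\to A$ is a $\mathbf k$-split injection; put $\bar A=A/\mathbf k$. **Notation.** Let $\Omega=\bigoplus_{n\ge0}\Omega^n$, $\Omega^n=A\otimes\bar A^{\otimes n}\ni a_0\,da_1\cdots da_n$, be the dg algebra of noncommutative differential forms of $A$, $\overline\Omega=\Omega/\mathbf k$, and let $\overline{[\Omega,\Omega]}$, $\overline{[d\Omega,d\Omega]}\subseteq\overline\Omega$ be the images of the spans of graded commutators of (exact) forms. Put $\overline{DR}=\overline\Omega/\overline{[\Omega,\Omega]}$, with projection $f\mapsto f_\natural$, and $\overline\Omega^n=\overline{DR}{}^n=0$ for $n<0$. Let $b(\alpha\,da)=(-1)^{n}[\alpha,a]$ for $\alpha\in\Omega^{n}$, $b|_{\Omega^0}=0$; $\kappa(\alpha\,da)=(-1)^{n}da\,\alpha$ for $\alpha\in\Omega^n$; $B|_{\Omega^n}=(1+\kappa+\dots+\kappa^n)d$; and $$i(a_0\,da_1\cdots da_n)=\sum_{l=1}^n(-1)^{(l-1)(n-1)+1}[a_l,\ da_{l+1}\cdots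 da_n\,a_0\,da_1\cdots da_{l-1}],$$ i.e. $i|_{\Omega^n}=b(1+\kappa+\dots+\kappa^{n-1})$. All of $d,b,B,i$ descend to $\overline\Omega$; $d$ descends to $\overline{DR}$, and $i$ induces $i:\overline{DR}{}^n\to\overline\Omega^{n-1}$. Let $u$ have degree $-2$, $R=\mathbf k(\!(u)\!)/u\mathbf k[\![u]\!]$, and write $f_0$ for the constant term of a series $f$ in $u$. For $n\in\mathbb Z$ define reduced Karoubi–de Rham homology $\overline{HD}_n=\ker(d|_{\overline{DR}{}^n})/d\overline{DR}{}^{n-1}$ and the reduced Hochschild, cyclic, negative cyclic and periodic cyclic homology $$\overline{HH}_n=H_n(\overline\Omega,b),\quad \overline{HC}_n=H_n(\overline\Omega\otimes R,b-uB),\quad \overline{HC}{}^-_n=H_n(\overline\Omega[\![u]\!],b-uB),\quad \overline{HC}{}^{per}_n=H_n(\overline\Omega(\!(u)\!),b-uB).$$ **Theorem.** (a) For all $n\in\mathbb Z$ there are $\mathbf k$-linear isomorphisms $$\overline{HH}_n\cong\ker\bigl(i:\overline{DR}{}^n\to\overline\Omega^{n-1}\bigr),\qquad \overline{HC}_n\cong\ker\bigl(i:\overline{DR}{}^n/d\overline{DR}{}^{n-1}\to\overline\Omega^{n-1}/d\overline\Omega^{n-2}\bigr),$$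 $$\overline{HC}{}^-_n\cong H_n(\overline\Omega[\![u]\!],i-ud)\big/\overline{[d\Omega,d\Omega]}{}^n,\qquad \overline{HC}{}^{per}_n\cong H_n(\overline\Omega(\!(u)\!),i-ud),$$ where $\overline{[d\Omega,d\Omega]}{}^n$ is placed in the constant terms in $u$. The first two are induced by $f\mapsto f_\natural$ and $f\mapsto(f_0)_\natural$. The last two send the class of a $(b-uB)$-cycle $f=\sum_jf_ju^j$, $f_j\in\overline\Omega^{n+2j}$, to the class of $\tilde f=\sum_j\frac1{(n+2j)!}f_ju^j$ whenever $\tilde f$ is an $(i-ud)$-cycle. (b) Identify these groups with the right-hand sides in (a). Let $\mathsf Z_n$ be the space of $f\in\overline\Omega[\![u]\!]$ of degree $n$ such that $(i-ud)f$ is independent of $u$; let $\overline{HD}{}'_n\subseteq\overline{HD}_n$ be the subspace of the classes of $(f_0)_\natural$, $f\in\mathsf Z_n$, and let $\overline{HH}{}'_n\subseteq\overline{HH}_n$ be the subspace of the elements $(f_0)_\natural$ with $f\in\overline\Omega[\![u]\!]$ of degree $n$ and $(i-ud)f=0$. Then for all $n\in\mathbb Z$ the following assignments give well-defined $\mathbf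 k$-linear maps (below $f$ is a homogeneous representative): - $I:\overline{HH}_n\to\overline{HC}_n$, $J:\overline{HH}{}'_n\to\overline{HD}{}'_n$, $S_2:\overline{HD}_n\to\overline{HC}_n$, $p_2:\overline{HD}{}'_n\to\overline{HC}_n$, all given by $f_\natural\mapsto f_\natural$; - $B:\overline{HC}_n\to\overline{HH}_{n+1}$, $f_\natural\mapsto(df)_\natural$; $B':\overline{HC}_n\to\overline{HC}{}^-_{n+1}$ and $B^-:\overline{HH}_n\to\overline{HC}{}^-_{n+1}$, $f_\natural\mapsto df$; - $S_1:\overline{HC}_{n+1}\to\overline{HD}_{n-1}$, $f_\natural\mapsto g_\natural$ for any $g\in\overline\Omega^{n-1}$ with $dg=i(f)$; - $S^-:\overline{HC}{}^-_{n+1}\to\overline{HC}{}^-_{n-1}$ and the isomorphism $\cdot u:\overline{HC}{}^{per}_{n+1}\to\overline{HC}{}^{per}_{n-1}$, $f\mapsto uf$; $p^-:\overline{HC}{}^-_n\to\overline{HC}{}^{per}_n$, $f\mapsto f$; - $I^-:\overline{HC}{}^-_n\to\overline{HH}{}'_n$ and $p_1:\overline{HC}{}^{per}_n\to\overline{HD}{}'_n$,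 $f\mapsto(f_0)_\natural$; $p=p_2p_1:\overline{HC}{}^{per}_n\to\overline{HC}_n$. The three rows $$0\to\overline{HH}{}'_n\hookrightarrow\overline{HH}_n\xrightarrow{B^-}\overline{HC}{}^-_{n+1}\xrightarrow{S^-}\overline{HC}{}^-_{n-1}\xrightarrow{I^-}\overline{HH}{}'_{n-1}\to0,$$ $$0\to\overline{HD}{}'_n\xrightarrow{p_2}\overline{HC}_n\xrightarrow{B'}\overline{HC}{}^-_{n+1}\xrightarrow{u\,p^-}\overline{HC}{}^{per}_{n-1}\xrightarrow{p_1}\overline{HD}{}'_{n-1}\to0,$$ $$0\to\overline{HD}_n\xrightarrow{S_2}\overline{HC}_n\xrightarrow{B}\overline{HH}_{n+1}\xrightarrow{I}\overline{HC}_{n+1}\xrightarrow{S_1}\overline{HD}_{n-1}\to0$$ are exact, and also $\operatorname{im}B'=\ker(p^-:\overline{HC}{}^-_{n+1}\to\overline{HC}{}^{per}_{n+1})$. The vertical maps $J,\ I,\ \mathrm{id},\ p^-,\ J$ from the first row to the second and $\mathrm{incl},\ \mathrm{id},\ I^-,\ p\circ u^{-1},\ \mathrm{incl}$ from the second row to the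 third make the whole diagram commute: $$p_2J=I|_{\overline{HH}{}'_n},\quad B'I=B^-,\quad u\,p^-=p^-S^-,\quad p_1p^-=JI^-,\quad S_2|_{\overline{HD}{}'_n}=p_2,\quad I^-B'=B,\quad p\,p^-=I\,I^-,\quad S_1p=p_1u.$$ -/

import Mathlib

open scoped TensorProduct DirectSum

noncomputable section

namespace NCForms

universe u v

variable (k : Type u) [CommRing k] (A : Type v) [Ring A] [Algebra k A]

/-- `Ā = A / k`. -/
abbrev Abar : Type v := A ⧸ LinearMap.range (Algebra.linearMap k A)

/-- The `k`-module `Ωⁿ A = A ⊗ Ā^{⊗ n}` of noncommutative `n`-forms;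
`a₀ ⊗ (ā₁ ⊗ ⋯ ⊗ āₙ)` is the form `a₀ da₁ ⋯ daₙ`. -/
abbrev Form (n : ℕ) : Type (max u v) := A ⊗[k] (⨂[k]^n (Abar k A))

/-- `A ≃ Ω⁰ A`. -/
def formZero : A ≃ₗ[k] Form k A 0 :=
  (TensorProduct.rid k A).symm ≪≫ₗ
    TensorProduct.congr (LinearEquiv.refl k A) (PiTensorProduct.isEmptyEquiv (Fin 0)).symm

/-- `Ωⁿ A ⊗ Ā ≃ Ωⁿ⁺¹ A`, `α ⊗ c̄ ↦ α dc`. -/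
def snoc (n : ℕ) : Form k A n ⊗[k] Abar k A ≃ₗ[k] Form k A (n + 1) :=
  TensorProduct.assoc k A (⨂[k]^n (Abar k A)) (Abar k A) ≪≫ₗ
    TensorProduct.congr (LinearEquiv.refl k A)
      (TensorProduct.congr (LinearEquiv.refl k _)
          (PiTensorProduct.subsingletonEquiv (s := fun _ : Fin 1 => Abar k A) 0).symm ≪≫ₗ
        TensorPower.mulEquiv)

theorem formZero_apply (a : A) (x : Fin 0 → Abar k A) :
    formZero k A a = a ⊗ₜ[k] PiTensorProduct.tprod k x := by
  have h : (PiTensorProduct.isEmptyEquiv (R := k) (s := fun _ : Fin 0 => Abar k A) (Fin 0)).symm 1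
      = PiTensorProduct.tprod k x := by
    rw [LinearEquiv.symm_apply_eq, PiTensorProduct.isEmptyEquiv_apply_tprod]
  simp [formZero, h]

theorem snoc_tmul (n : ℕ) (a : A) (x : Fin n → Abar k A) (c : Abar k A) :
    snoc k A n ((a ⊗ₜ[k] PiTensorProduct.tprod k x) ⊗ₜ[k] c)
      = a ⊗ₜ[k] PiTensorProduct.tprod k (Fin.snoc x c) := by
  have h := TensorPower.tprod_mul_tprod k x (fun _ : Fin 1 => c)
  rw [TensorPower.gMul_def, Fin.append_right_eq_snoc] at h
  simp [snoc, h]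

/-- The graded module `Ω A = ⨁ₙ Ωⁿ A` of noncommutative differential forms. -/
def Omega : Type (max u v) := ⨁ n : ℕ, Form k A n

instance : AddCommGroup (Omega k A) := inferInstanceAs (AddCommGroup (⨁ n : ℕ, Form k A n))
instance : Module k (Omega k A) := inferInstanceAs (Module k (⨁ n : ℕ, Form k A n))

variable {k A}

/-- Linear maps out of `Ω A` are given degreewise. -/
def Omega.lift {N : Type*} [AddCommGroup N] [Module k N] (f : ∀ n, Form k A n →ₗ[k] N) :
    Omega k A →ₗ[k] N := DirectSum.toModule k ℕ N f

variable (k A) in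
/-- The inclusion `Ωⁿ A → Ω A`. -/
def hom (n : ℕ) : Form k A n →ₗ[k] Omega k A := DirectSum.lof k ℕ (Form k A) n

@[simp] theorem Omega.lift_hom {N : Type*} [AddCommGroup N] [Module k N]
    (f : ∀ n, Form k A n →ₗ[k] N) (n : ℕ) (x : Form k A n) :
    Omega.lift f (hom k A n x) = f n x := DirectSum.toModule_lof k n x

variable (k A) in
/-- The inclusion `A = Ω⁰ A → Ω A`. -/
def ofA : A →ₗ[k] Omega k A := hom k A 0 ∘ₗ (formZero k A).toLinearMap

variable (k A) in
/-- The class of `a` in `Ā`. -/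
def bar : A →ₗ[k] Abar k A := Submodule.mkQ _

variable (k A) in
/-- Right multiplication by exact 1-forms, `(α, c̄) ↦ α dc`. -/
def rightD : Omega k A →ₗ[k] Abar k A →ₗ[k] Omega k A :=
  Omega.lift fun n => TensorProduct.curry (hom k A (n + 1) ∘ₗ (snoc k A n).toLinearMap)

theorem rightD_hom (n : ℕ) (x : Form k A n) (c : Abar k A) :
    rightD k A (hom k A n x) c = hom k A (n + 1) (snoc k A n (x ⊗ₜ c)) := by
  simp [rightD]

theorem form_succ_induction {n : ℕ} {p : Form k A (n + 1) → Prop}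
    (h1 : ∀ x a, p (snoc k A n (x ⊗ₜ bar k A a))) (h2 : ∀ x y, p x → p y → p (x + y))
    (x : Form k A (n + 1)) : p x := by
  obtain ⟨y, rfl⟩ := (snoc k A n).surjective x
  induction y with
  | zero => simpa using h1 0 0
  | tmul x c => obtain ⟨a, rfl⟩ := Submodule.mkQ_surjective _ c; exact h1 x a
  | add x y hx hy => rw [map_add]; exact h2 _ _ hx hy

/-- Every form is a sum of forms `a` and `α dc`. -/
theorem hom_induction {p : ℕ → Omega k A → Prop}
    (h0 : ∀ a, p 0 (ofA k A a))
    (h1 : ∀ n x a, p n (hom k A n x) → p (n + 1) (rightD k A (hom k A n x) (bar k A a)))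
    (h2 : ∀ n x y, p n x → p n y → p n (x + y)) (n : ℕ) (x : Form k A n) :
    p n (hom k A n x) := by
  induction n with
  | zero =>
    obtain ⟨a, rfl⟩ := (formZero k A).surjective x
    exact h0 a
  | succ n ih =>
    induction x using form_succ_induction with
    | h1 x a => rw [← rightD_hom]; exact h1 n x a (ih x)
    | h2 x y hx hy => rw [map_add]; exact h2 _ _ _ hx hy

theorem Omega.induction {p : Omega k A → Prop} (h1 : ∀ n x, p (hom k A n x))
    (h2 : ∀ x y, p x → p y → p (x + y)) (x : Omega k A) : p x := by
  refine DirectSum.induction_on (motive := p) x ?_ h1 h2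
  have := h1 0 0
  rwa [map_zero] at this

theorem omega_induction {p : Omega k A → Prop} (h0 : ∀ a, p (ofA k A a))
    (h1 : ∀ x a, p x → p (rightD k A x (bar k A a)))
    (h2 : ∀ x y, p x → p y → p (x + y)) (x : Omega k A) : p x :=
  Omega.induction
    (hom_induction (p := fun _ => p) h0 (fun _ _ a => h1 _ a) (fun _ => h2)) h2 x

/-- The restriction of `d` to `Ωⁿ A`: `da = 1 · da` and `d(α dc) = (dα) dc`. -/
def dForm : ∀ n : ℕ, Form k A n →ₗ[k] Omega k A
  | 0 => rightD k A (ofA k A 1) ∘ₗ bar k A ∘ₗ (formZero k A).symm.toLinearMap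
  | n + 1 => TensorProduct.lift (rightD k A ∘ₗ dForm n) ∘ₗ (snoc k A n).symm.toLinearMap

variable (k A) in
/-- The differential `d` on `Ω A`: `d(a₀ da₁ ⋯ daₙ) = 1 da₀ da₁ ⋯ daₙ`. -/
def d : Omega k A →ₗ[k] Omega k A := Omega.lift dForm

theorem d_ofA (a : A) : d k A (ofA k A a) = rightD k A (ofA k A 1) (bar k A a) := by
  simp [d, ofA, dForm]

theorem d_rightD (x : Omega k A) (c : Abar k A) :
    d k A (rightD k A x c) = rightD k A (d k A x) c := by
  induction x using Omega.induction with
  | h1 n x => rw [rightD_hom]; simp [d, dForm]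
  | h2 x y hx hy => simp [hx, hy]

theorem bar_one : bar k A 1 = 0 := by
  rw [bar, Submodule.mkQ_apply, Submodule.Quotient.mk_eq_zero]
  exact ⟨1, by simp⟩

theorem bar_algebraMap (r : k) : bar k A (algebraMap k A r) = 0 := by
  rw [Algebra.algebraMap_eq_smul_one, map_smul, bar_one, smul_zero]

theorem d_one : d k A (ofA k A 1) = 0 := by rw [d_ofA, bar_one, map_zero]

theorem d_d (x : Omega k A) : d k A (d k A x) = 0 := by
  induction x using omega_induction with
  | h0 a => rw [d_ofA, d_rightD, d_one]; simp
  | h1 x a hx => rw [d_rightD, d_rightD, hx]; simp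
  | h2 x y hx hy => simp [hx, hy]

variable (k A) in
/-- Left multiplication by elements of `A`: `a · (a₀ da₁ ⋯ daₙ) = (a a₀) da₁ ⋯ daₙ`. -/
def leftA : A →ₗ[k] Module.End k (Omega k A) :=
  LinearMap.flip (Omega.lift fun n =>
    LinearMap.flip (LinearMap.compRight k (hom k A n) ∘ₗ
      LinearMap.rTensorHom (⨂[k]^n (Abar k A)) ∘ₗ LinearMap.mul k A))

theorem leftA_hom_tmul (n : ℕ) (a b : A) (t : ⨂[k]^n (Abar k A)) :
    leftA k A a (hom k A n (b ⊗ₜ t)) = hom k A n ((a * b) ⊗ₜ t) := by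
  simp [leftA]

theorem leftA_ofA (a b : A) : leftA k A a (ofA k A b) = ofA k A (a * b) := by
  simp only [ofA, LinearMap.comp_apply, LinearEquiv.coe_coe]
  rw [formZero_apply k A b Fin.elim0, formZero_apply k A (a * b) Fin.elim0, leftA_hom_tmul]

theorem leftA_rightD (a : A) (x : Omega k A) (c : Abar k A) :
    leftA k A a (rightD k A x c) = rightD k A (leftA k A a x) c := by
  induction x using Omega.induction with
  | h1 n x =>
    induction x using TensorProduct.induction_on with
    | zero => simp
    | tmul b t =>
      induction t using PiTensorProduct.induction_on with
      | smul_tprod r f =>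
        simp only [TensorProduct.tmul_smul, map_smul, LinearMap.smul_apply, leftA_hom_tmul,
          rightD_hom, snoc_tmul]
      | add x y hx hy => simp only [TensorProduct.tmul_add, map_add, LinearMap.add_apply, hx, hy]
    | add x y hx hy => simp only [map_add, LinearMap.add_apply, hx, hy]
  | h2 x y hx hy => simp only [map_add, LinearMap.add_apply, hx, hy]

theorem leftA_one (x : Omega k A) : leftA k A 1 x = x := by
  induction x using omega_induction with
  | h0 a => rw [leftA_ofA, one_mul]
  | h1 x a hx => rw [leftA_rightD, hx]
  | h2 x y hx hy => simp [hx, hy]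

theorem leftA_mul (a b : A) (x : Omega k A) :
    leftA k A (a * b) x = leftA k A a (leftA k A b x) := by
  induction x using omega_induction with
  | h0 c => simp only [leftA_ofA, mul_assoc]
  | h1 x a hx => simp only [leftA_rightD, hx]
  | h2 x y hx hy => simp [hx, hy]

variable (k A) in
/-- Left multiplication by exact 1-forms, as forced by the Leibniz rule:
`dc · ω = d(c ω) - c dω`. -/
def leftD : Abar k A →ₗ[k] Module.End k (Omega k A) :=
  Submodule.liftQ _
    (LinearMap.mulLeft k (d k A) ∘ₗ leftA k A - LinearMap.mulRight k (d k A) ∘ₗ leftA k A) (by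
      rintro _ ⟨r, rfl⟩
      ext x
      simp [Algebra.algebraMap_eq_smul_one, leftA_one])

theorem leftD_bar (a : A) (x : Omega k A) :
    leftD k A (bar k A a) x = d k A (leftA k A a x) - leftA k A a (d k A x) := by
  simp [leftD, bar]

theorem leftD_rightD (c : Abar k A) (x : Omega k A) (e : Abar k A) :
    leftD k A c (rightD k A x e) = rightD k A (leftD k A c x) e := by
  obtain ⟨a, rfl⟩ := Submodule.mkQ_surjective _ c
  change leftD k A (bar k A a) _ = rightD k A (leftD k A (bar k A a) x) e
  simp [leftD_bar, leftA_rightD, d_rightD]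

/-- Left multiplication by an `n`-form:
`(a₀ da₁ ⋯ daₙ) · ω = a₀ · (da₁ · ( ⋯ (daₙ · ω) ⋯ ))`. -/
def mulForm : ∀ n : ℕ, Form k A n →ₗ[k] Module.End k (Omega k A)
  | 0 => leftA k A ∘ₗ (formZero k A).symm.toLinearMap
  | n + 1 => TensorProduct.lift
      ((LinearMap.mul k (Module.End k (Omega k A))).compl₁₂ (mulForm n) (leftD k A)) ∘ₗ
        (snoc k A n).symm.toLinearMap

variable (k A) in
/-- The product of `Ω A`. -/
def mulOmega : Omega k A →ₗ[k] Module.End k (Omega k A) := Omega.lift mulForm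

theorem mulOmega_ofA (a : A) : mulOmega k A (ofA k A a) = leftA k A a := by
  simp [mulOmega, ofA, mulForm]

theorem mulOmega_rightD (x : Omega k A) (c : Abar k A) (y : Omega k A) :
    mulOmega k A (rightD k A x c) y = mulOmega k A x (leftD k A c y) := by
  induction x using Omega.induction with
  | h1 n x => rw [rightD_hom]; simp [mulOmega, mulForm]
  | h2 x y hx hy => simp [hx, hy]

theorem mulOmega_leftA (a : A) (x y : Omega k A) :
    mulOmega k A (leftA k A a x) y = leftA k A a (mulOmega k A x y) := by
  induction x using omega_induction generalizing y with
  | h0 b => simp only [leftA_ofA, mulOmega_ofA, leftA_mul]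
  | h1 x c hx => simp only [leftA_rightD, mulOmega_rightD, hx]
  | h2 x y hx hy => simp [hx, hy]

theorem mulOmega_x_rightD (x y : Omega k A) (c : Abar k A) :
    mulOmega k A x (rightD k A y c) = rightD k A (mulOmega k A x y) c := by
  induction x using omega_induction generalizing y with
  | h0 a => simp only [mulOmega_ofA, leftA_rightD]
  | h1 x a hx => simp only [mulOmega_rightD, leftD_rightD, hx]
  | h2 x y hx hy => simp [hx, hy]

theorem mulOmega_one (x : Omega k A) : mulOmega k A x (ofA k A 1) = x := by
  induction x using omega_induction with
  | h0 a => rw [mulOmega_ofA, leftA_ofA, mul_one]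
  | h1 x a hx =>
    rw [mulOmega_rightD, leftD_bar, leftA_ofA, d_one, map_zero, sub_zero, mul_one, d_ofA,
      mulOmega_x_rightD, hx]
  | h2 x y hx hy => simp [hx, hy]

/-- The Leibniz rule. -/
theorem d_mulOmega (n : ℕ) (x : Form k A n) (y : Omega k A) :
    d k A (mulOmega k A (hom k A n x) y) =
      mulOmega k A (d k A (hom k A n x)) y + (-1 : k) ^ n • mulOmega k A (hom k A n x) (d k A y) := by
  refine hom_induction (k := k) (A := A) (p := fun n x => ∀ y, d k A (mulOmega k A x y) =
    mulOmega k A (d k A x) y + (-1 : k) ^ n • mulOmega k A x (d k A y)) ?_ ?_ ?_ n x y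
  · intro a y
    simp [d_ofA, mulOmega_ofA, mulOmega_rightD, leftA_one, leftD_bar]
  · intro n x a ih y
    simp only [mulOmega_rightD, d_rightD, ih, leftD_bar, map_sub, d_d, pow_succ]
    simp only [map_zero]
    module
  · intro n x y hx hy z
    simp only [map_add, LinearMap.add_apply, hx, hy, smul_add]
    abel

theorem mulOmega_leftD (c : Abar k A) (x y : Omega k A) :
    mulOmega k A (leftD k A c x) y = leftD k A c (mulOmega k A x y) := by
  obtain ⟨a, rfl⟩ := Submodule.mkQ_surjective _ c
  change mulOmega k A (leftD k A (bar k A a) x) y = leftD k A (bar k A a) _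
  induction x using Omega.induction with
  | h1 n x =>
    have h1 := d_mulOmega n x y
    have hx : ∃ x', leftA k A a (hom k A n x) = hom k A n x' :=
      ⟨LinearMap.rTensor _ (LinearMap.mulLeft k a) x, by
        simp [leftA]; rfl⟩
    obtain ⟨x', hx'⟩ := hx
    have h2 := d_mulOmega n x' y
    rw [← hx', mulOmega_leftA, mulOmega_leftA] at h2
    rw [leftD_bar, leftD_bar, map_sub, LinearMap.sub_apply, h2, h1, mulOmega_leftA]
    simp
  | h2 x y hx hy => simp [hx, hy]

theorem mulOmega_assoc (x y z : Omega k A) :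
    mulOmega k A (mulOmega k A x y) z = mulOmega k A x (mulOmega k A y z) := by
  induction x using omega_induction generalizing y with
  | h0 a => simp only [mulOmega_ofA, mulOmega_leftA]
  | h1 x a hx => simp only [mulOmega_rightD, hx, mulOmega_leftD]
  | h2 x y hx hy => simp [hx, hy]

instance : Ring (Omega k A) :=
  { (inferInstance : AddCommGroup (Omega k A)) with
    mul x y := mulOmega k A x y
    one := ofA k A 1
    mul_assoc := mulOmega_assoc
    one_mul x := by
      change mulOmega k A (ofA k A 1) x = x
      rw [mulOmega_ofA, leftA_one]
    mul_one := mulOmega_one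
    left_distrib x y z := map_add (mulOmega k A x) y z
    right_distrib x y z := by
      change mulOmega k A (x + y) z = mulOmega k A x z + mulOmega k A y z
      rw [map_add, LinearMap.add_apply]
    zero_mul x := by
      change mulOmega k A 0 x = 0
      rw [map_zero, LinearMap.zero_apply]
    mul_zero x := map_zero (mulOmega k A x) }

instance : Algebra k (Omega k A) :=
  Algebra.ofModule
    (fun r x y => by
      change mulOmega k A (r • x) y = r • mulOmega k A x y
      rw [map_smul, LinearMap.smul_apply])
    (fun r x y => map_smul (mulOmega k A x) r y)

theorem mul_def (x y : Omega k A) : x * y = mulOmega k A x y := rfl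

theorem ofA_mul (a b : A) : ofA k A a * ofA k A b = ofA k A (a * b) := by
  rw [mul_def, mulOmega_ofA, leftA_ofA]

theorem ofA_one : ofA k A 1 = 1 := rfl

theorem mul_d_ofA (x : Omega k A) (a : A) : x * d k A (ofA k A a) = rightD k A x (bar k A a) := by
  rw [mul_def, d_ofA, mulOmega_x_rightD, mulOmega_one]

theorem leftD_eq (x : Omega k A) (a : A) : leftD k A (bar k A a) x = d k A (ofA k A a) * x := by
  rw [mul_def, d_ofA, mulOmega_rightD, mulOmega_ofA, leftA_one]

theorem d_mul (n : ℕ) (x : Form k A n) (y : Omega k A) :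
    d k A (hom k A n x * y) =
      d k A (hom k A n x) * y + (-1 : k) ^ n • (hom k A n x * d k A y) := d_mulOmega n x y

variable (k A) in
/-- `(α, c̄) ↦ [α, c] = α c - c α`. -/
def commA : Omega k A →ₗ[k] Abar k A →ₗ[k] Omega k A :=
  LinearMap.flip (Submodule.liftQ _
    ((LinearMap.mul k (Omega k A)).flip ∘ₗ ofA k A - LinearMap.mul k (Omega k A) ∘ₗ ofA k A) (by
      rintro _ ⟨r, rfl⟩
      ext x
      simp [Algebra.algebraMap_eq_smul_one, ofA_one]))

theorem commA_bar (x : Omega k A) (a : A) :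
    commA k A x (bar k A a) = x * ofA k A a - ofA k A a * x := by
  simp [commA, bar]

/-- The restriction of the Hochschild differential to `Ωⁿ A`. -/
def hochForm : ∀ n : ℕ, Form k A n →ₗ[k] Omega k A
  | 0 => 0
  | n + 1 => (-1 : k) ^ n •
      (TensorProduct.lift (commA k A ∘ₗ hom k A n) ∘ₗ (snoc k A n).symm.toLinearMap)

variable (k A) in
/-- The Hochschild differential `b`: `b(α da) = (-1)ⁿ [α, a]` for `α ∈ Ωⁿ A`, and `b = 0` on
`Ω⁰ A`. -/
def hoch : Omega k A →ₗ[k] Omega k A := Omega.lift hochForm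

/-- The restriction of the Karoubi operator to `Ωⁿ A`. -/
def karForm : ∀ n : ℕ, Form k A n →ₗ[k] Omega k A
  | 0 => hom k A 0
  | n + 1 => (-1 : k) ^ n •
      (TensorProduct.lift ((leftD k A).flip ∘ₗ hom k A n) ∘ₗ (snoc k A n).symm.toLinearMap)

variable (k A) in
/-- The Karoubi operator `κ`: `κ(α da) = (-1)ⁿ da α` for `α ∈ Ωⁿ A`. (Its value on `Ω⁰ A`, here
the identity, plays no role in the definitions of `B` and `i`.) -/
def kar : Omega k A →ₗ[k] Omega k A := Omega.lift karForm

variable (k A) in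
/-- The Connes differential: `B = (1 + κ + ⋯ + κⁿ) d` on `Ωⁿ A`. -/
def connes : Omega k A →ₗ[k] Omega k A :=
  Omega.lift fun n => (∑ j ∈ Finset.range (n + 1), kar k A ^ j) ∘ₗ d k A ∘ₗ hom k A n

variable (k A) in
/-- The contraction `i`, on `Ωⁿ A` equal to `b (1 + κ + ⋯ + κⁿ⁻¹)`; the explicit formula
`i(a₀ da₁ ⋯ daₙ) = ∑ₗ (-1)^((l-1)(n-1)+1) [aₗ, daₗ₊₁ ⋯ daₙ a₀ da₁ ⋯ daₗ₋₁]` is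
`contr_apply` below. -/
def contr : Omega k A →ₗ[k] Omega k A :=
  Omega.lift fun n => hoch k A ∘ₗ (∑ j ∈ Finset.range n, kar k A ^ j) ∘ₗ hom k A n

theorem hoch_ofA (a : A) : hoch k A (ofA k A a) = 0 := by
  simp [hoch, ofA, hochForm]

theorem hoch_mul_d (n : ℕ) (x : Form k A n) (a : A) :
    hoch k A (hom k A n x * d k A (ofA k A a)) =
      (-1 : k) ^ n • (hom k A n x * ofA k A a - ofA k A a * hom k A n x) := by
  rw [mul_d_ofA, rightD_hom]
  simp [hoch, hochForm, commA_bar]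

theorem kar_mul_d (n : ℕ) (x : Form k A n) (a : A) :
    kar k A (hom k A n x * d k A (ofA k A a)) =
      (-1 : k) ^ n • (d k A (ofA k A a) * hom k A n x) := by
  rw [mul_d_ofA, rightD_hom]
  simp [kar, karForm, leftD_eq]

theorem connes_hom (n : ℕ) (x : Form k A n) :
    connes k A (hom k A n x) =
      ∑ j ∈ Finset.range (n + 1), (kar k A ^ j) (d k A (hom k A n x)) := by
  simp [connes]

theorem contr_hom (n : ℕ) (x : Form k A n) :
    contr k A (hom k A n x) =
      hoch k A (∑ j ∈ Finset.range n, (kar k A ^ j) (hom k A n x)) := by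
  simp [contr]

theorem contr_ofA (a : A) : contr k A (ofA k A a) = 0 := by
  simp [ofA, contr_hom]

theorem connes_one : connes k A 1 = 0 := by
  have h := connes_hom 0 (formZero k A 1)
  change connes k A (ofA k A 1) = ∑ j ∈ _, (kar k A ^ j) (d k A (ofA k A 1)) at h
  rw [d_one] at h
  simpa [ofA_one] using h

variable (k A) in
/-- The degree `n` part of `Ω A`. -/
def homog (n : ℕ) : Submodule k (Omega k A) := LinearMap.range (hom k A n)

theorem ofA_mem (a : A) : ofA k A a ∈ homog k A 0 := ⟨_, rfl⟩

theorem homog_induction {p : Omega k A → Prop} {n : ℕ}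
    (h1 : ∀ x ∈ homog k A n, ∀ a, p (x * d k A (ofA k A a)))
    (h2 : ∀ x y, p x → p y → p (x + y)) {x : Omega k A} (hx : x ∈ homog k A (n + 1)) : p x := by
  obtain ⟨x, rfl⟩ := hx
  induction x using form_succ_induction with
  | h1 x a => rw [← rightD_hom, ← mul_d_ofA]; exact h1 _ ⟨x, rfl⟩ a
  | h2 x y hx hy => rw [map_add]; exact h2 _ _ hx hy

theorem homog_zero {x : Omega k A} (hx : x ∈ homog k A 0) : ∃ a, x = ofA k A a := by
  obtain ⟨x, rfl⟩ := hx
  obtain ⟨a, rfl⟩ := (formZero k A).surjective x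
  exact ⟨a, rfl⟩

theorem mul_d_mem {n : ℕ} {x : Omega k A} (hx : x ∈ homog k A n) (a : A) :
    x * d k A (ofA k A a) ∈ homog k A (n + 1) := by
  obtain ⟨x, rfl⟩ := hx
  rw [mul_d_ofA, rightD_hom]
  exact ⟨_, rfl⟩

theorem d_mem {n : ℕ} {x : Omega k A} (hx : x ∈ homog k A n) : d k A x ∈ homog k A (n + 1) := by
  induction n generalizing x with
  | zero =>
    obtain ⟨a, rfl⟩ := homog_zero hx
    rw [← one_mul (d k A _), ← ofA_one]
    exact mul_d_mem (ofA_mem 1) a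
  | succ n ih =>
    refine homog_induction (p := fun x => d k A x ∈ homog k A (n + 1 + 1)) ?_ ?_ hx
    · intro x hx a
      rw [mul_d_ofA, d_rightD, ← mul_d_ofA]
      exact mul_d_mem (ih hx) a
    · intro x y hx hy
      rw [map_add]
      exact add_mem hx hy

theorem mul_mem {m n : ℕ} {x y : Omega k A} (hx : x ∈ homog k A m) (hy : y ∈ homog k A n) :
    x * y ∈ homog k A (m + n) := by
  induction n generalizing y with
  | zero =>
    obtain ⟨a, rfl⟩ := homog_zero hy
    clear hy
    induction m generalizing x a with
    | zero =>
      obtain ⟨b, rfl⟩ := homog_zero hx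
      rw [ofA_mul]
      exact ofA_mem _
    | succ m ih =>
      refine homog_induction (p := fun x => ∀ a, x * ofA k A a ∈ homog k A (m + 1 + 0)) ?_ ?_ hx a
      · intro x hx c a
        have h : d k A (ofA k A c) * ofA k A a =
            d k A (ofA k A (c * a)) - ofA k A c * d k A (ofA k A a) := by
          have := d_mul 0 (formZero k A c) (ofA k A a)
          change d k A (ofA k A c * ofA k A a) = d k A (ofA k A c) * ofA k A a +
            (-1 : k) ^ 0 • (ofA k A c * d k A (ofA k A a)) at this
          rw [ofA_mul] at this
          rw [this]; simp
        rw [mul_assoc, h, mul_sub, ← mul_assoc]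
        exact sub_mem (mul_d_mem hx _) (mul_d_mem (ih hx c) _)
      · intro x y hx hy a
        rw [add_mul]
        exact add_mem (hx a) (hy a)
  | succ n ih =>
    refine homog_induction (p := fun y => x * y ∈ homog k A (m + (n + 1))) ?_ ?_ hy
    · intro y hy a
      rw [← mul_assoc]
      exact mul_d_mem (ih hy) a
    · intro y z hy hz
      rw [mul_add]
      exact add_mem hy hz

/-! Versions of the rules above for homogeneous elements. -/

theorem d_mul' {n : ℕ} {x : Omega k A} (hx : x ∈ homog k A n) (y : Omega k A) :
    d k A (x * y) = d k A x * y + (-1 : k) ^ n • (x * d k A y) := by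
  obtain ⟨x, rfl⟩ := hx
  exact d_mul n x y

theorem hoch_mul_d' {n : ℕ} {x : Omega k A} (hx : x ∈ homog k A n) (a : A) :
    hoch k A (x * d k A (ofA k A a)) =
      (-1 : k) ^ n • (x * ofA k A a - ofA k A a * x) := by
  obtain ⟨x, rfl⟩ := hx
  exact hoch_mul_d n x a

theorem kar_mul_d' {n : ℕ} {x : Omega k A} (hx : x ∈ homog k A n) (a : A) :
    kar k A (x * d k A (ofA k A a)) = (-1 : k) ^ n • (d k A (ofA k A a) * x) := by
  obtain ⟨x, rfl⟩ := hx
  exact kar_mul_d n x a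

theorem kar_mem {n : ℕ} {x : Omega k A} (hx : x ∈ homog k A n) : kar k A x ∈ homog k A n := by
  cases n with
  | zero =>
    obtain ⟨x, rfl⟩ := hx
    simp only [kar, Omega.lift_hom, karForm]
    exact ⟨x, rfl⟩
  | succ n =>
    refine homog_induction (p := fun x => kar k A x ∈ homog k A (n + 1)) ?_ ?_ hx
    · intro x hx a
      rw [kar_mul_d' hx, add_comm]
      exact Submodule.smul_mem _ _ (mul_mem (d_mem (ofA_mem a)) hx)
    · intro x y hx hy
      rw [map_add]
      exact add_mem hx hy

theorem kar_pow_mem {n : ℕ} (j : ℕ) {x : Omega k A} (hx : x ∈ homog k A n) :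
    (kar k A ^ j) x ∈ homog k A n := by
  induction j with
  | zero => simpa using hx
  | succ j ih => rw [pow_succ', Module.End.mul_apply]; exact kar_mem ih

/-- `dcs [c₁, …, cₘ] = dc₁ ⋯ dcₘ`. -/
def dcs (l : List A) : Omega k A := (l.map fun a => d k A (ofA k A a)).prod

theorem dcs_mem (l : List A) : dcs (k := k) l ∈ homog k A l.length := by
  induction l with
  | nil => exact ofA_mem 1
  | cons a l ih =>
    have h : dcs (k := k) (a :: l) = d k A (ofA k A a) * dcs l := by simp [dcs]
    rw [h, List.length_cons, add_comm]
    exact mul_mem (d_mem (ofA_mem a)) ih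

theorem kar_pow_dcs (a : A) (l₁ l₂ : List A) :
    (kar k A ^ l₂.length) (ofA k A a * dcs (l₁ ++ l₂)) =
      (-1 : k) ^ (l₂.length * (l₁.length + l₂.length - 1)) • (dcs l₂ * ofA k A a * dcs l₁) := by
  induction l₂ generalizing l₁ with
  | nil => simp [dcs]
  | cons c l₂ ih =>
    have h := ih (l₁ ++ [c])
    rw [List.append_assoc, List.singleton_append] at h
    rw [List.length_cons, pow_succ', Module.End.mul_apply, h, map_smul]
    have e : dcs (k := k) l₂ * ofA k A a * dcs (l₁ ++ [c]) =
        (dcs l₂ * ofA k A a * dcs l₁) * d k A (ofA k A c) := by simp [dcs, mul_assoc]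
    have hm : dcs (k := k) l₂ * ofA k A a * dcs l₁ ∈ homog k A (l₂.length + 0 + l₁.length) :=
      mul_mem (mul_mem (dcs_mem l₂) (ofA_mem a)) (dcs_mem l₁)
    rw [e, kar_mul_d' hm, smul_smul, ← pow_add]
    have e2 : dcs (k := k) (c :: l₂) = d k A (ofA k A c) * dcs l₂ := by simp [dcs]
    rw [e2]
    simp only [mul_assoc]
    congr 2
    simp only [List.length_append, List.length_cons, List.length_nil]
    have h1 : l₁.length + (0 + 1) + l₂.length - 1 = l₁.length + l₂.length := by omega
    have h2 : l₁.length + (l₂.length + 1) - 1 = l₁.length + l₂.length := by omega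
    rw [h1, h2]; ring

/-- The explicit formula for `i` (with `l` counted from zero). -/
theorem contr_apply (a : A) (c : List A) :
    contr k A (ofA k A a * dcs c) =
      ∑ l : Fin c.length, (-1 : k) ^ (l * (c.length - 1) + 1) •
        (ofA k A (c.get l) * (dcs (c.drop (l + 1)) * ofA k A a * dcs (c.take l)) -
          (dcs (c.drop (l + 1)) * ofA k A a * dcs (c.take l)) * ofA k A (c.get l)) := by
  obtain ⟨x, hx⟩ : ofA k A a * dcs c ∈ homog k A (0 + c.length) :=
    mul_mem (ofA_mem a) (dcs_mem c)
  rw [← hx, contr_hom, hx, map_sum, zero_add, ← Finset.sum_range_reflect, Finset.sum_range]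
  refine Finset.sum_congr rfl fun l _ => ?_
  set c₁ := c.take l with hc1
  set c₂ := c.drop (l + 1) with hc2
  have hc : c = c₁ ++ c.get l :: c₂ := by
    rw [hc1, hc2]; simp
  have hl : c₁.length = l := by simp [hc1]
  have hl2 : c.length - 1 - l = c₂.length := by simp [hc2]; omega
  have hlen : c.length = l + c₂.length + 1 := by have := l.2; omega
  have h := kar_pow_dcs (k := k) a (c₁ ++ [c.get l]) c₂
  rw [List.append_assoc, List.singleton_append, ← hc] at h
  rw [hl2, h, map_smul]
  have e : dcs (k := k) c₂ * ofA k A a * dcs (c₁ ++ [c.get l]) =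
      (dcs c₂ * ofA k A a * dcs c₁) * d k A (ofA k A (c.get l)) := by simp [dcs, mul_assoc]
  have hm : dcs (k := k) c₂ * ofA k A a * dcs c₁ ∈ homog k A (c₂.length + 0 + c₁.length) :=
    mul_mem (mul_mem (dcs_mem c₂) (ofA_mem a)) (dcs_mem c₁)
  rw [e, hoch_mul_d' hm, smul_smul, ← pow_add, ← neg_sub, smul_neg, ← neg_smul]
  congr 1
  rw [← neg_one_mul, ← pow_succ']
  simp only [List.length_append, List.length_cons, List.length_nil, hl]
  have h1 : (l : ℕ) + (0 + 1) + c₂.length - 1 = l + c₂.length := by omega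
  have h2 : c.length - 1 = l + c₂.length := by omega
  rw [h1, h2]
  generalize (l : ℕ) = p
  generalize c₂.length = q
  rw [neg_one_pow_congr]
  have h3 := Nat.even_mul_succ_self (p + q)
  simp only [Nat.even_add, Nat.even_mul, Nat.even_add_one] at h3 ⊢
  tauto

/-! The graded commutators, and why `d` and `i` descend to the quotient by them. -/

theorem omega_homog_induction {p : Omega k A → Prop} (h1 : ∀ n, ∀ x ∈ homog k A n, p x)
    (h2 : ∀ x y, p x → p y → p (x + y)) (x : Omega k A) : p x :=
  Omega.induction (fun n x => h1 n _ ⟨x, rfl⟩) h2 x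

theorem d_mul_ofA (c a : A) : d k A (ofA k A c) * ofA k A a =
    d k A (ofA k A (c * a)) - ofA k A c * d k A (ofA k A a) := by
  have := d_mul' (ofA_mem (k := k) c) (ofA k A a)
  rw [ofA_mul, pow_zero, one_smul] at this
  rw [this, add_sub_cancel_right]

theorem hoch_mem {n : ℕ} {x : Omega k A} (hx : x ∈ homog k A (n + 1)) :
    hoch k A x ∈ homog k A n := by
  refine homog_induction (p := fun x => hoch k A x ∈ homog k A n) ?_ ?_ hx
  · intro x hx a
    rw [hoch_mul_d' hx]
    refine Submodule.smul_mem _ _ (sub_mem ?_ ?_)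
    · exact mul_mem hx (ofA_mem a)
    · have := mul_mem (ofA_mem a) hx
      rwa [zero_add] at this
  · intro x y hx hy
    rw [map_add]
    exact add_mem hx hy

theorem hoch_homog_zero {x : Omega k A} (hx : x ∈ homog k A 0) : hoch k A x = 0 := by
  obtain ⟨a, rfl⟩ := homog_zero hx
  exact hoch_ofA a

theorem hoch_hoch (x : Omega k A) : hoch k A (hoch k A x) = 0 := by
  induction x using omega_homog_induction with
  | h1 n x hx =>
    match n, hx with
    | 0, hx => rw [hoch_homog_zero hx, map_zero]
    | 1, hx => exact hoch_homog_zero (hoch_mem hx)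
    | n + 2, hx =>
      refine homog_induction (p := fun x => hoch k A (hoch k A x) = 0) ?_ ?_ hx
      · intro x hx a
        refine homog_induction
          (p := fun x => x ∈ homog k A (n + 1) ∧
            hoch k A (hoch k A (x * d k A (ofA k A a))) = 0) ?_ ?_ hx |>.2
        · intro y hy c
          refine ⟨mul_d_mem hy c, ?_⟩
          have hyc := mul_mem hy (ofA_mem c)
          have hay := mul_mem (ofA_mem a) hy
          rw [zero_add] at hay
          rw [hoch_mul_d' (mul_d_mem hy c), mul_assoc y, d_mul_ofA, mul_sub, ← mul_assoc,
            ← mul_assoc, map_smul, map_sub, map_sub, hoch_mul_d' hy, hoch_mul_d' hyc,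
            hoch_mul_d' hay, add_zero, ← smul_sub, ← smul_sub, ← ofA_mul]
          convert smul_zero _
          convert smul_zero _
          noncomm_ring
        · rintro x y ⟨hx, hx'⟩ ⟨hy, hy'⟩
          refine ⟨add_mem hx hy, ?_⟩
          rw [add_mul, map_add, map_add, hx', hy', add_zero]
      · intro x y hx hy
        rw [map_add, map_add, hx, hy, add_zero]
  | h2 x y hx hy => rw [map_add, map_add, hx, hy, add_zero]

theorem kar_ofA (a : A) : kar k A (ofA k A a) = ofA k A a := by
  simp [kar, ofA, karForm]

/-- `b d + d b = 1 - κ`. -/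
theorem hoch_d_add (x : Omega k A) :
    hoch k A (d k A x) + d k A (hoch k A x) = x - kar k A x := by
  induction x using omega_homog_induction with
  | h1 n x hx =>
    match n, hx with
    | 0, hx =>
      obtain ⟨a, rfl⟩ := homog_zero hx
      have h := hoch_mul_d' (ofA_mem (k := k) (1 : A)) a
      rw [ofA_one, one_mul, one_mul, mul_one, sub_self, smul_zero] at h
      rw [h, hoch_ofA, kar_ofA, map_zero, sub_self, add_zero]
    | n + 1, hx =>
      refine homog_induction (p := fun x => hoch k A (d k A x) + d k A (hoch k A x) =
        x - kar k A x) ?_ ?_ hx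
      · intro x hx a
        have h1 := d_mul' (ofA_mem (k := k) a) x
        rw [pow_zero, one_smul] at h1
        rw [d_mul' hx, d_d, mul_zero, smul_zero, add_zero, hoch_mul_d' (d_mem hx),
          hoch_mul_d' hx, map_smul, map_sub, d_mul' hx, h1, kar_mul_d' hx, pow_succ]
        have h2 : (-1 : k) ^ n * (-1) ^ n = 1 := by rw [← mul_pow]; simp
        simp only [smul_sub, smul_add, smul_smul, h2]
        module
      · intro x y hx hy
        simp only [map_add]
        rw [add_add_add_comm, hx, hy]
        abel
  | h2 x y hx hy =>
    simp only [map_add]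
    rw [add_add_add_comm, hx, hy]
    abel

theorem hoch_kar (x : Omega k A) : hoch k A (kar k A x) = kar k A (hoch k A x) := by
  have h1 := congrArg (hoch k A) (hoch_d_add x)
  have h2 := hoch_d_add (hoch k A x)
  rw [map_add, hoch_hoch, zero_add, map_sub] at h1
  rw [hoch_hoch, map_zero, add_zero] at h2
  rw [h2] at h1
  exact (sub_right_injective h1).symm

theorem hoch_kar_pow (j : ℕ) (x : Omega k A) :
    hoch k A ((kar k A ^ j) x) = (kar k A ^ j) (hoch k A x) := by
  induction j with
  | zero => simp
  | succ j ih => simp only [pow_succ', Module.End.mul_apply, hoch_kar, ih]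

theorem contr_homog {n : ℕ} {x : Omega k A} (hx : x ∈ homog k A n) :
    contr k A x = hoch k A (∑ j ∈ Finset.range n, (kar k A ^ j) x) := by
  obtain ⟨x, rfl⟩ := hx
  exact contr_hom n x

theorem contr_hoch {n : ℕ} {x : Omega k A} (hx : x ∈ homog k A (n + 1)) :
    contr k A (hoch k A x) = 0 := by
  rw [contr_homog (hoch_mem hx), map_sum]
  exact Finset.sum_eq_zero fun j _ => by rw [hoch_kar_pow, hoch_hoch, map_zero]

theorem homog_le_span (n : ℕ) : homog k A n ≤
    Submodule.span k {x | ∃ (a : A) (c : List A), c.length = n ∧ x = ofA k A a * dcs c} := by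
  induction n with
  | zero =>
    intro x hx
    obtain ⟨a, rfl⟩ := homog_zero hx
    exact Submodule.subset_span ⟨a, [], rfl, by simp [dcs]⟩
  | succ n ih =>
    intro x hx
    refine homog_induction (p := fun x => x ∈ Submodule.span k
      {x | ∃ (a : A) (c : List A), c.length = n + 1 ∧ x = ofA k A a * dcs c}) ?_ ?_ hx
    · intro x hx a
      refine Submodule.span_induction (p := fun x _ => x * d k A (ofA k A a) ∈ Submodule.span k
        {x | ∃ (a : A) (c : List A), c.length = n + 1 ∧ x = ofA k A a * dcs c}) ?_ ?_ ?_ ?_ (ih hx)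
      · rintro _ ⟨b, c, hc, rfl⟩
        exact Submodule.subset_span ⟨b, c ++ [a], by simp [hc], by simp [dcs, mul_assoc]⟩
      · simp
      · intro x y _ _ hx hy
        rw [add_mul]
        exact add_mem hx hy
      · intro r x _ hx
        rw [smul_mul_assoc]
        exact Submodule.smul_mem _ _ hx
    · intro x y hx hy
      exact add_mem hx hy

theorem hoch_kar_pow_deg {n : ℕ} {x : Omega k A} (hx : x ∈ homog k A n) :
    hoch k A ((kar k A ^ n) x) = hoch k A x := by
  refine Submodule.span_induction (p := fun x _ => hoch k A ((kar k A ^ n) x) = hoch k A x)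
    ?_ ?_ ?_ ?_ (homog_le_span n hx)
  · rintro _ ⟨a, c, rfl, rfl⟩
    have h := kar_pow_dcs (k := k) a [] c
    rw [List.nil_append, List.length_nil, zero_add,
      (Nat.even_mul_pred_self c.length).neg_one_pow, one_smul] at h
    have h0 : dcs (k := k) ([] : List A) = 1 := by simp [dcs]
    have h1 := hoch_mul_d' (dcs_mem (k := k) c) a
    have h2 := hoch_hoch (dcs c * d k A (ofA k A a))
    rw [h1, map_smul, map_sub] at h2
    have h3 : (-1 : k) ^ c.length * (-1) ^ c.length = 1 := by rw [← mul_pow]; simp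
    have h4 := congrArg (fun y => (-1 : k) ^ c.length • y) h2
    simp only [smul_smul, h3, one_smul, smul_zero] at h4
    rw [h, h0, mul_one]
    exact sub_eq_zero.1 h4
  · simp
  · intro x y _ _ hx hy
    simp only [map_add, hx, hy]
  · intro r x _ hx
    simp only [map_smul, hx]

theorem contr_kar {n : ℕ} {x : Omega k A} (hx : x ∈ homog k A n) :
    contr k A (kar k A x) = contr k A x := by
  rw [contr_homog (kar_mem hx), contr_homog hx, ← sub_eq_zero, ← map_sub,
    ← Finset.sum_sub_distrib]
  have h : ∀ j, (kar k A ^ j) (kar k A x) = (kar k A ^ (j + 1)) x := fun j => by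
    rw [pow_succ, Module.End.mul_apply]
  simp only [h]
  rw [Finset.sum_range_sub (fun j => (kar k A ^ j) x), map_sub, hoch_kar_pow_deg hx]
  simp

variable (k A) in
/-- `[Ω, Ω]`, the span of all graded commutators of homogeneous forms. -/
def comm : Submodule k (Omega k A) :=
  Submodule.span k {w | ∃ (m n : ℕ), ∃ x ∈ homog k A m, ∃ y ∈ homog k A n,
    w = x * y - (-1 : k) ^ (m * n) • (y * x)}

variable (k A) in
/-- `[dΩ, dΩ]`, the span of all graded commutators of exact homogeneous forms. -/
def dcomm : Submodule k (Omega k A) :=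
  Submodule.span k {w | ∃ (m n : ℕ), ∃ x ∈ homog k A m, ∃ y ∈ homog k A n,
    w = d k A x * d k A y - (-1 : k) ^ ((m + 1) * (n + 1)) • (d k A y * d k A x)}

theorem contr_comm_aux {m n : ℕ} {x y : Omega k A} (hx : x ∈ homog k A m)
    (hy : y ∈ homog k A n) :
    contr k A (x * y) = (-1 : k) ^ (m * n) • contr k A (y * x) := by
  induction n generalizing m x y with
  | zero =>
    obtain ⟨a, rfl⟩ := homog_zero hy
    have h := contr_hoch (mul_d_mem hx a)
    rw [hoch_mul_d' hx, map_smul] at h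
    have h3 : (-1 : k) ^ m * (-1) ^ m = 1 := by rw [← mul_pow]; simp
    have h4 := congrArg (fun y => (-1 : k) ^ m • y) h
    simp only [smul_smul, h3, one_smul, smul_zero, map_sub] at h4
    rw [mul_zero, pow_zero, one_smul]
    exact sub_eq_zero.1 h4
  | succ n ih =>
    refine homog_induction (p := fun y => contr k A (x * y) =
      (-1 : k) ^ (m * (n + 1)) • contr k A (y * x)) ?_ ?_ hy
    · intro z hz a
      have h1 := contr_kar (mul_d_mem (mul_mem hx hz) a)
      rw [kar_mul_d' (mul_mem hx hz), map_smul] at h1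
      have h2 := ih (mul_mem (d_mem (ofA_mem a)) hx) hz
      rw [← mul_assoc, ← h1, ← mul_assoc, h2, smul_smul, mul_assoc z, ← pow_add]
      congr 1
      rw [neg_one_pow_congr]
      simp only [Nat.even_add, Nat.even_mul, Nat.even_add_one]
      tauto
    · intro y z hy hz
      rw [mul_add, add_mul, map_add, map_add, hy, hz, smul_add]

theorem contr_comm {w : Omega k A} (hw : w ∈ comm k A) : contr k A w = 0 := by
  refine Submodule.span_induction (p := fun w _ => contr k A w = 0) ?_ ?_ ?_ ?_ hw
  · rintro _ ⟨m, n, x, hx, y, hy, rfl⟩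
    rw [map_sub, map_smul, contr_comm_aux hx hy, sub_self]
  · exact map_zero _
  · intro x y _ _ hx hy
    rw [map_add, hx, hy, add_zero]
  · intro r x _ hx
    rw [map_smul, hx, smul_zero]

theorem d_comm {w : Omega k A} (hw : w ∈ comm k A) : d k A w ∈ comm k A := by
  refine Submodule.span_induction (p := fun w _ => d k A w ∈ comm k A) ?_ ?_ ?_ ?_ hw
  · rintro _ ⟨m, n, x, hx, y, hy, rfl⟩
    have h1 : d k A x * y - (-1 : k) ^ ((m + 1) * n) • (y * d k A x) ∈ comm k A :=
      Submodule.subset_span ⟨_, _, _, d_mem hx, _, hy, rfl⟩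
    have h2 : x * d k A y - (-1 : k) ^ (m * (n + 1)) • (d k A y * x) ∈ comm k A :=
      Submodule.subset_span ⟨_, _, _, hx, _, d_mem hy, rfl⟩
    convert add_mem h1 (Submodule.smul_mem _ ((-1 : k) ^ m) h2) using 1
    have h3 : (-1 : k) ^ m * (-1) ^ (m * (n + 1)) = (-1) ^ (m * n) := by
      rw [← pow_add, neg_one_pow_congr]
      simp only [Nat.even_add, Nat.even_mul, Nat.even_add_one]
      tauto
    rw [map_sub, map_smul, d_mul' hx, d_mul' hy, smul_sub, smul_smul ((-1 : k) ^ m), h3,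
      smul_add, smul_smul, ← pow_add, show m * n + n = (m + 1) * n by ring]
    abel
  · rw [map_zero]; exact zero_mem _
  · intro x y _ _ hx hy
    rw [map_add]
    exact add_mem hx hy
  · intro r x _ hx
    rw [map_smul]
    exact Submodule.smul_mem _ _ hx

/-! ### Reduced forms and the reduced de Rham complex -/

section Reduced

variable (k A)

/-- `k ⊆ Ω⁰ A`. -/
def scal : Submodule k (Omega k A) := LinearMap.range (ofA k A ∘ₗ Algebra.linearMap k A)

variable {k A} in
theorem scal_le_comap {T : Omega k A →ₗ[k] Omega k A} (h : T 1 = 0) :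
    scal k A ≤ (scal k A).comap T := by
  rintro _ ⟨r, rfl⟩
  simp [Algebra.algebraMap_eq_smul_one, ofA_one, h]

/-- `Ω̄ = Ω A / k`. -/
abbrev OmegaBar : Type (max u v) := Omega k A ⧸ scal k A

/-- `d` on `Ω̄`. -/
def dBar : OmegaBar k A →ₗ[k] OmegaBar k A :=
  (scal k A).mapQ (scal k A) (d k A) (scal_le_comap d_one)

/-- `b` on `Ω̄`. -/
def hochBar : OmegaBar k A →ₗ[k] OmegaBar k A :=
  (scal k A).mapQ (scal k A) (hoch k A) (scal_le_comap (hoch_ofA 1))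

/-- `B` on `Ω̄`. -/
def connesBar : OmegaBar k A →ₗ[k] OmegaBar k A :=
  (scal k A).mapQ (scal k A) (connes k A) (scal_le_comap connes_one)

/-- `i` on `Ω̄`. -/
def contrBar : OmegaBar k A →ₗ[k] OmegaBar k A :=
  (scal k A).mapQ (scal k A) (contr k A) (scal_le_comap (contr_ofA 1))

/-- The image of `[Ω, Ω]` in `Ω̄`. -/
def commBar : Submodule k (OmegaBar k A) := (comm k A).map (scal k A).mkQ

/-- The image of `[dΩ, dΩ]` in `Ω̄`. -/
def dcommBar : Submodule k (OmegaBar k A) := (dcomm k A).map (scal k A).mkQ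

/-- The reduced noncommutative de Rham complex `Ω̄ / [Ω, Ω]` (as a module). -/
abbrev DRBar : Type (max u v) := OmegaBar k A ⧸ commBar k A

/-- The projection `f ↦ f_♮` from `Ω̄` to the reduced de Rham complex. -/
def nat : OmegaBar k A →ₗ[k] DRBar k A := (commBar k A).mkQ

/-- The differential of the reduced de Rham complex, induced by `d`. -/
def dDR : DRBar k A →ₗ[k] DRBar k A :=
  (commBar k A).mapQ (commBar k A) (dBar k A) (by
    rintro _ ⟨w, hw, rfl⟩
    exact ⟨d k A w, d_comm hw, by simp [dBar]⟩)

/-- The map from the reduced de Rham complex to `Ω̄` induced by `i`. -/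
def contrDR : DRBar k A →ₗ[k] OmegaBar k A :=
  (commBar k A).liftQ (contrBar k A) (by
    rintro _ ⟨w, hw, rfl⟩
    simp [contrBar, contr_comm hw])

/-- The degree `n` part of `Ω̄`, for `n ∈ ℤ` (zero if `n < 0`). -/
def degBar : ℤ → Submodule k (OmegaBar k A)
  | Int.ofNat n => (homog k A n).map (scal k A).mkQ
  | Int.negSucc _ => ⊥

/-- The degree `n` part of the reduced de Rham complex. -/
def degDR (n : ℤ) : Submodule k (DRBar k A) := (degBar k A n).map (nat k A)

end Reduced

/-! ### Homology groups as subquotients -/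

section Homology

/-- The subquotient `Z / W` (used with `W ⊆ Z`). -/
abbrev SubQuot {M : Type*} [AddCommGroup M] [Module k M] (Z W : Submodule k M) : Type _ :=
  ↥Z ⧸ W.comap Z.subtype

/-- `q ∈ Z / W` is the class represented by `x` (in particular `x ∈ Z`). -/
def Represents {M : Type*} [AddCommGroup M] [Module k M] {Z W : Submodule k M} (x : M)
    (q : SubQuot Z W) : Prop :=
  ∃ h : x ∈ Z, (Submodule.Quotient.mk ⟨x, h⟩ : SubQuot Z W) = q

variable (k A)

/-- The degree `n` part of the Laurent series `Ω̄((u))`, where `|u| = -2`: the series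
`∑ⱼ fⱼ uʲ` with `fⱼ` of degree `n + 2 j`. Such a series is automatically bounded below. -/
def laurent (n : ℤ) : Submodule k (ℤ → OmegaBar k A) where
  carrier := {f | ∀ j, f j ∈ degBar k A (n + 2 * j)}
  add_mem' hf hg j := add_mem (hf j) (hg j)
  zero_mem' _ := zero_mem _
  smul_mem' c _ hf j := Submodule.smul_mem _ c (hf j)

theorem laurent_bounded {n : ℤ} {f : ℤ → OmegaBar k A} (hf : f ∈ laurent k A n) (j : ℤ)
    (hj : n + 2 * j < 0) : f j = 0 := by
  have h := hf j
  obtain ⟨m, hm⟩ := Int.eq_negSucc_of_lt_zero hj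
  rw [hm] at h
  exact h

/-- The degree `n` part of the power series `Ω̄[[u]]`. -/
def power (n : ℤ) : Submodule k (ℤ → OmegaBar k A) where
  carrier := {f | f ∈ laurent k A n ∧ ∀ j < 0, f j = 0}
  add_mem' hf hg := ⟨add_mem hf.1 hg.1, fun j hj => by simp [hf.2 j hj, hg.2 j hj]⟩
  zero_mem' := ⟨zero_mem _, fun _ _ => rfl⟩
  smul_mem' c _ hf := ⟨Submodule.smul_mem _ c hf.1, fun j hj => by simp [hf.2 j hj]⟩

/-- The degree `n` part of `Ω̄ ⊗ R`, where `R = k((u)) / u k[[u]]`: polynomials in `u⁻¹`. -/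
def polar (n : ℤ) : Submodule k (ℤ → OmegaBar k A) where
  carrier := {f | f ∈ laurent k A n ∧ ∀ j, 0 < j → f j = 0}
  add_mem' hf hg := ⟨add_mem hf.1 hg.1, fun j hj => by simp [hf.2 j hj, hg.2 j hj]⟩
  zero_mem' := ⟨zero_mem _, fun _ _ => rfl⟩
  smul_mem' c _ hf := ⟨Submodule.smul_mem _ c hf.1, fun j hj => by simp [hf.2 j hj]⟩

/-- Multiplication by `u`. -/
def mulU : (ℤ → OmegaBar k A) →ₗ[k] (ℤ → OmegaBar k A) :=
  LinearMap.funLeft k (OmegaBar k A) fun j => j - 1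

/-- A form as a series constant in `u`. -/
def const : OmegaBar k A →ₗ[k] (ℤ → OmegaBar k A) := LinearMap.single k (fun _ => OmegaBar k A) 0

/-- The differential `b - u B` on series. -/
def diffBB : (ℤ → OmegaBar k A) →ₗ[k] (ℤ → OmegaBar k A) :=
  (hochBar k A).compLeft ℤ - mulU k A ∘ₗ (connesBar k A).compLeft ℤ

/-- The differential `i - u d` on series. -/
def diffID : (ℤ → OmegaBar k A) →ₗ[k] (ℤ → OmegaBar k A) :=
  (contrBar k A).compLeft ℤ - mulU k A ∘ₗ (dBar k A).compLeft ℤ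

/-- Discarding the positive powers of `u`. -/
def truncate : (ℤ → OmegaBar k A) →ₗ[k] (ℤ → OmegaBar k A) :=
  LinearMap.pi fun j => if 0 < j then 0 else LinearMap.proj j

/-! The standard definitions. -/

/-- Reduced Hochschild homology `H_n(Ω̄, b)`. -/
abbrev HHStd (n : ℤ) : Type (max u v) :=
  SubQuot (degBar k A n ⊓ LinearMap.ker (hochBar k A))
    ((degBar k A (n + 1)).map (hochBar k A))

/-- Reduced cyclic homology `H_n(Ω̄ ⊗ R, b - u B)`. -/
abbrev HCStd (n : ℤ) : Type (max u v) :=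
  SubQuot (polar k A n ⊓ LinearMap.ker (truncate k A ∘ₗ diffBB k A))
    ((polar k A (n + 1)).map (truncate k A ∘ₗ diffBB k A))

/-- Reduced negative cyclic homology `H_n(Ω̄[[u]], b - u B)`. -/
abbrev HCNegStd (n : ℤ) : Type (max u v) :=
  SubQuot (power k A n ⊓ LinearMap.ker (diffBB k A)) ((power k A (n + 1)).map (diffBB k A))

/-- Reduced periodic cyclic homology `H_n(Ω̄((u)), b - u B)`. -/
abbrev HCPerStd (n : ℤ) : Type (max u v) :=
  SubQuot (laurent k A n ⊓ LinearMap.ker (diffBB k A)) ((laurent k A (n + 1)).map (diffBB k A))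

/-! The noncommutative de Rham models. -/

/-- Reduced Karoubi-de Rham homology. -/
abbrev HD (n : ℤ) : Type (max u v) :=
  SubQuot (degDR k A n ⊓ LinearMap.ker (dDR k A)) ((degDR k A (n - 1)).map (dDR k A))

/-- De Rham model of Hochschild homology: the kernel of `i` on the reduced de Rham complex in
degree `n`. -/
def HH (n : ℤ) : Submodule k (DRBar k A) := degDR k A n ⊓ LinearMap.ker (contrDR k A)

/-- De Rham model of cyclic homology: with `DR` the reduced de Rham complex, the kernel of
`i : DRⁿ / d DRⁿ⁻¹ → Ω̄ⁿ⁻¹ / d Ω̄ⁿ⁻²`. -/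
abbrev HC (n : ℤ) : Type (max u v) :=
  SubQuot (degDR k A n ⊓ ((degBar k A (n - 2)).map (dBar k A)).comap (contrDR k A))
    ((degDR k A (n - 1)).map (dDR k A))

/-- De Rham model of negative cyclic homology: `H_n(Ω̄[[u]], i - u d) / [dΩ, dΩ]`, where
`[dΩ, dΩ]` is placed in the constant terms. -/
abbrev HCNeg (n : ℤ) : Type (max u v) :=
  SubQuot (power k A n ⊓ LinearMap.ker (diffID k A))
    ((power k A (n + 1)).map (diffID k A) ⊔ (dcommBar k A ⊓ degBar k A n).map (const k A))

/-- De Rham model of periodic cyclic homology: `H_n(Ω̄((u)), i - u d)`. -/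
abbrev HCPer (n : ℤ) : Type (max u v) :=
  SubQuot (laurent k A n ⊓ LinearMap.ker (diffID k A)) ((laurent k A (n + 1)).map (diffID k A))

/-- `Z_n`: the power series `f` of degree `n` such that `(i - u d) f` is independent of `u`. -/
def Zser (n : ℤ) : Submodule k (ℤ → OmegaBar k A) where
  carrier := {f | f ∈ power k A n ∧ ∀ j, j ≠ 0 → diffID k A f j = 0}
  add_mem' hf hg := ⟨add_mem hf.1 hg.1, fun j hj => by simp [hf.2 j hj, hg.2 j hj]⟩
  zero_mem' := ⟨zero_mem _, fun _ _ => by simp⟩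
  smul_mem' c _ hf := ⟨Submodule.smul_mem _ c hf.1, fun j hj => by simp [hf.2 j hj]⟩

/-- `f ↦ (f₀)_♮`, where `f₀` is the constant term of the series `f`. -/
def constTerm : (ℤ → OmegaBar k A) →ₗ[k] DRBar k A := nat k A ∘ₗ LinearMap.proj 0

/-- The subgroup of `HD n` of the classes `(f₀)_♮`, `f ∈ Z_n`. -/
def HD' (n : ℤ) : Submodule k (HD k A n) :=
  (((Zser k A n).map (constTerm k A)).comap
    (degDR k A n ⊓ LinearMap.ker (dDR k A)).subtype).map (Submodule.mkQ _)

/-- The subgroup of `HH n` of the classes `(f₀)_♮`, where `f` is a cycle of degree `n` in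
`(Ω̄[[u]], i - u d)`. -/
def HH' (n : ℤ) : Submodule k (HH k A n) :=
  ((power k A n ⊓ LinearMap.ker (diffID k A)).map (constTerm k A)).comap (HH k A n).subtype

/-- On series of total degree `n`: divide the component of form degree `p` by `p!`. -/
def rescale [Algebra ℚ k] (n : ℤ) (f : ℤ → OmegaBar k A) : ℤ → OmegaBar k A :=
  fun j => algebraMap ℚ k ((n + 2 * j).toNat.factorial : ℚ)⁻¹ • f j

end Homology

end NCForms

end

open NCForms

noncomputable section

namespace NCForms

universe u v

/-! Everything rests on the Karoubi operator `κ = 1 - (bd + db)`. On `Ωⁿ` it satisfies `(κⁿ -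
1)(κⁿ⁺¹ - 1) = 0` (`kar_pow_sub_one`). For `n > 0` this polynomial has 1 as a double root, and over
`ℚ` the remaining factor is prime to `X - 1`. Hence `1 - κ` has a Drazin inverse `G` (`green`), and
`P = 1 - (1 - κ)G` (`harm`) projects onto the part where `(1 - κ)² = 0`. Both commute with `b` and
`d`, which commute with `κ`.

On the image of `P`, powers of `κ` fix `dP` and `bP`, so unipotence in characteristic zero makes `κ`
itself fix them. The averages defining `B` and `i` then collapse to `B = (n+1) dP` and `i = n bP` on
`Ωⁿ` (`connes_eq`, `contr_eq`). Dividing degree `p` by `p!` and applying `P` therefore turns `b -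
uB` into `i - ud` (`diffID_harmDiv`, `diffBB_harmMul`). The same analysis gives `id + di = 0`
(`contr_d_add`).

On the complement of `P`, both `B` and `i` vanish. There `bd + db` is invertible, so the `b - uB`
complexes are acyclic, with homotopy `dG`. The `i - ud` complex reduces to `-ud`, and the splitting
of `k → A` makes `d` exact on `Ω̄` (`exists_contraction`). So nothing survives for Laurent series,
while for power series the closed constant terms killed by `P` survive. These are exactly the
reduced `[dΩ, dΩ]` (`mem_dcommBar_iff`), which explains the quotient in negative cyclic homology.

The de Rham quotient fits in because `[Ω, Ω] = bΩ + (1 - κ)Ω`: a form `f` has `f_♮ = 0` exactly when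
`Pf` lies in the image of `i` (`nat_eq_zero_iff`). Hochschild homology follows at once. For cyclic
homology a constant term extends downwards in powers of `u`, by solving `d g_{j-1} = i g_j - f_j`
with the contraction (`exists_descending`).

The diagram is then handled on representatives with `i - ud` alone. Besides descending extension the
main tools are discarding negative powers of `u`, which leaves the defect `d f_{-1}`
(`diffID_posPart`), and dividing by `u` a series without constant term. -/

/-- A Drazin inverse of `l` commutes with everything that commutes with `l`. -/
theorem drazin_commute {R : Type*} [Ring R] {l g t : R} (hlg : l * g = g * l)
    (h1 : g * l * g = g) (h2 : l * l * l * g = l * l) (ht : t * l = l * t) : t * g = g * t := by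
  have e1 : l * g = g * g * (l * l) := by
    calc l * g = l * (g * l * g) := by rw [h1]
      _ = (l * g) * (l * g) := by noncomm_ring
      _ = (g * l) * (g * l) := by rw [hlg]
      _ = g * (l * g) * l := by noncomm_ring
      _ = g * (g * l) * l := by rw [hlg]
      _ = _ := by noncomm_ring
  have e2 : l * g = l * l * (g * g) := by
    calc l * g = l * (g * l * g) := by rw [h1]
      _ = l * (g * l) * g := by noncomm_ring
      _ = l * (l * g) * g := by rw [hlg]
      _ = _ := by noncomm_ring
  have hp1 : l * l * (1 - l * g) = 0 := by
    calc l * l * (1 - l * g) = l * l - l * l * l * g := by noncomm_ring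
      _ = 0 := by rw [h2, sub_self]
  have hp2 : (1 - l * g) * (l * l) = 0 := by
    calc (1 - l * g) * (l * l) = l * l - l * (g * l) * l := by noncomm_ring
      _ = l * l - l * (l * g) * l := by rw [← hlg]
      _ = l * l - l * l * (g * l) := by noncomm_ring
      _ = l * l - l * l * l * g := by rw [← hlg]; noncomm_ring
      _ = 0 := by rw [h2, sub_self]
  have ht2 : t * (l * l) = l * l * t := by
    rw [← mul_assoc, ht, mul_assoc, ht, mul_assoc]
  have a1 : (l * g) * t * (1 - l * g) = 0 := by
    calc (l * g) * t * (1 - l * g) = g * g * (l * l * t) * (1 - l * g) := by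
          rw [e1]; noncomm_ring
      _ = g * g * t * (l * l * (1 - l * g)) := by rw [← ht2]; noncomm_ring
      _ = 0 := by rw [hp1, mul_zero]
  have a2 : (1 - l * g) * t * (l * g) = 0 := by
    calc (1 - l * g) * t * (l * g) = (1 - l * g) * (t * (l * l)) * (g * g) := by
          rw [e2]; noncomm_ring
      _ = (1 - l * g) * (l * l) * (t * (g * g)) := by rw [ht2]; noncomm_ring
      _ = 0 := by rw [hp2, zero_mul]
  have a3 : t * (l * g) = (l * g) * t := by
    have : t * (l * g) - (l * g) * t =
      (1 - l * g) * t * (l * g) - (l * g) * t * (1 - l * g) := by noncomm_ring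
    rwa [a1, a2, sub_zero, sub_eq_zero] at this
  calc t * g = t * ((g * l) * g) := by rw [h1]
    _ = t * (l * g) * g := by rw [← hlg]; noncomm_ring
    _ = g * (l * t) * g := by rw [a3, hlg]; noncomm_ring
    _ = g * (t * (l * g)) := by rw [← ht]; noncomm_ring
    _ = g * l * g * t := by rw [a3]; noncomm_ring
    _ = g * t := by rw [h1]

/-! ### The polynomial identity for the Karoubi operator and its Drazin inverse -/

section

variable {k : Type u} [CommRing k] {A : Type v} [Ring A] [Algebra k A]

/-- `1 - κ = bd + db` commutes with `d` because `d² = 0`. -/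
theorem kar_d (x : Omega k A) : kar k A (d k A x) = d k A (kar k A x) := by
  have h1 := congrArg (d k A) (hoch_d_add x)
  have h2 := hoch_d_add (d k A x)
  rw [map_add, d_d, add_zero, map_sub] at h1
  rw [d_d, map_zero, zero_add] at h2
  rw [h2] at h1
  exact sub_right_injective h1

theorem d_dcs (l : List A) : d k A (dcs l) = 0 := by
  induction l with
  | nil => exact d_one
  | cons a l ih =>
    have h : dcs (k := k) (a :: l) = d k A (ofA k A a) * dcs l := by simp [dcs]
    rw [h, d_mul' (d_mem (ofA_mem a)), d_d, ih, zero_mul, mul_zero, smul_zero, add_zero]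

theorem d_ofA_mul_dcs (a : A) (c : List A) : d k A (ofA k A a * dcs c) = dcs (a :: c) := by
  rw [d_mul' (ofA_mem a), d_dcs, mul_zero, smul_zero, add_zero]
  simp [dcs]

theorem homog_dcs_induction {n : ℕ} {S T : Omega k A →ₗ[k] Omega k A}
    (h : ∀ (a : A) (c : List A), c.length = n → S (ofA k A a * dcs c) = T (ofA k A a * dcs c))
    {x : Omega k A} (hx : x ∈ homog k A n) : S x = T x := by
  refine Submodule.span_induction (p := fun x _ => S x = T x) ?_ ?_ ?_ ?_ (homog_le_span n hx)
  · rintro _ ⟨a, c, hc, rfl⟩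
    exact h a c hc
  · simp
  · intro x y _ _ hx hy
    simp only [map_add, hx, hy]
  · intro r x _ hx
    simp only [map_smul, hx]

/-- Applying `κ` to `da₀ da₁ ⋯ daₙ` rotates the factors cyclically. After `n + 1` rotations the
order is restored, with total sign `(-1)^(n(n+1)) = 1`. -/
theorem kar_pow_succ_d {n : ℕ} {x : Omega k A} (hx : x ∈ homog k A n) :
    (kar k A ^ (n + 1)) (d k A x) = d k A x := by
  refine homog_dcs_induction (S := (kar k A ^ (n + 1)) ∘ₗ d k A) (T := d k A) ?_ hx
  rintro a c rfl
  have h := kar_pow_dcs (k := k) (1 : A) [] (a :: c)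
  have h0 : dcs (k := k) ([] : List A) = 1 := by simp [dcs]
  rw [List.nil_append, List.length_nil, zero_add, (Nat.even_mul_pred_self _).neg_one_pow,
    one_smul, ofA_one, one_mul, h0, mul_one, mul_one, List.length_cons] at h
  rw [LinearMap.comp_apply, d_ofA_mul_dcs, h]

/-- On a monomial, `κⁿ` carries all differentials in front of the coefficient: `κⁿ(a ω) = ω a` with
`ω = dc₁ ⋯ dcₙ`. The discrepancy `[ω, a]` is up to sign `b(ω da)`, and `ω da` is up to sign `κⁿ(da
ω)`. The signs cancel. -/
theorem kar_pow_deg {n : ℕ} {x : Omega k A} (hx : x ∈ homog k A n) :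
    (kar k A ^ n) x = x + hoch k A ((kar k A ^ n) (d k A x)) := by
  refine homog_dcs_induction (S := kar k A ^ n)
    (T := LinearMap.id + hoch k A ∘ₗ (kar k A ^ n) ∘ₗ d k A) ?_ hx
  rintro a c rfl
  have h := kar_pow_dcs (k := k) a [] c
  have h' := kar_pow_dcs (k := k) (1 : A) [a] c
  have h0 : dcs (k := k) ([] : List A) = 1 := by simp [dcs]
  have h1 : dcs (k := k) [a] = d k A (ofA k A a) := by simp [dcs]
  rw [List.nil_append, List.length_nil, zero_add, (Nat.even_mul_pred_self _).neg_one_pow,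
    one_smul, h0, mul_one] at h
  rw [ofA_one, one_mul, mul_one, List.singleton_append, h1] at h'
  simp only [LinearMap.add_apply, LinearMap.comp_apply, LinearMap.id_apply]
  rw [d_ofA_mul_dcs, h, h', map_smul, hoch_mul_d' (dcs_mem c), smul_smul, ← pow_add]
  have : Even (c.length * ([a].length + c.length - 1) + c.length) := by
    rw [List.length_singleton, Nat.add_sub_cancel_left, ← Nat.mul_succ]
    exact Nat.even_mul_succ_self _
  rw [this.neg_one_pow, one_smul]
  abel

/-- On `Ωⁿ A` the Karoubi operator satisfies `(κⁿ - 1)(κⁿ⁺¹ - 1) = 0`. -/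
theorem kar_pow_sub_one {n : ℕ} {x : Omega k A} (hx : x ∈ homog k A n) :
    (kar k A ^ (n + 1) - 1) ((kar k A ^ n - 1) x) = 0 := by
  -- The factor `κⁿ - 1` lands in `b κⁿ d`, and `κⁿ⁺¹` passes through `b` and fixes `dx`.
  have h : (kar k A ^ n - 1) x = hoch k A ((kar k A ^ n) (d k A x)) := by
    rw [LinearMap.sub_apply, kar_pow_deg hx]; simp
  rw [h, LinearMap.sub_apply, ← hoch_kar_pow, ← Module.End.mul_apply (kar k A ^ (n + 1)),
    ← pow_add, add_comm, pow_add, Module.End.mul_apply, kar_pow_succ_d hx]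
  simp

theorem aeval_kar_mem {n : ℕ} (p : Polynomial k) {x : Omega k A} (hx : x ∈ homog k A n) :
    Polynomial.aeval (kar k A) p x ∈ homog k A n := by
  rw [Polynomial.aeval_eq_sum_range, LinearMap.sum_apply]
  exact sum_mem fun i _ => Submodule.smul_mem _ _ (kar_pow_mem i hx)

/-- An endomorphism acting on `Ωⁿ A` as the polynomial `p n` in the Karoubi operator. -/
def polyKar (p : ℕ → Polynomial k) : Module.End k (Omega k A) :=
  Omega.lift fun n => Polynomial.aeval (kar k A) (p n) ∘ₗ hom k A n

theorem polyKar_homog (p : ℕ → Polynomial k) {n : ℕ} {x : Omega k A} (hx : x ∈ homog k A n) :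
    polyKar p x = Polynomial.aeval (kar k A) (p n) x := by
  obtain ⟨x, rfl⟩ := hx
  simp [polyKar]

theorem omega_ext {S T : Omega k A →ₗ[k] Omega k A}
    (h : ∀ n, ∀ x ∈ homog k A n, S x = T x) : S = T := by
  ext x
  induction x using omega_homog_induction with
  | h1 n x hx => exact h n x hx
  | h2 x y hx hy => rw [map_add, map_add, hx, hy]

theorem polyKar_kar (p : ℕ → Polynomial k) :
    (polyKar p : Module.End k (Omega k A)) * kar k A = kar k A * polyKar p := by
  refine omega_ext fun n x hx => ?_
  rw [Module.End.mul_apply, Module.End.mul_apply, polyKar_homog p hx,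
    polyKar_homog p (kar_mem hx)]
  have h : Polynomial.aeval (kar k A) (p n * Polynomial.X) =
    Polynomial.aeval (kar k A) (Polynomial.X * p n) := by rw [mul_comm]
  rw [map_mul, map_mul, Polynomial.aeval_X] at h
  exact LinearMap.congr_fun h x

open Polynomial in
-- The product on the right is `(1 - X)²` times two geometric sums whose values at 1 are the
-- invertible numbers `n + 1` and `n + 2`. Modulo this product `(1 - X)²` is thus a multiple of `(1
-- - X)³`. The witness `p` comes from expanding the product of the sums around `X = 1`.
theorem exists_geom_poly [Algebra ℚ k] (n : ℕ) : ∃ p q : k[X],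
    (1 - X) ^ 3 * p - (1 - X) ^ 2 = q * ((X ^ (n + 2) - 1) * (X ^ (n + 1) - 1)) := by
  have key : ∀ m : ℕ, ∃ t : k[X], ∑ j ∈ Finset.range m, X ^ j = (m : k[X]) + (1 - X) * t := by
    intro m
    have h : (X - C 1 : k[X]) ∣ ∑ j ∈ Finset.range m, X ^ j - (m : k[X]) := by
      rw [dvd_iff_isRoot, IsRoot.def]
      simp [eval_finsetSum]
    obtain ⟨t, ht⟩ := h
    refine ⟨-t, ?_⟩
    rw [sub_eq_iff_eq_add] at ht
    rw [ht, C_1]; ring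
  obtain ⟨t₁, h₁⟩ := key (n + 1)
  obtain ⟨t₂, h₂⟩ := key (n + 2)
  have g1 := mul_geom_sum (X : k[X]) (n + 1)
  have g2 := mul_geom_sum (X : k[X]) (n + 2)
  set c : k[X] := C (algebraMap ℚ k (((n + 1 : ℕ) : ℚ) * ((n + 2 : ℕ) : ℚ))⁻¹) with hc
  have hc1 : c * (((n + 1 : ℕ) : k[X]) * ((n + 2 : ℕ) : k[X])) = 1 := by
    have h3 : (((n + 1 : ℕ) : k[X]) * ((n + 2 : ℕ) : k[X])) =
        C (algebraMap ℚ k (((n + 1 : ℕ) : ℚ) * ((n + 2 : ℕ) : ℚ))) := by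
      simp only [map_mul, map_natCast]
    have h4 : (((n + 1 : ℕ) : ℚ) * ((n + 2 : ℕ) : ℚ)) ≠ 0 := by positivity
    rw [h3, hc, ← C_mul, ← map_mul, inv_mul_cancel₀ h4, map_one, C_1]
  refine ⟨-(c * (((n + 1 : ℕ) : k[X]) * t₂ + ((n + 2 : ℕ) : k[X]) * t₁ + (1 - X) * t₁ * t₂)),
    -c, ?_⟩
  rw [← g1, ← g2, h₁, h₂]
  linear_combination ((1 - X) ^ 2) * hc1

theorem exists_drazin_kar [Algebra ℚ k] : ∃ G : Module.End k (Omega k A),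
    (∀ n, ∀ x ∈ homog k A n, G x ∈ homog k A n) ∧ (1 - kar k A) * G = G * (1 - kar k A) ∧
      G * (1 - kar k A) * G = G ∧
      (1 - kar k A) * (1 - kar k A) * (1 - kar k A) * G = (1 - kar k A) * (1 - kar k A) := by
  choose p q hpq using exists_geom_poly (k := k)
  -- The polynomial `p n` serves degree `n + 1`. In degree 0, `κ` is the identity, so `1 - κ = 0`
  -- and the value 0 will do.
  let p' : ℕ → Polynomial k := fun n => Nat.casesOn n 0 p
  set r : Module.End k (Omega k A) := polyKar p'
  set l : Module.End k (Omega k A) := 1 - kar k A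
  have hlr : Commute l r := by
    change (1 - kar k A) * r = r * (1 - kar k A)
    rw [sub_mul, mul_sub, polyKar_kar, one_mul, mul_one]
  have h3 : l ^ 3 * r = l ^ 2 := by
    refine omega_ext fun n x hx => ?_
    rw [Module.End.mul_apply, polyKar_homog p' hx]
    match n, hx with
    | 0, hx =>
      obtain ⟨a, rfl⟩ := homog_zero hx
      have : l (ofA k A a) = 0 := by simp [l, kar_ofA]
      simp [p', pow_two, this]
    | n + 1, hx =>
      change (l ^ 3) (Polynomial.aeval (kar k A) (p n) x) = _
      have h := congrArg (Polynomial.aeval (kar k A)) (hpq n)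
      simp only [map_sub, map_mul, map_pow, map_one, Polynomial.aeval_X] at h
      have h' := LinearMap.congr_fun h x
      rw [LinearMap.sub_apply, Module.End.mul_apply, Module.End.mul_apply, Module.End.mul_apply,
        kar_pow_sub_one hx, map_zero, sub_eq_zero] at h'
      exact h'
  have hmem : ∀ n, ∀ x ∈ homog k A n, r x ∈ homog k A n := fun n x hx => by
    rw [polyKar_homog p' hx]; exact aeval_kar_mem _ hx
  have lmem : ∀ n, ∀ x ∈ homog k A n, l x ∈ homog k A n := fun n x hx =>
    sub_mem hx (kar_mem hx)
  -- Only `l³ r = l²` and commutation are used from here on: `l²` absorbs every power of `lr`, which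
  -- makes `l² r³` a Drazin inverse.
  have h5 : l ^ 2 * (l * r) = l ^ 2 := by rw [← mul_assoc, ← pow_succ, h3]
  have h6 : ∀ m, l ^ 2 * (l * r) ^ m = l ^ 2 := fun m => by
    induction m with
    | zero => simp
    | succ m ih => rw [pow_succ (l * r), ← mul_assoc, ih, h5]
  have hc : Commute l (l ^ 2 * r ^ 3) :=
    ((Commute.refl l).pow_right 2).mul_right (hlr.pow_right 3)
  have h7 : l * (l ^ 2 * r ^ 3) = (l * r) ^ 3 := by
    rw [hlr.mul_pow, ← mul_assoc, ← pow_succ']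
  refine ⟨l ^ 2 * r ^ 3, ?_, hc, ?_, ?_⟩
  · intro n x hx
    simp only [pow_succ, pow_zero, one_mul, Module.End.mul_apply]
    exact lmem _ _ (lmem _ _ (hmem _ _ (hmem _ _ (hmem _ _ hx))))
  · have h8 : r ^ 3 * (l * r) ^ 3 = (l * r) ^ 3 * r ^ 3 := by
      rw [hlr.mul_pow]
      exact ((hlr.symm.pow_pow 3 3).mul_right ((Commute.refl r).pow_pow 3 3))
    rw [mul_assoc, h7, mul_assoc, h8, ← mul_assoc, h6]
  · rw [mul_assoc, h7]
    have := h6 3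
    rwa [pow_two] at this

end

/-! ### The harmonic projection, and formulas for `B` and `i` in terms of it -/

theorem nsmul_eq_zero_of_rat {k : Type*} [CommRing k] [Algebra ℚ k] {M : Type*} [AddCommGroup M]
    [Module k M] {n : ℕ} (hn : n ≠ 0) {x : M} (h : n • x = 0) : x = 0 := by
  have h1 : algebraMap ℚ k (n : ℚ)⁻¹ • (n • x) = x := by
    rw [← Nat.cast_smul_eq_nsmul k, smul_smul, ← map_natCast (algebraMap ℚ k), ← map_mul,
      inv_mul_cancel₀ (by exact_mod_cast hn), map_one, one_smul]
  rw [← h1, h, smul_zero]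

section

variable {k : Type u} [CommRing k] {A : Type v} [Ring A] [Algebra k A]

theorem lap_d (x : Omega k A) : (1 - kar k A) (d k A x) = d k A ((1 - kar k A) x) := by
  simp [kar_d]

theorem lap_hoch (x : Omega k A) : (1 - kar k A) (hoch k A x) = hoch k A ((1 - kar k A) x) := by
  simp [hoch_kar]

theorem kar_pow_eq {y : Omega k A} (h : kar k A y = y) (j : ℕ) : (kar k A ^ j) y = y := by
  induction j with
  | zero => simp
  | succ j ih => rw [pow_succ', Module.End.mul_apply, ih, h]

theorem connes_homog {n : ℕ} {x : Omega k A} (hx : x ∈ homog k A n) :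
    connes k A x = ∑ j ∈ Finset.range (n + 1), (kar k A ^ j) (d k A x) := by
  obtain ⟨x, rfl⟩ := hx
  exact connes_hom n x

theorem contr_mem {n : ℕ} {x : Omega k A} (hx : x ∈ homog k A (n + 1)) :
    contr k A x ∈ homog k A n := by
  rw [contr_homog hx]
  exact hoch_mem (sum_mem fun j _ => kar_pow_mem j hx)

theorem sum_kar_pow (m : ℕ) (y : Omega k A) :
    ∑ j ∈ Finset.range m, (kar k A ^ j) ((1 - kar k A) y) = y - (kar k A ^ m) y := by
  have h : ∀ j, (kar k A ^ j) ((1 - kar k A) y) =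
      (kar k A ^ j) y - (kar k A ^ (j + 1)) y := fun j => by
    rw [pow_succ, Module.End.mul_apply, LinearMap.sub_apply, map_sub]; simp
  simp only [h]
  rw [Finset.sum_range_sub' (fun j => (kar k A ^ j) y)]
  simp

/-- The binomial expansion of `(1 - (1 - κ))^m` stops after its linear term. -/
theorem kar_pow_of_lap_lap {y : Omega k A} (h : (1 - kar k A) ((1 - kar k A) y) = 0) (m : ℕ) :
    (kar k A ^ m) y = y - m • (1 - kar k A) y := by
  induction m with
  | zero => simp
  | succ m ih =>
    have h1 : kar k A ((1 - kar k A) y) = (1 - kar k A) y := by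
      rw [LinearMap.sub_apply, Module.End.one_apply, sub_eq_zero] at h
      exact h.symm
    rw [pow_succ', Module.End.mul_apply, ih, map_sub, map_nsmul, h1, succ_nsmul]
    simp
    abel

end

section

variable (k : Type u) [CommRing k] [Algebra ℚ k] (A : Type v) [Ring A] [Algebra k A]

/-- The Drazin inverse of `1 - κ = b d + d b`. -/
def green : Module.End k (Omega k A) := (exists_drazin_kar (k := k) (A := A)).choose

/-- The projection onto the generalized eigenspace of `κ` for the eigenvalue `1`. -/
def harm : Module.End k (Omega k A) := 1 - (1 - kar k A) * green k A

variable {k A}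

theorem green_mem {n : ℕ} {x : Omega k A} (hx : x ∈ homog k A n) : green k A x ∈ homog k A n :=
  (exists_drazin_kar (k := k) (A := A)).choose_spec.1 n x hx

theorem lap_green : (1 - kar k A) * green k A = green k A * (1 - kar k A) :=
  (exists_drazin_kar (k := k) (A := A)).choose_spec.2.1

theorem green_lap_green : green k A * (1 - kar k A) * green k A = green k A :=
  (exists_drazin_kar (k := k) (A := A)).choose_spec.2.2.1

theorem lap_lap_lap_green : (1 - kar k A) * (1 - kar k A) * (1 - kar k A) * green k A =
    (1 - kar k A) * (1 - kar k A) :=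
  (exists_drazin_kar (k := k) (A := A)).choose_spec.2.2.2

theorem commute_green {t : Module.End k (Omega k A)} (ht : t * kar k A = kar k A * t) :
    t * green k A = green k A * t :=
  drazin_commute lap_green green_lap_green lap_lap_lap_green (by
    rw [mul_sub, sub_mul, ht, one_mul, mul_one])

theorem commute_harm {t : Module.End k (Omega k A)} (ht : t * kar k A = kar k A * t) :
    t * harm k A = harm k A * t := by
  have h : t * (1 - kar k A) = (1 - kar k A) * t := by rw [mul_sub, sub_mul, ht, one_mul, mul_one]
  have h' := commute_green ht
  rw [harm]
  generalize 1 - kar k A = l at h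
  rw [mul_sub, sub_mul, one_mul, mul_one, ← mul_assoc, h, mul_assoc, mul_assoc, h']

theorem green_d (x : Omega k A) : green k A (d k A x) = d k A (green k A x) :=
  (LinearMap.congr_fun (commute_green (t := d k A)
    (LinearMap.ext fun x => (kar_d x).symm)) x).symm

theorem green_hoch (x : Omega k A) : green k A (hoch k A x) = hoch k A (green k A x) :=
  (LinearMap.congr_fun (commute_green (t := hoch k A)
    (LinearMap.ext fun x => hoch_kar x)) x).symm

theorem harm_d (x : Omega k A) : harm k A (d k A x) = d k A (harm k A x) :=
  (LinearMap.congr_fun (commute_harm (t := d k A)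
    (LinearMap.ext fun x => (kar_d x).symm)) x).symm

theorem harm_hoch (x : Omega k A) : harm k A (hoch k A x) = hoch k A (harm k A x) :=
  (LinearMap.congr_fun (commute_harm (t := hoch k A)
    (LinearMap.ext fun x => hoch_kar x)) x).symm

theorem harm_kar (x : Omega k A) : harm k A (kar k A x) = kar k A (harm k A x) :=
  (LinearMap.congr_fun (commute_harm (t := kar k A) rfl) x).symm

theorem harm_mem {n : ℕ} {x : Omega k A} (hx : x ∈ homog k A n) : harm k A x ∈ homog k A n :=
  sub_mem hx (sub_mem (green_mem hx) (kar_mem (green_mem hx)))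

theorem harm_mul_green : harm k A * green k A = 0 := by
  rw [harm, lap_green, sub_mul, one_mul, green_lap_green, sub_self]

theorem harm_green (x : Omega k A) : harm k A (green k A x) = 0 := by
  rw [← Module.End.mul_apply, harm_mul_green, LinearMap.zero_apply]

/-- The Hodge-type decomposition: `1 - P = (1 - κ)G` and `1 - κ = bd + db`. -/
theorem sub_harm (x : Omega k A) :
    x - harm k A x = hoch k A (d k A (green k A x)) + d k A (hoch k A (green k A x)) := by
  rw [hoch_d_add]
  simp [harm]

theorem harm_harm (x : Omega k A) : harm k A (harm k A x) = harm k A x := by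
  have : harm k A (x - harm k A x) = 0 := by
    rw [sub_harm, map_add, harm_hoch, harm_d, harm_d, harm_hoch, harm_green]
    simp
  rw [map_sub, sub_eq_zero] at this
  exact this.symm

theorem lap_lap_harm (x : Omega k A) : (1 - kar k A) ((1 - kar k A) (harm k A x)) = 0 := by
  have h : (1 - kar k A) * (1 - kar k A) * harm k A = 0 := by
    rw [harm, mul_sub, mul_one, ← mul_assoc, lap_lap_lap_green, sub_self]
  exact LinearMap.congr_fun h x

/-- A unipotent operator of finite order is trivial in characteristic zero: `κᵐy = y - m(1 - κ)y`,
and `m` is invertible. -/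
theorem kar_eq_of_pow {y : Omega k A} (h : (1 - kar k A) ((1 - kar k A) y) = 0) {m : ℕ}
    (hm : m ≠ 0) (h' : (kar k A ^ m) y = y) : kar k A y = y := by
  rw [kar_pow_of_lap_lap h, sub_eq_self] at h'
  have := nsmul_eq_zero_of_rat (k := k) hm h'
  rw [LinearMap.sub_apply, sub_eq_zero] at this
  exact this.symm

theorem kar_d_harm {n : ℕ} {x : Omega k A} (hx : x ∈ homog k A n) :
    kar k A (d k A (harm k A x)) = d k A (harm k A x) :=
  kar_eq_of_pow (by rw [lap_d, lap_d, lap_lap_harm, map_zero]) n.succ_ne_zero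
    (kar_pow_succ_d (harm_mem hx))

theorem kar_hoch_harm {n : ℕ} {x : Omega k A} (hx : x ∈ homog k A n) :
    kar k A (hoch k A (harm k A x)) = hoch k A (harm k A x) := by
  rcases Nat.eq_zero_or_pos n with rfl | hn
  · rw [hoch_homog_zero (harm_mem hx), map_zero]
  · exact kar_eq_of_pow (by rw [lap_hoch, lap_hoch, lap_lap_harm, map_zero]) hn.ne'
      (by rw [← hoch_kar_pow, hoch_kar_pow_deg (harm_mem hx)])

/-- On the complement of `P` the sum telescopes to `(1 - κⁿ⁺¹) dG = 0`. On the image of `P` its `n +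
1` summands coincide, because `κ` fixes `dP`. -/
theorem connes_eq {n : ℕ} {x : Omega k A} (hx : x ∈ homog k A n) :
    connes k A x = (n + 1) • d k A (harm k A x) := by
  have h1 : connes k A (x - harm k A x) = 0 := by
    rw [connes_homog (sub_mem hx (harm_mem hx)), sub_harm, hoch_d_add]
    have h2 : d k A (green k A x - kar k A (green k A x)) =
      (1 - kar k A) (d k A (green k A x)) := by simp [kar_d]
    rw [h2, sum_kar_pow, kar_pow_succ_d (green_mem hx), sub_self]
  rw [map_sub, sub_eq_zero] at h1
  rw [h1, connes_homog (harm_mem hx)]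
  simp [kar_pow_eq (kar_d_harm hx)]

/-- The argument for `B` with `b` in place of `d`: telescoping uses `b κⁿ = b`, and `κ` fixes `bP`.
-/
theorem contr_eq {n : ℕ} {x : Omega k A} (hx : x ∈ homog k A n) :
    contr k A x = n • hoch k A (harm k A x) := by
  have h1 : contr k A (x - harm k A x) = 0 := by
    rw [contr_homog (sub_mem hx (harm_mem hx)), sub_harm, hoch_d_add]
    have h2 : green k A x - kar k A (green k A x) =
      (1 - kar k A) (green k A x) := by simp
    rw [h2, sum_kar_pow, map_sub, hoch_kar_pow_deg (green_mem hx), sub_self]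
  rw [map_sub, sub_eq_zero] at h1
  rw [h1, contr_homog (harm_mem hx), map_sum]
  simp [hoch_kar_pow, kar_pow_eq (kar_hoch_harm hx)]

/-- Compute `κⁿP` in two ways: it is `P + bdP` by `kar_pow_deg`, and `P - n(bd + db)P` by
unipotence. -/
theorem hoch_d_harm {n : ℕ} {x : Omega k A} (hx : x ∈ homog k A n) :
    (n + 1) • hoch k A (d k A (harm k A x)) + n • d k A (hoch k A (harm k A x)) = 0 := by
  have h1 := kar_pow_deg (harm_mem hx)
  rw [kar_pow_eq (kar_d_harm hx), kar_pow_of_lap_lap (lap_lap_harm x)] at h1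
  have h2 : (1 - kar k A) (harm k A x) =
    hoch k A (d k A (harm k A x)) + d k A (hoch k A (harm k A x)) := by
    rw [hoch_d_add]; simp
  rw [h2, smul_add, sub_eq_add_neg, add_right_inj, neg_eq_iff_add_eq_zero] at h1
  rw [succ_nsmul, ← h1]
  abel

theorem contr_d_add {n : ℕ} {x : Omega k A} (hx : x ∈ homog k A n) :
    contr k A (d k A x) + d k A (contr k A x) = 0 := by
  rw [contr_eq (d_mem hx), contr_eq hx, map_nsmul, harm_d, hoch_d_harm hx]

/-- Needed so that, after applying `P`, the commutators coming from `1 - κ` add nothing to those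
coming from `b`. In `(1 - κ)P = bdP + dbP` the second term is a rational multiple of the first. -/
theorem lap_harm_mem {n : ℕ} {x : Omega k A} (hx : x ∈ homog k A n) :
    ∃ y ∈ homog k A (n + 1), (1 - kar k A) (harm k A x) = hoch k A (harm k A y) := by
  have h2 : (1 - kar k A) (harm k A x) =
    hoch k A (d k A (harm k A x)) + d k A (hoch k A (harm k A x)) := by
    rw [hoch_d_add]; simp
  rw [h2]
  rcases Nat.eq_zero_or_pos n with rfl | hn
  · refine ⟨d k A x, d_mem hx, ?_⟩
    rw [hoch_homog_zero (harm_mem hx), map_zero, add_zero, harm_d]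
  · have h3 := hoch_d_harm hx
    -- From `n dbP = -(n+1) bdP` one gets `(1 - κ)P = -(1/n) bdP`.
    refine ⟨-(algebraMap ℚ k (n : ℚ)⁻¹ • d k A x), neg_mem (Submodule.smul_mem _ _ (d_mem hx)), ?_⟩
    have h4 : algebraMap ℚ k (n : ℚ)⁻¹ * (n : k) = 1 := by
      rw [← map_natCast (algebraMap ℚ k), ← map_mul,
        inv_mul_cancel₀ (by exact_mod_cast hn.ne'), map_one]
    rw [succ_nsmul, ← Nat.cast_smul_eq_nsmul k, ← Nat.cast_smul_eq_nsmul k] at h3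
    have h5 := congrArg (fun y => algebraMap ℚ k (n : ℚ)⁻¹ • y) h3
    simp only [smul_add, smul_smul, h4, one_smul, smul_zero] at h5
    simp only [map_neg, map_smul, harm_d]
    rw [eq_neg_iff_add_eq_zero, ← h5]
    abel

end

/-! ### A contracting homotopy for `d` -/

section

variable {k : Type u} [CommRing k] {A : Type v} [Ring A] [Algebra k A]

/-- The section `Ā → A` defined by a retraction `A → k`. -/
def sectionOfRetraction (r : A →ₗ[k] k) (hr : r ∘ₗ Algebra.linearMap k A = LinearMap.id) :
    Abar k A →ₗ[k] A :=
  Submodule.liftQ _ (LinearMap.id - Algebra.linearMap k A ∘ₗ r) (by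
    rintro _ ⟨c, rfl⟩
    have : r (algebraMap k A c) = c := LinearMap.congr_fun hr c
    simp [this])

theorem sectionOfRetraction_bar (r : A →ₗ[k] k)
    (hr : r ∘ₗ Algebra.linearMap k A = LinearMap.id) (a : A) :
    sectionOfRetraction r hr (bar k A a) = a - algebraMap k A (r a) := by
  simp [sectionOfRetraction, bar]

theorem bar_sectionOfRetraction (r : A →ₗ[k] k)
    (hr : r ∘ₗ Algebra.linearMap k A = LinearMap.id) (c : Abar k A) :
    bar k A (sectionOfRetraction r hr c) = c := by
  obtain ⟨a, rfl⟩ := Submodule.mkQ_surjective _ c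
  change bar k A (sectionOfRetraction r hr (bar k A a)) = bar k A a
  rw [sectionOfRetraction_bar, map_sub, bar_algebraMap, sub_zero]

/-- The restriction to `Ωⁿ A` of the contracting homotopy. -/
def homotForm (r : A →ₗ[k] k) (hr : r ∘ₗ Algebra.linearMap k A = LinearMap.id) :
    ∀ n : ℕ, Form k A n →ₗ[k] Omega k A
  | 0 => 0
  | 1 => TensorProduct.lift ((LinearMap.lsmul k (Omega k A)).compl₁₂
      (r ∘ₗ (formZero k A).symm.toLinearMap) (ofA k A ∘ₗ sectionOfRetraction r hr)) ∘ₗ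
        (snoc k A 0).symm.toLinearMap
  | n + 2 => TensorProduct.lift (rightD k A ∘ₗ homotForm r hr (n + 1)) ∘ₗ
      (snoc k A (n + 1)).symm.toLinearMap

/-- The contracting homotopy `a₀ da₁ da₂ ⋯ daₙ ↦ r(a₀) σ(a₁) da₂ ⋯ daₙ`, where `σ` is the section
defined by the retraction `r`. -/
def homot (r : A →ₗ[k] k) (hr : r ∘ₗ Algebra.linearMap k A = LinearMap.id) :
    Omega k A →ₗ[k] Omega k A := Omega.lift (homotForm r hr)

variable (r : A →ₗ[k] k) (hr : r ∘ₗ Algebra.linearMap k A = LinearMap.id)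

theorem homot_ofA (a : A) : homot r hr (ofA k A a) = 0 := by
  simp [homot, ofA, homotForm]

theorem homot_rightD_ofA (a : A) (c : Abar k A) :
    homot r hr (rightD k A (ofA k A a) c) = r a • ofA k A (sectionOfRetraction r hr c) := by
  rw [ofA, LinearMap.comp_apply, rightD_hom]
  simp [homot, homotForm, ofA]

theorem homot_rightD {n : ℕ} {x : Omega k A} (hx : x ∈ homog k A (n + 1)) (c : Abar k A) :
    homot r hr (rightD k A x c) = rightD k A (homot r hr x) c := by
  obtain ⟨x, rfl⟩ := hx
  rw [rightD_hom]
  simp [homot, homotForm]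

theorem homot_d_ofA (a : A) :
    homot r hr (d k A (ofA k A a)) = ofA k A a - ofA k A (algebraMap k A (r a)) := by
  have h1 : r 1 = 1 := by
    have := LinearMap.congr_fun hr 1
    simpa using this
  rw [d_ofA, homot_rightD_ofA, h1, one_smul, sectionOfRetraction_bar, map_sub]

/-- For `a dc` the two terms are `r(a) dc` and `(a - r(a)) dc`. Higher degrees follow because both
operators commute with right multiplication by `dc`. In degree 0 the identity fails by the constant
`r(a)`, hence the restriction to positive degree. -/
theorem d_homot_add {n : ℕ} {x : Omega k A} (hx : x ∈ homog k A (n + 1)) :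
    d k A (homot r hr x) + homot r hr (d k A x) = x := by
  induction n generalizing x with
  | zero =>
    refine homog_induction (p := fun x => d k A (homot r hr x) + homot r hr (d k A x) = x)
      ?_ ?_ hx
    · intro x hx c
      obtain ⟨a, rfl⟩ := homog_zero hx
      rw [mul_d_ofA, homot_rightD_ofA, d_rightD, homot_rightD r hr (d_mem hx), homot_d_ofA,
        map_smul, d_ofA, bar_sectionOfRetraction, Algebra.algebraMap_eq_smul_one, map_smul, map_sub,
        LinearMap.sub_apply, map_smul, LinearMap.smul_apply]
      abel
    · intro x y hx hy
      simp only [map_add]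
      rw [add_add_add_comm, hx, hy]
  | succ n ih =>
    refine homog_induction (p := fun x => d k A (homot r hr x) + homot r hr (d k A x) = x)
      ?_ ?_ hx
    · intro x hx c
      rw [mul_d_ofA, d_rightD, homot_rightD r hr hx, homot_rightD r hr (d_mem hx), d_rightD,
        ← LinearMap.add_apply, ← map_add, ih hx]
    · intro x y hx hy
      simp only [map_add]
      rw [add_add_add_comm, hx, hy]

theorem homot_mem {n : ℕ} {x : Omega k A} (hx : x ∈ homog k A (n + 1)) :
    homot r hr x ∈ homog k A n := by
  induction n generalizing x with
  | zero =>
    refine homog_induction (p := fun x => homot r hr x ∈ homog k A 0) ?_ ?_ hx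
    · intro x hx c
      obtain ⟨a, rfl⟩ := homog_zero hx
      rw [mul_d_ofA, homot_rightD_ofA]
      exact Submodule.smul_mem _ _ (ofA_mem _)
    · intro x y hx hy
      rw [map_add]
      exact add_mem hx hy
  | succ n ih =>
    refine homog_induction (p := fun x => homot r hr x ∈ homog k A (n + 1)) ?_ ?_ hx
    · intro x hx c
      rw [mul_d_ofA, homot_rightD r hr hx, ← mul_d_ofA]
      exact mul_d_mem (ih hx) _
    · intro x y hx hy
      rw [map_add]
      exact add_mem hx hy

end

/-! ### Generators of the commutator subspaces -/

section

variable {k : Type u} [CommRing k] {A : Type v} [Ring A] [Algebra k A]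

/-- `b` and `1 - κ` generate all commutators: `[x, a] = ± b(x da)`, and the last differential of `y
= z da` is peeled off by `[x, z da] = (1 - κ)(xz da) ± [da x, z]`. -/
theorem comm_le {N : Submodule k (Omega k A)}
    (h1 : ∀ n, ∀ x ∈ homog k A (n + 1), hoch k A x ∈ N)
    (h2 : ∀ n, ∀ x ∈ homog k A n, (1 - kar k A) x ∈ N) : comm k A ≤ N := by
  refine Submodule.span_le.2 ?_
  rintro _ ⟨m, n, x, hx, y, hy, rfl⟩
  rw [SetLike.mem_coe]
  induction n generalizing m x y with
  | zero =>
    obtain ⟨a, rfl⟩ := homog_zero hy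
    have h := Submodule.smul_mem N ((-1 : k) ^ m) (h1 _ _ (mul_d_mem hx a))
    have h3 : (-1 : k) ^ m * (-1) ^ m = 1 := by rw [← mul_pow]; simp
    rw [hoch_mul_d' hx, smul_smul, h3, one_smul] at h
    rwa [mul_zero, pow_zero, one_smul]
  | succ n ih =>
    refine homog_induction (p := fun y => x * y - (-1 : k) ^ (m * (n + 1)) • (y * x) ∈ N)
      ?_ ?_ hy
    · intro z hz a
      have e1 := h2 _ _ (mul_d_mem (mul_mem hx hz) a)
      have e2 := ih _ _ (mul_mem (d_mem (ofA_mem a)) hx) z hz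
      rw [LinearMap.sub_apply, kar_mul_d' (mul_mem hx hz)] at e1
      convert add_mem e1 (Submodule.smul_mem N ((-1 : k) ^ (m + n)) e2) using 1
      rw [Module.End.one_apply, smul_sub, smul_smul, ← pow_add, mul_assoc x z, mul_assoc _ x z,
        mul_assoc z]
      have : (-1 : k) ^ (m + n + (0 + 1 + m) * n) = (-1) ^ (m * (n + 1)) := by
        rw [neg_one_pow_congr]
        simp only [Nat.even_add, Nat.even_mul, Nat.even_add_one]
        tauto
      rw [this]
      abel
    · intro y z hy hz
      convert add_mem hy hz using 1
      rw [mul_add, add_mul, smul_add]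
      abel

/-- The same peeling for exact forms: `[dx, dz da] = (1 - κ)(dx dz da) ± [da dx, dz]`, where `da dx
= d(a dx)` is again exact. -/
theorem dcomm_le {N : Submodule k (Omega k A)}
    (h : ∀ n, ∀ x ∈ homog k A n, (1 - kar k A) (d k A x) ∈ N) : dcomm k A ≤ N := by
  refine Submodule.span_le.2 ?_
  rintro _ ⟨m, n, x, hx, y, hy, rfl⟩
  rw [SetLike.mem_coe]
  induction n generalizing m x y with
  | zero =>
    obtain ⟨a, rfl⟩ := homog_zero hy
    have e := h _ _ (mul_d_mem hx a)
    rw [d_mul' hx, d_d, mul_zero, smul_zero, add_zero, LinearMap.sub_apply,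
      kar_mul_d' (d_mem hx), Module.End.one_apply] at e
    rwa [zero_add, mul_one]
  | succ n ih =>
    refine homog_induction (p := fun y => d k A x * d k A y -
      (-1 : k) ^ ((m + 1) * (n + 1 + 1)) • (d k A y * d k A x) ∈ N) ?_ ?_ hy
    · intro z hz a
      have e0 : d k A (z * d k A (ofA k A a)) = d k A z * d k A (ofA k A a) := by
        rw [d_mul' hz, d_d, mul_zero, smul_zero, add_zero]
      have e1 := h _ _ (mul_mem hx (d_mem (mul_d_mem hz a)))
      rw [d_mul' hx, d_d, mul_zero, smul_zero, add_zero, e0, ← mul_assoc, LinearMap.sub_apply,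
        kar_mul_d' (mul_mem (d_mem hx) (d_mem hz)), Module.End.one_apply] at e1
      have e2 := ih _ _ (mul_mem (ofA_mem a) (d_mem hx)) z hz
      rw [d_mul' (ofA_mem a), d_d, mul_zero, smul_zero, add_zero] at e2
      convert add_mem e1 (Submodule.smul_mem N ((-1 : k) ^ (m + 1 + (n + 1))) e2) using 1
      rw [e0, smul_sub, smul_smul, ← pow_add, ← mul_assoc (d k A x),
        ← mul_assoc _ (d k A x) (d k A z), mul_assoc (d k A z)]
      have : (-1 : k) ^ (m + 1 + (n + 1) + (0 + (m + 1) + 1) * (n + 1)) =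
          (-1) ^ ((m + 1) * (n + 1 + 1)) := by
        rw [neg_one_pow_congr]
        simp only [Nat.even_add, Nat.even_mul, Nat.even_add_one]
        tauto
      rw [this]
      abel
    · intro y z hy hz
      convert add_mem hy hz using 1
      rw [map_add, mul_add (d k A x), add_mul (d k A y), smul_add]
      abel

theorem hoch_mem_comm {n : ℕ} {x : Omega k A} (hx : x ∈ homog k A n) :
    hoch k A x ∈ comm k A := by
  cases n with
  | zero => rw [hoch_homog_zero hx]; exact zero_mem _
  | succ n =>
    refine homog_induction (p := fun x => hoch k A x ∈ comm k A) ?_ ?_ hx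
    · intro x hx a
      rw [hoch_mul_d' hx]
      refine Submodule.smul_mem _ _ (Submodule.subset_span ⟨n, 0, x, hx, _, ofA_mem a, ?_⟩)
      rw [mul_zero, pow_zero, one_smul]
    · intro x y hx hy
      rw [map_add]
      exact add_mem hx hy

theorem lap_mem_comm {n : ℕ} {x : Omega k A} (hx : x ∈ homog k A n) :
    (1 - kar k A) x ∈ comm k A := by
  cases n with
  | zero =>
    obtain ⟨a, rfl⟩ := homog_zero hx
    rw [LinearMap.sub_apply, kar_ofA, Module.End.one_apply, sub_self]
    exact zero_mem _
  | succ n =>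
    refine homog_induction (p := fun x => (1 - kar k A) x ∈ comm k A) ?_ ?_ hx
    · intro x hx a
      refine Submodule.subset_span ⟨n, 1, x, hx, _, d_mem (ofA_mem a), ?_⟩
      rw [LinearMap.sub_apply, kar_mul_d' hx, Module.End.one_apply, mul_one]
    · intro x y hx hy
      rw [map_add]
      exact add_mem hx hy

theorem lap_d_mem_dcomm {n : ℕ} {x : Omega k A} (hx : x ∈ homog k A n) :
    (1 - kar k A) (d k A x) ∈ dcomm k A := by
  cases n with
  | zero =>
    obtain ⟨a, rfl⟩ := homog_zero hx
    have h := kar_mul_d' (ofA_mem (k := k) (1 : A)) a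
    rw [ofA_one, one_mul, mul_one, pow_zero, one_smul] at h
    rw [LinearMap.sub_apply, h, Module.End.one_apply, sub_self]
    exact zero_mem _
  | succ n =>
    refine homog_induction (p := fun x => (1 - kar k A) (d k A x) ∈ dcomm k A) ?_ ?_ hx
    · intro x hx a
      refine Submodule.subset_span ⟨n, 0, x, hx, _, ofA_mem a, ?_⟩
      rw [d_mul' hx, d_d, mul_zero, smul_zero, add_zero, LinearMap.sub_apply,
        kar_mul_d' (d_mem hx), Module.End.one_apply, zero_add, mul_one]
    · intro x y hx hy
      rw [map_add, map_add]
      exact add_mem hx hy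

variable (k A) in
/-- The projection of `Ω A` onto its degree `n` part. -/
def degComp (n : ℕ) : Omega k A →ₗ[k] Omega k A :=
  Omega.lift fun m => if m = n then hom k A m else 0

theorem degComp_same {n : ℕ} {x : Omega k A} (hx : x ∈ homog k A n) : degComp k A n x = x := by
  obtain ⟨x, rfl⟩ := hx
  simp [degComp]

theorem degComp_ne {m n : ℕ} (h : m ≠ n) {x : Omega k A} (hx : x ∈ homog k A m) :
    degComp k A n x = 0 := by
  obtain ⟨x, rfl⟩ := hx
  simp [degComp, h]

/-- The span of commutators is graded, since both families of generators are homogeneous. In a fixed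
degree only one `b y` and one `(1 - κ)z` are needed. -/
theorem degComp_comm (n : ℕ) {w : Omega k A} (hw : w ∈ comm k A) :
    ∃ y ∈ homog k A (n + 1), ∃ z ∈ homog k A n,
      degComp k A n w = hoch k A y + (1 - kar k A) z := by
  have h : comm k A ≤ ((homog k A (n + 1)).map (hoch k A) ⊔
      (homog k A n).map (1 - kar k A)).comap (degComp k A n) := by
    refine comm_le ?_ ?_
    · intro m x hx
      rw [Submodule.mem_comap]
      by_cases hm : m = n
      · subst hm
        rw [degComp_same (hoch_mem hx)]
        exact Submodule.mem_sup_left ⟨x, hx, rfl⟩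
      · rw [degComp_ne hm (hoch_mem hx)]
        exact zero_mem _
    · intro m x hx
      rw [Submodule.mem_comap]
      have hx' : (1 - kar k A) x ∈ homog k A m := sub_mem hx (kar_mem hx)
      by_cases hm : m = n
      · subst hm
        rw [degComp_same hx']
        exact Submodule.mem_sup_right ⟨x, hx, rfl⟩
      · rw [degComp_ne hm hx']
        exact zero_mem _
  obtain ⟨_, ⟨y, hy, rfl⟩, _, ⟨z, hz, rfl⟩, e⟩ := Submodule.mem_sup.1 (h hw)
  exact ⟨y, hy, z, hz, e.symm⟩

theorem scal_le_homog : scal k A ≤ homog k A 0 := by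
  rintro _ ⟨r, rfl⟩
  exact ofA_mem _

theorem degComp_scal (n : ℕ) {x : Omega k A} (hx : x ∈ scal k A) : degComp k A n x ∈ scal k A := by
  by_cases h : 0 = n
  · subst h
    rwa [degComp_same (scal_le_homog hx)]
  · rw [degComp_ne h (scal_le_homog hx)]
    exact zero_mem _

end

/-! ### Operators on reduced forms -/

section

variable {k : Type u} [CommRing k] {A : Type v} [Ring A] [Algebra k A]

theorem omegaBar_induction {p : OmegaBar k A → Prop}
    (h1 : ∀ n, ∀ x ∈ homog k A n, p ((scal k A).mkQ x))
    (h2 : ∀ x y, p x → p y → p (x + y)) (x : OmegaBar k A) : p x := by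
  obtain ⟨x, rfl⟩ := (scal k A).mkQ_surjective x
  induction x using omega_homog_induction with
  | h1 n x hx => exact h1 n x hx
  | h2 x y hx hy => rw [map_add]; exact h2 _ _ hx hy

theorem degBar_cases {n : ℤ} {x : OmegaBar k A} (hx : x ∈ degBar k A n) :
    x = 0 ∨ ∃ m : ℕ, n = m ∧ ∃ y ∈ homog k A m, x = (scal k A).mkQ y := by
  match n, hx with
  | Int.ofNat m, hx =>
    obtain ⟨y, hy, rfl⟩ := hx
    exact Or.inr ⟨m, rfl, y, hy, rfl⟩
  | Int.negSucc m, hx => exact Or.inl hx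

theorem mkQ_mem_degBar {m : ℕ} {y : Omega k A} (hy : y ∈ homog k A m) {n : ℤ} (h : n = m) :
    (scal k A).mkQ y ∈ degBar k A n := by
  subst h
  exact ⟨y, hy, rfl⟩

theorem eq_zero_of_neg {n : ℤ} {x : OmegaBar k A} (hx : x ∈ degBar k A n) (hn : n < 0) :
    x = 0 := by
  obtain h | ⟨m, hm, -⟩ := degBar_cases hx
  · exact h
  · omega

theorem dBar_mk (x : Omega k A) : dBar k A ((scal k A).mkQ x) = (scal k A).mkQ (d k A x) := rfl

theorem hochBar_mk (x : Omega k A) :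
    hochBar k A ((scal k A).mkQ x) = (scal k A).mkQ (hoch k A x) := rfl

theorem connesBar_mk (x : Omega k A) :
    connesBar k A ((scal k A).mkQ x) = (scal k A).mkQ (connes k A x) := rfl

theorem contrBar_mk (x : Omega k A) :
    contrBar k A ((scal k A).mkQ x) = (scal k A).mkQ (contr k A x) := rfl

theorem dBar_mem {m n : ℤ} {x : OmegaBar k A} (hx : x ∈ degBar k A m)
    (h : n = m + 1 := by omega) : dBar k A x ∈ degBar k A n := by
  obtain rfl | ⟨m, hm, y, hy, rfl⟩ := degBar_cases hx
  · rw [map_zero]; exact zero_mem _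
  · exact mkQ_mem_degBar (d_mem hy) (by omega)

theorem hochBar_mem {m n : ℤ} {x : OmegaBar k A} (hx : x ∈ degBar k A m)
    (h : n = m - 1 := by omega) : hochBar k A x ∈ degBar k A n := by
  obtain rfl | ⟨m, hm, y, hy, rfl⟩ := degBar_cases hx
  · rw [map_zero]; exact zero_mem _
  · cases m with
    | zero => rw [hochBar_mk, hoch_homog_zero hy, map_zero]; exact zero_mem _
    | succ m => exact mkQ_mem_degBar (hoch_mem hy) (by omega)

theorem contrBar_mem {m n : ℤ} {x : OmegaBar k A} (hx : x ∈ degBar k A m)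
    (h : n = m - 1 := by omega) : contrBar k A x ∈ degBar k A n := by
  obtain rfl | ⟨m, hm, y, hy, rfl⟩ := degBar_cases hx
  · rw [map_zero]; exact zero_mem _
  · cases m with
    | zero =>
      obtain ⟨a, rfl⟩ := homog_zero hy
      rw [contrBar_mk, contr_ofA, map_zero]; exact zero_mem _
    | succ m => exact mkQ_mem_degBar (contr_mem hy) (by omega)

theorem dBar_dBar (x : OmegaBar k A) : dBar k A (dBar k A x) = 0 := by
  induction x using omegaBar_induction with
  | h1 n x hx => rw [dBar_mk, dBar_mk, d_d, map_zero]
  | h2 x y hx hy => simp only [map_add, hx, hy, add_zero]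

theorem nat_hochBar (x : OmegaBar k A) : nat k A (hochBar k A x) = 0 := by
  induction x using omegaBar_induction with
  | h1 n x hx =>
    rw [nat, Submodule.mkQ_apply, Submodule.Quotient.mk_eq_zero]
    exact ⟨_, hoch_mem_comm hx, rfl⟩
  | h2 x y hx hy => simp only [map_add, hx, hy, add_zero]

theorem contrDR_nat (x : OmegaBar k A) : contrDR k A (nat k A x) = contrBar k A x := rfl

theorem dDR_nat (x : OmegaBar k A) : dDR k A (nat k A x) = nat k A (dBar k A x) := rfl

/-- A contracting homotopy for `d` on `Ω̄`. -/
structure IsContraction (s : OmegaBar k A →ₗ[k] OmegaBar k A) : Prop where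
  mem' : ∀ n, ∀ x ∈ degBar k A n, s x ∈ degBar k A (n - 1)
  add_eq : ∀ x, dBar k A (s x) + s (dBar k A x) = x

theorem IsContraction.mem {s : OmegaBar k A →ₗ[k] OmegaBar k A} (hs : IsContraction s) {m n : ℤ}
    {x : OmegaBar k A} (hx : x ∈ degBar k A m) (h : n = m - 1 := by omega) :
    s x ∈ degBar k A n := h ▸ hs.mem' m x hx

theorem IsContraction.d_eq {s : OmegaBar k A →ₗ[k] OmegaBar k A} (hs : IsContraction s)
    {x : OmegaBar k A} (hx : dBar k A x = 0) : dBar k A (s x) = x := by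
  have := hs.add_eq x
  rwa [hx, map_zero, add_zero] at this

theorem exists_contraction
    (hsplit : ∃ r : A →ₗ[k] k, r ∘ₗ Algebra.linearMap k A = LinearMap.id) :
    ∃ s : OmegaBar k A →ₗ[k] OmegaBar k A, IsContraction s := by
  obtain ⟨r, hr⟩ := hsplit
  refine ⟨(scal k A).mapQ (scal k A) (homot r hr) (scal_le_comap (homot_ofA r hr 1)), ?_, ?_⟩
  · intro n x hx
    obtain rfl | ⟨m, hm, y, hy, rfl⟩ := degBar_cases hx
    · rw [map_zero]; exact zero_mem _
    rw [Submodule.mkQ_apply, Submodule.mapQ_apply]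
    cases m with
    | zero =>
      obtain ⟨a, rfl⟩ := homog_zero hy
      rw [homot_ofA]
      exact zero_mem _
    | succ m => exact mkQ_mem_degBar (homot_mem r hr hy) (by omega)
  · intro x
    induction x using omegaBar_induction with
    | h1 n x hx =>
      rw [dBar_mk, Submodule.mkQ_apply, Submodule.mapQ_apply, Submodule.mkQ_apply,
        Submodule.mapQ_apply, ← Submodule.mkQ_apply, ← Submodule.mkQ_apply, dBar_mk, ← map_add]
      cases n with
      | zero =>
        obtain ⟨a, rfl⟩ := homog_zero hx
        -- The degree 0 defect `r(a)` is a scalar, hence zero in `Ω̄`. This is where passing to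
        -- reduced forms makes `d` exact.
        rw [homot_ofA, map_zero, zero_add, homot_d_ofA, map_sub, Submodule.mkQ_apply,
          Submodule.mkQ_apply, sub_eq_self, Submodule.Quotient.mk_eq_zero]
        exact ⟨r a, rfl⟩
      | succ n => rw [d_homot_add r hr hx, Submodule.mkQ_apply]
    | h2 x y hx hy =>
      simp only [map_add]
      rw [add_add_add_comm, hx, hy]

end

section

variable {k : Type u} [CommRing k] [Algebra ℚ k] {A : Type v} [Ring A] [Algebra k A]

theorem green_one : green k A 1 = 0 := by
  have h1 : (green k A * (1 - kar k A)) 1 = 0 := by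
    rw [Module.End.mul_apply, LinearMap.sub_apply, Module.End.one_apply, ← ofA_one, kar_ofA,
      sub_self, map_zero]
  rw [← green_lap_green, mul_assoc, lap_green, Module.End.mul_apply, h1, map_zero]

theorem harm_one : harm k A 1 = 1 := by
  rw [harm, LinearMap.sub_apply, Module.End.mul_apply, green_one, map_zero, sub_zero,
    Module.End.one_apply]

variable (k A) in
/-- The operator induced by `green` on `Ω̄`. -/
def greenBar : OmegaBar k A →ₗ[k] OmegaBar k A :=
  (scal k A).mapQ (scal k A) (green k A) (scal_le_comap green_one)

variable (k A) in
/-- The operator induced by `harm` on `Ω̄`. -/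
def harmBar : OmegaBar k A →ₗ[k] OmegaBar k A :=
  (scal k A).mapQ (scal k A) (harm k A) (by
    rintro _ ⟨r, rfl⟩
    exact ⟨r, by simp [Algebra.algebraMap_eq_smul_one, ofA_one, harm_one]⟩)

theorem greenBar_mk (x : Omega k A) :
    greenBar k A ((scal k A).mkQ x) = (scal k A).mkQ (green k A x) := rfl

theorem harmBar_mk (x : Omega k A) :
    harmBar k A ((scal k A).mkQ x) = (scal k A).mkQ (harm k A x) := rfl

theorem greenBar_mem {n : ℤ} {x : OmegaBar k A} (hx : x ∈ degBar k A n) :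
    greenBar k A x ∈ degBar k A n := by
  obtain rfl | ⟨m, hm, y, hy, rfl⟩ := degBar_cases hx
  · rw [map_zero]; exact zero_mem _
  · exact mkQ_mem_degBar (green_mem hy) hm

theorem harmBar_mem {n : ℤ} {x : OmegaBar k A} (hx : x ∈ degBar k A n) :
    harmBar k A x ∈ degBar k A n := by
  obtain rfl | ⟨m, hm, y, hy, rfl⟩ := degBar_cases hx
  · rw [map_zero]; exact zero_mem _
  · exact mkQ_mem_degBar (harm_mem hy) hm

theorem harmBar_harmBar (x : OmegaBar k A) : harmBar k A (harmBar k A x) = harmBar k A x := by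
  obtain ⟨x, rfl⟩ := (scal k A).mkQ_surjective x
  rw [harmBar_mk, harmBar_mk, harm_harm]

theorem harmBar_dBar (x : OmegaBar k A) :
    harmBar k A (dBar k A x) = dBar k A (harmBar k A x) := by
  obtain ⟨x, rfl⟩ := (scal k A).mkQ_surjective x
  rw [dBar_mk, harmBar_mk, harmBar_mk, dBar_mk, harm_d]

theorem harmBar_hochBar (x : OmegaBar k A) :
    harmBar k A (hochBar k A x) = hochBar k A (harmBar k A x) := by
  obtain ⟨x, rfl⟩ := (scal k A).mkQ_surjective x
  rw [hochBar_mk, harmBar_mk, harmBar_mk, hochBar_mk, harm_hoch]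

theorem greenBar_hochBar (x : OmegaBar k A) :
    greenBar k A (hochBar k A x) = hochBar k A (greenBar k A x) := by
  obtain ⟨x, rfl⟩ := (scal k A).mkQ_surjective x
  rw [hochBar_mk, greenBar_mk, greenBar_mk, hochBar_mk, green_hoch]

theorem greenBar_dBar (x : OmegaBar k A) :
    greenBar k A (dBar k A x) = dBar k A (greenBar k A x) := by
  obtain ⟨x, rfl⟩ := (scal k A).mkQ_surjective x
  rw [dBar_mk, greenBar_mk, greenBar_mk, dBar_mk, green_d]

theorem sub_harmBar (x : OmegaBar k A) : x - harmBar k A x =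
    hochBar k A (dBar k A (greenBar k A x)) + dBar k A (hochBar k A (greenBar k A x)) := by
  obtain ⟨x, rfl⟩ := (scal k A).mkQ_surjective x
  rw [greenBar_mk, harmBar_mk, hochBar_mk, dBar_mk, hochBar_mk, dBar_mk, ← map_sub, ← map_add,
    sub_harm]

theorem connesBar_eq {n : ℤ} {x : OmegaBar k A} (hx : x ∈ degBar k A n) :
    connesBar k A x = (n + 1) • dBar k A (harmBar k A x) := by
  obtain rfl | ⟨m, hm, y, hy, rfl⟩ := degBar_cases hx
  · simp only [map_zero, smul_zero]
  rw [connesBar_mk, harmBar_mk, dBar_mk, connes_eq hy, map_nsmul, hm]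
  exact_mod_cast rfl

theorem contrBar_eq {n : ℤ} {x : OmegaBar k A} (hx : x ∈ degBar k A n) :
    contrBar k A x = n • hochBar k A (harmBar k A x) := by
  obtain rfl | ⟨m, hm, y, hy, rfl⟩ := degBar_cases hx
  · simp only [map_zero, smul_zero]
  rw [contrBar_mk, harmBar_mk, hochBar_mk, contr_eq hy, map_nsmul, hm, natCast_zsmul]

theorem contrBar_dBar (x : OmegaBar k A) :
    contrBar k A (dBar k A x) = -dBar k A (contrBar k A x) := by
  rw [eq_neg_iff_add_eq_zero]
  induction x using omegaBar_induction with
  | h1 n x hx =>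
    rw [dBar_mk, contrBar_mk, contrBar_mk, dBar_mk, ← map_add, contr_d_add hx, map_zero]
  | h2 x y hx hy =>
    simp only [map_add]
    rw [add_add_add_comm, hx, hy, add_zero]

theorem harmBar_contrBar (x : OmegaBar k A) :
    harmBar k A (contrBar k A x) = contrBar k A x := by
  induction x using omegaBar_induction with
  | h1 n x hx => rw [contrBar_mk, contr_eq hx, harmBar_mk, map_nsmul, harm_hoch, harm_harm]
  | h2 x y hx hy => simp only [map_add, hx, hy]

theorem contrBar_harmBar (x : OmegaBar k A) :
    contrBar k A (harmBar k A x) = contrBar k A x := by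
  induction x using omegaBar_induction with
  | h1 n x hx =>
    rw [harmBar_mk, contrBar_mk, contr_eq (harm_mem hx), contrBar_mk, contr_eq hx, harm_harm]
  | h2 x y hx hy => simp only [map_add, hx, hy]

theorem contrBar_contrBar (x : OmegaBar k A) : contrBar k A (contrBar k A x) = 0 := by
  induction x using omegaBar_induction with
  | h1 n x hx =>
    cases n with
    | zero =>
      obtain ⟨a, rfl⟩ := homog_zero hx
      rw [contrBar_mk, contr_ofA, map_zero, map_zero]
    | succ n =>
      rw [contrBar_mk, contr_eq hx, map_nsmul, map_nsmul, contrBar_mk,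
        contr_hoch (harm_mem hx), map_zero, smul_zero]
  | h2 x y hx hy => simp only [map_add, hx, hy, add_zero]

/-- `(1 - P)x = (1 - κ)Gx` is a commutator, so every de Rham class has a harmonic representative. -/
theorem nat_harmBar (x : OmegaBar k A) : nat k A (harmBar k A x) = nat k A x := by
  induction x using omegaBar_induction with
  | h1 n x hx =>
    rw [eq_comm, ← sub_eq_zero, ← map_sub, harmBar_mk, ← map_sub, nat, Submodule.mkQ_apply,
      Submodule.Quotient.mk_eq_zero]
    exact ⟨_, lap_mem_comm (green_mem hx), by simp [harm]⟩
  | h2 x y hx hy => simp only [map_add, hx, hy]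

theorem nat_contrBar (x : OmegaBar k A) : nat k A (contrBar k A x) = 0 := by
  induction x using omegaBar_induction with
  | h1 n x hx =>
    rw [contrBar_mk, contr_eq hx, map_nsmul, ← hochBar_mk, map_nsmul, nat_hochBar, smul_zero]
  | h2 x y hx hy => simp only [map_add, hx, hy, add_zero]

/-- This lets the proof compute in `Ω̄` instead of the de Rham quotient. A commutator of degree `m`
is `by + (1 - κ)z`. Applying `P` gives an element of `bP` by `lap_harm_mem`, and `bP = i/(m+1)` on
degree `m + 1`. -/
theorem nat_eq_zero_iff {n : ℤ} {f : OmegaBar k A} (hf : f ∈ degBar k A n) :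
    nat k A f = 0 ↔ ∃ y ∈ degBar k A (n + 1), harmBar k A f = contrBar k A y := by
  constructor
  · intro h
    obtain rfl | ⟨m, hm, x, hx, rfl⟩ := degBar_cases hf
    · exact ⟨0, zero_mem _, by simp only [map_zero]⟩
    rw [nat, Submodule.mkQ_apply, Submodule.Quotient.mk_eq_zero] at h
    obtain ⟨w, hw, hwx⟩ := h
    obtain ⟨y, hy, z, hz, e⟩ := degComp_comm m hw
    obtain ⟨y', hy', e'⟩ := lap_harm_mem hz
    -- The commutator `w` agrees with `x` only modulo scalars and need not be homogeneous. Its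
    -- degree `m` component still has the same class.
    have h1 : (scal k A).mkQ x = (scal k A).mkQ (degComp k A m w) := by
      rw [Submodule.mkQ_apply, Submodule.mkQ_apply, Submodule.Quotient.eq] at hwx ⊢
      have h2 := degComp_scal m hwx
      rw [map_sub, degComp_same hx] at h2
      rw [← neg_sub]
      exact neg_mem h2
    have h3 : harm k A (degComp k A m w) = hoch k A (harm k A (y + y')) := by
      have : harm k A ((1 - kar k A) z) = (1 - kar k A) (harm k A z) := by
        simp [harm_kar]
      rw [e, map_add, harm_hoch, this, e', map_add, map_add]
    have h4 : algebraMap ℚ k (((m + 1 : ℕ) : ℚ))⁻¹ * ((m + 1 : ℕ) : k) = 1 := by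
      rw [← map_natCast (algebraMap ℚ k), ← map_mul,
        inv_mul_cancel₀ (by exact_mod_cast m.succ_ne_zero), map_one]
    refine ⟨(scal k A).mkQ (algebraMap ℚ k (((m + 1 : ℕ) : ℚ))⁻¹ • (y + y')),
      mkQ_mem_degBar (Submodule.smul_mem _ _ (add_mem hy hy')) (by omega), ?_⟩
    rw [h1, harmBar_mk, contrBar_mk, h3, map_smul, contr_eq (add_mem hy hy'),
      ← Nat.cast_smul_eq_nsmul k, smul_smul, h4, one_smul]
  · rintro ⟨y, -, h⟩
    rw [← nat_harmBar, h, nat_contrBar]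

/-- `P` kills the generators `(1 - κ)dx` because `κ` fixes `dP`. Conversely, if `w = dv` by
exactness and `Pw = 0`, then `w = (bd + db)G dv = (1 - κ)d(Gv)`. -/
theorem mem_dcommBar_iff {s : OmegaBar k A →ₗ[k] OmegaBar k A} (hs : IsContraction s) {n : ℤ}
    {w : OmegaBar k A} (hw : w ∈ degBar k A n) :
    w ∈ dcommBar k A ↔ dBar k A w = 0 ∧ harmBar k A w = 0 := by
  constructor
  · rintro ⟨w, hw', rfl⟩
    have h : dcomm k A ≤ LinearMap.ker (d k A) ⊓ LinearMap.ker (harm k A) := by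
      refine dcomm_le fun n x hx => Submodule.mem_inf.2 ⟨?_, ?_⟩
      · rw [LinearMap.mem_ker, lap_d, d_d]
      · rw [LinearMap.mem_ker, LinearMap.sub_apply, map_sub, Module.End.one_apply, harm_kar,
          harm_d, kar_d_harm hx, sub_self]
    obtain ⟨h1, h2⟩ := h hw'
    rw [dBar_mk, harmBar_mk, LinearMap.mem_ker.1 h1, LinearMap.mem_ker.1 h2]
    simp only [map_zero, and_self]
  · rintro ⟨h1, h2⟩
    have h3 := sub_harmBar w
    rw [h2, sub_zero] at h3
    rw [← hs.d_eq h1] at h3 ⊢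
    generalize s w = v at *
    rw [h3]
    clear hs hw h1 h2 h3
    induction v using omegaBar_induction with
    | h1 n x hx =>
      rw [dBar_mk, greenBar_mk, hochBar_mk, dBar_mk, dBar_mk, hochBar_mk, ← map_add, hoch_d_add,
        green_d]
      exact ⟨_, lap_d_mem_dcomm (green_mem hx), rfl⟩
    | h2 x y hx hy =>
      simp only [map_add]
      rw [add_add_add_comm]
      exact add_mem hx hy

end

/-! ### Maps between subquotients -/

section

variable {k : Type*} [CommRing k] {M N : Type*} [AddCommGroup M] [Module k M]
  [AddCommGroup N] [Module k N]

theorem exists_represents {Z W : Submodule k M} (q : SubQuot Z W) : ∃ x, Represents x q := by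
  obtain ⟨⟨x, h⟩, rfl⟩ := Submodule.mkQ_surjective _ q
  exact ⟨x, h, rfl⟩

theorem represents_mk {Z W : Submodule k M} {x : M} (h : x ∈ Z) :
    Represents x ((W.comap Z.subtype).mkQ ⟨x, h⟩ : SubQuot Z W) := ⟨h, rfl⟩

theorem Represents.mem {Z W : Submodule k M} {x : M} {q : SubQuot Z W} (h : Represents x q) :
    x ∈ Z := h.1

theorem Represents.eq {Z W : Submodule k M} {x : M} {q q' : SubQuot Z W} (h : Represents x q)
    (h' : Represents x q') : q = q' := by
  obtain ⟨_, rfl⟩ := h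
  obtain ⟨_, rfl⟩ := h'
  rfl

theorem Represents.eq_zero_iff {Z W : Submodule k M} {x : M} {q : SubQuot Z W}
    (h : Represents x q) : q = 0 ↔ x ∈ W := by
  obtain ⟨h, rfl⟩ := h
  rw [Submodule.Quotient.mk_eq_zero]
  rfl

theorem Represents.congr {Z W : Submodule k M} {x y : M} {q : SubQuot Z W}
    (h : Represents x q) (hy : y ∈ Z) (hxy : x - y ∈ W) : Represents y q := by
  obtain ⟨h, rfl⟩ := h
  refine ⟨hy, ?_⟩
  rw [eq_comm, Submodule.Quotient.eq]
  exact hxy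

/-- A surjection `φ` factors a linear map vanishing on its kernel. -/
theorem exists_factor {Y X T : Type*} [AddCommGroup Y] [Module k Y] [AddCommGroup X] [Module k X]
    [AddCommGroup T] [Module k T] (φ : Y →ₗ[k] X) (hφ : Function.Surjective φ) (ψ : Y →ₗ[k] T)
    (h : ∀ y, φ y = 0 → ψ y = 0) : ∃ l : X →ₗ[k] T, ∀ y, l (φ y) = ψ y := by
  refine ⟨(LinearMap.ker φ).liftQ ψ (fun y hy => h y hy) ∘ₗ
    (φ.quotKerEquivOfSurjective hφ).symm.toLinearMap, fun y => ?_⟩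
  have : (φ.quotKerEquivOfSurjective hφ).symm (φ y) = (LinearMap.ker φ).mkQ y := by
    rw [LinearEquiv.symm_apply_eq]
    rfl
  rw [LinearMap.comp_apply, LinearEquiv.coe_coe, this]
  exact (LinearMap.ker φ).liftQ_apply ψ y

/-- A linear map of subquotients defined on representatives through a correspondence. -/
theorem exists_subQuot_rel_map {P : Type*} [AddCommGroup P] [Module k P] (Y : Submodule k P)
    (α : P →ₗ[k] M) (β : P →ₗ[k] N) {Z W : Submodule k M} {Z' W' : Submodule k N}
    (hα : ∀ p ∈ Y, α p ∈ Z) (hβ : ∀ p ∈ Y, β p ∈ Z') (hs : ∀ z ∈ Z, ∃ p ∈ Y, α p = z)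
    (hW : ∀ p ∈ Y, α p ∈ W → β p ∈ W') :
    ∃ l : SubQuot Z W →ₗ[k] SubQuot Z' W',
      ∀ p ∈ Y, ∀ q, Represents (α p) q → Represents (β p) (l q) := by
  obtain ⟨l, hl⟩ := exists_factor ((W.comap Z.subtype).mkQ ∘ₗ α.restrict hα)
    (fun q => by
      obtain ⟨⟨z, hz⟩, rfl⟩ := Submodule.mkQ_surjective _ q
      obtain ⟨p, hp, rfl⟩ := hs z hz
      exact ⟨⟨p, hp⟩, rfl⟩)
    ((W'.comap Z'.subtype).mkQ ∘ₗ β.restrict hβ) (by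
      rintro ⟨p, hp⟩ h
      rw [LinearMap.comp_apply, Submodule.mkQ_apply, Submodule.Quotient.mk_eq_zero] at h ⊢
      exact hW p hp h)
  refine ⟨l, fun p hp q hq => ?_⟩
  obtain ⟨h, rfl⟩ := hq
  exact ⟨hβ p hp, (hl ⟨p, hp⟩).symm⟩

/-- As `exists_subQuot_rel_map`, for maps into a submodule. -/
theorem exists_subQuot_rel_map' {P : Type*} [AddCommGroup P] [Module k P] (Y : Submodule k P)
    (α : P →ₗ[k] M) (β : P →ₗ[k] N) {Z W : Submodule k M} {Z' : Submodule k N}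
    (hα : ∀ p ∈ Y, α p ∈ Z) (hβ : ∀ p ∈ Y, β p ∈ Z') (hs : ∀ z ∈ Z, ∃ p ∈ Y, α p = z)
    (hW : ∀ p ∈ Y, α p ∈ W → β p = 0) :
    ∃ l : SubQuot Z W →ₗ[k] Z', ∀ p ∈ Y, ∀ q, Represents (α p) q → (l q : N) = β p := by
  obtain ⟨l, hl⟩ := exists_factor ((W.comap Z.subtype).mkQ ∘ₗ α.restrict hα)
    (fun q => by
      obtain ⟨⟨z, hz⟩, rfl⟩ := Submodule.mkQ_surjective _ q
      obtain ⟨p, hp, rfl⟩ := hs z hz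
      exact ⟨⟨p, hp⟩, rfl⟩)
    (β.restrict hβ) (by
      rintro ⟨p, hp⟩ h
      rw [LinearMap.comp_apply, Submodule.mkQ_apply, Submodule.Quotient.mk_eq_zero] at h
      exact Subtype.ext (hW p hp h))
  refine ⟨l, fun p hp q hq => ?_⟩
  obtain ⟨h, rfl⟩ := hq
  exact congrArg Subtype.val (hl ⟨p, hp⟩)

/-- As `exists_subQuot_rel_map`, for maps out of a submodule. -/
theorem exists_submodule_rel_map {P : Type*} [AddCommGroup P] [Module k P] (Y : Submodule k P)
    (α : P →ₗ[k] M) (β : P →ₗ[k] N) {Z : Submodule k M} {Z' W' : Submodule k N}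
    (hα : ∀ p ∈ Y, α p ∈ Z) (hβ : ∀ p ∈ Y, β p ∈ Z') (hs : ∀ z ∈ Z, ∃ p ∈ Y, α p = z)
    (hW : ∀ p ∈ Y, α p = 0 → β p ∈ W') :
    ∃ l : Z →ₗ[k] SubQuot Z' W', ∀ p ∈ Y, ∀ z : Z, α p = z → Represents (β p) (l z) := by
  obtain ⟨l, hl⟩ := exists_factor (α.restrict hα)
    (fun z => by
      obtain ⟨p, hp, h⟩ := hs z z.2
      exact ⟨⟨p, hp⟩, Subtype.ext h⟩)
    ((W'.comap Z'.subtype).mkQ ∘ₗ β.restrict hβ) (by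
      rintro ⟨p, hp⟩ h
      rw [LinearMap.comp_apply, Submodule.mkQ_apply, Submodule.Quotient.mk_eq_zero]
      exact hW p hp (congrArg Subtype.val h))
  refine ⟨l, fun p hp z hz => ?_⟩
  obtain rfl : α.restrict hα ⟨p, hp⟩ = z := Subtype.ext hz
  exact ⟨hβ p hp, (hl ⟨p, hp⟩).symm⟩

/-- A linear map of subquotients induced by a linear map. -/
theorem exists_subQuot_map (T : M →ₗ[k] N) {Z W : Submodule k M} {Z' W' : Submodule k N}
    (hZ : ∀ x ∈ Z, T x ∈ Z') (hW : ∀ x ∈ Z, x ∈ W → T x ∈ W') :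
    ∃ l : SubQuot Z W →ₗ[k] SubQuot Z' W', ∀ x q, Represents x q → Represents (T x) (l q) := by
  obtain ⟨l, hl⟩ := exists_subQuot_rel_map Z LinearMap.id T (fun _ h => h) hZ
    (fun z hz => ⟨z, hz, rfl⟩) hW
  exact ⟨l, fun x q h => hl x h.mem q h⟩

theorem exists_subQuot_equiv (T : M →ₗ[k] N) {Z W : Submodule k M} {Z' W' : Submodule k N}
    (hZ : ∀ x ∈ Z, T x ∈ Z') (hW : ∀ x ∈ Z, T x ∈ W' ↔ x ∈ W)
    (hs : ∀ y ∈ Z', ∃ x ∈ Z, T x - y ∈ W') :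
    ∃ l : SubQuot Z W ≃ₗ[k] SubQuot Z' W', ∀ x q, Represents x q → Represents (T x) (l q) := by
  obtain ⟨l, hl⟩ := exists_subQuot_map T hZ fun x hx => (hW x hx).2
  refine ⟨LinearEquiv.ofBijective l ⟨?_, ?_⟩, hl⟩
  · refine (injective_iff_map_eq_zero l).2 fun q hq => ?_
    obtain ⟨x, hx⟩ := exists_represents q
    rw [hx.eq_zero_iff, ← hW x hx.mem, ← (hl x q hx).eq_zero_iff, hq]
  · intro q
    obtain ⟨y, hy⟩ := exists_represents q
    obtain ⟨x, hx, h⟩ := hs y hy.mem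
    refine ⟨_, (hl x _ (represents_mk hx)).eq (hy.congr (hZ x hx) ?_)⟩
    rw [← neg_sub]
    exact neg_mem h

theorem exists_subQuot_equiv' (T : M →ₗ[k] N) {Z W : Submodule k M} {Z' : Submodule k N}
    (hZ : ∀ x ∈ Z, T x ∈ Z') (hW : ∀ x ∈ Z, T x = 0 ↔ x ∈ W)
    (hs : ∀ y ∈ Z', ∃ x ∈ Z, T x = y) :
    ∃ l : SubQuot Z W ≃ₗ[k] Z', ∀ x q, Represents x q → (l q : N) = T x := by
  obtain ⟨l, hl⟩ := exists_subQuot_rel_map' Z LinearMap.id T (fun _ h => h) hZ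
    (fun z hz => ⟨z, hz, rfl⟩) fun x hx => (hW x hx).2
  have hl' : ∀ x q, Represents x q → (l q : N) = T x := fun x q h => hl x h.mem q h
  refine ⟨LinearEquiv.ofBijective l ⟨?_, ?_⟩, hl'⟩
  · refine (injective_iff_map_eq_zero l).2 fun q hq => ?_
    obtain ⟨x, hx⟩ := exists_represents q
    rw [hx.eq_zero_iff, ← hW x hx.mem, ← hl' x q hx, hq]
    rfl
  · rintro ⟨y, hy⟩
    obtain ⟨x, hx, rfl⟩ := hs y hy
    exact ⟨_, Subtype.ext (hl' x _ (represents_mk hx))⟩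

end

/-! ### Series -/

section

variable {k : Type u} [CommRing k] {A : Type v} [Ring A] [Algebra k A]

theorem mulU_apply (f : ℤ → OmegaBar k A) (j : ℤ) : mulU k A f j = f (j - 1) := rfl

theorem diffID_apply (f : ℤ → OmegaBar k A) (j : ℤ) :
    diffID k A f j = contrBar k A (f j) - dBar k A (f (j - 1)) := rfl

theorem diffBB_apply (f : ℤ → OmegaBar k A) (j : ℤ) :
    diffBB k A f j = hochBar k A (f j) - connesBar k A (f (j - 1)) := rfl

theorem const_zero (x : OmegaBar k A) : const k A x 0 = x := by
  simp [const]

theorem const_ne (x : OmegaBar k A) {j : ℤ} (hj : j ≠ 0) : const k A x j = 0 := by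
  simp [const, hj]

theorem truncate_of_pos (f : ℤ → OmegaBar k A) {j : ℤ} (hj : 0 < j) : truncate k A f j = 0 := by
  simp [truncate, hj]

theorem truncate_of_nonpos (f : ℤ → OmegaBar k A) {j : ℤ} (hj : j ≤ 0) :
    truncate k A f j = f j := by
  simp [truncate, not_lt.2 hj]

theorem constTerm_apply (f : ℤ → OmegaBar k A) : constTerm k A f = nat k A (f 0) := rfl

theorem diffID_mulU (f : ℤ → OmegaBar k A) :
    diffID k A (mulU k A f) = mulU k A (diffID k A f) := rfl

theorem diffID_const (x : OmegaBar k A) :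
    diffID k A (const k A x) = const k A (contrBar k A x) - mulU k A (const k A (dBar k A x)) := by
  funext j
  rw [diffID_apply, Pi.sub_apply, mulU_apply]
  have h : ∀ (T : OmegaBar k A →ₗ[k] OmegaBar k A) (i : ℤ),
      T (const k A x i) = const k A (T x) i := fun T i => by
    by_cases hi : i = 0
    · subst hi
      rw [const_zero, const_zero]
    · rw [const_ne _ hi, const_ne _ hi, map_zero]
  rw [h, h]

theorem degBar_cast {m n : ℤ} {x : OmegaBar k A} (hx : x ∈ degBar k A m)
    (h : n = m := by omega) : x ∈ degBar k A n := h ▸ hx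

theorem laurent_mem {n : ℤ} {f : ℤ → OmegaBar k A} (hf : f ∈ laurent k A n) {m : ℤ} (j : ℤ)
    (h : m = n + 2 * j := by omega) : f j ∈ degBar k A m := h ▸ hf j

theorem const_mem_power {n : ℤ} {x : OmegaBar k A} (hx : x ∈ degBar k A n) :
    const k A x ∈ power k A n := by
  refine ⟨fun j => ?_, fun j hj => const_ne x hj.ne⟩
  by_cases h : j = 0
  · subst h
    rw [const_zero]
    exact degBar_cast hx
  · rw [const_ne x h]
    exact zero_mem _

end

section

variable {k : Type u} [CommRing k] [Algebra ℚ k] {A : Type v} [Ring A] [Algebra k A]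

/-- Solving `(i - u d) g = f` in the powers of `u` at most `j₀`, given the coefficient of `g`
at `j₀`. -/
theorem exists_descending {s : OmegaBar k A →ₗ[k] OmegaBar k A} (hs : IsContraction s) {n m : ℤ}
    (hm : m = n + 1) {j₀ : ℤ} {f : ℤ → OmegaBar k A} (hf : f ∈ laurent k A n)
    (hcyc : ∀ j ≤ j₀, contrBar k A (f j) = dBar k A (f (j - 1))) {a : OmegaBar k A}
    (ha : a ∈ degBar k A (m + 2 * j₀)) (had : dBar k A (contrBar k A a) = dBar k A (f j₀)) :
    ∃ g ∈ laurent k A m, g j₀ = a ∧ (∀ j, j₀ < j → g j = 0) ∧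
      ∀ j ≤ j₀, contrBar k A (g j) - dBar k A (g (j - 1)) = f j := by
  -- `h t` is the coefficient at `j₀ - t`. Each one is the primitive, chosen by the contraction, of
  -- what `d g_{j-1}` must equal.
  let h : ℕ → OmegaBar k A := fun t => Nat.rec a (fun t y => s (contrBar k A y - f (j₀ - t))) t
  have h0 : h 0 = a := rfl
  have h1 : ∀ t, h (t + 1) = s (contrBar k A (h t) - f (j₀ - t)) := fun t => rfl
  -- The invariant `d i g_j = d f_j` says that the next right-hand side is closed. It persists: for
  -- `z = i g_j - f_j`, anticommutation gives `d i (s z) = -i z = i f_j = d f_{j-1}`.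
  have key : ∀ t : ℕ, h t ∈ degBar k A (m + 2 * (j₀ - t)) ∧
      dBar k A (contrBar k A (h t)) = dBar k A (f (j₀ - t)) := by
    intro t
    induction t with
    | zero => exact ⟨by rw [h0]; exact degBar_cast ha, by rw [h0, had]; simp⟩
    | succ t ih =>
      rw [h1]
      have e : dBar k A (contrBar k A (h t) - f (j₀ - t)) = 0 := by rw [map_sub, ih.2, sub_self]
      refine ⟨hs.mem (sub_mem (contrBar_mem ih.1 (n := m + 2 * (j₀ - t) - 1))
        (laurent_mem hf (j₀ - t))) (by push_cast; omega), ?_⟩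
      have e2 := contrBar_dBar (s (contrBar k A (h t) - f (j₀ - t)))
      rw [hs.d_eq e, map_sub, contrBar_contrBar, zero_sub, neg_inj] at e2
      rw [← e2, hcyc _ (by omega)]
      congr 2
      push_cast
      ring
  refine ⟨fun j => if j ≤ j₀ then h (j₀ - j).toNat else 0, ?_, ?_, ?_, ?_⟩
  · intro j
    dsimp only
    split_ifs with hj
    · exact degBar_cast (key _).1
    · exact zero_mem _
  · simp [h0]
  · intro j hj
    simp [not_le.2 hj]
  · intro j hj
    obtain ⟨t, rfl⟩ : ∃ t : ℕ, j = j₀ - t := ⟨(j₀ - j).toNat, by omega⟩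
    have e1 : (j₀ - (j₀ - (t : ℤ))).toNat = t := by omega
    have e2 : (j₀ - (j₀ - (t : ℤ) - 1)).toNat = t + 1 := by omega
    have e : dBar k A (contrBar k A (h t) - f (j₀ - t)) = 0 := by
      rw [map_sub, (key t).2, sub_self]
    dsimp only
    rw [if_pos hj, if_pos (by omega), e1, e2, h1, hs.d_eq e]
    abel

end

/-! ### Comparison of `b - u B` and `i - u d` -/

section

variable {k : Type u} [CommRing k] [Algebra ℚ k] {A : Type v} [Ring A] [Algebra k A]

variable (k) in
/-- The scalar `p!`, for `p ∈ ℤ` (with `p! = 1` for `p < 0`). -/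
def facZ (p : ℤ) : k := algebraMap ℚ k (p.toNat.factorial : ℚ)

variable (k) in
/-- The scalar `1 / p!`. -/
def invFacZ (p : ℤ) : k := algebraMap ℚ k (p.toNat.factorial : ℚ)⁻¹

theorem facZ_mul_invFacZ (p : ℤ) : facZ k p * invFacZ k p = 1 := by
  rw [facZ, invFacZ, ← map_mul, mul_inv_cancel₀ (by exact_mod_cast p.toNat.factorial_ne_zero),
    map_one]

theorem facZ_natCast_succ (m : ℕ) : facZ k ((m + 1 : ℕ) : ℤ) = (m + 1 : ℕ) * facZ k m := by
  simp only [facZ, Int.toNat_natCast, Nat.factorial_succ]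
  push_cast
  simp

theorem invFacZ_natCast_succ (m : ℕ) : (m + 1 : ℕ) * invFacZ k ((m + 1 : ℕ) : ℤ) = invFacZ k m := by
  have h1 := facZ_mul_invFacZ (k := k) ((m + 1 : ℕ) : ℤ)
  have h2 := facZ_mul_invFacZ (k := k) (m : ℤ)
  rw [facZ_natCast_succ] at h1
  linear_combination invFacZ k (m : ℤ) * h1 - ((m + 1 : ℕ) * invFacZ k ((m + 1 : ℕ) : ℤ)) * h2

/-- This is `p / p! = 1 / (p-1)!` combined with `i = p bP`; the next three lemmas are its analogues
for `d` and for multiplication by factorials. The convention `p! = 1` for `p < 0` is harmless, as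
forms of negative degree vanish. -/
theorem invFacZ_smul_contrBar {p q : ℤ} {x : OmegaBar k A} (hx : x ∈ degBar k A p)
    (hq : q = p - 1) :
    invFacZ k p • contrBar k A x = invFacZ k q • harmBar k A (hochBar k A x) := by
  have h0 := hochBar_mem hx hq
  rcases lt_or_ge q 0 with h | h
  · rw [contrBar_eq hx, ← harmBar_hochBar, eq_zero_of_neg h0 h]
    simp only [map_zero, smul_zero]
  · obtain ⟨m, rfl⟩ := Int.eq_ofNat_of_zero_le h
    obtain rfl : p = (m + 1 : ℕ) := by push_cast; omega
    rw [contrBar_eq hx, ← invFacZ_natCast_succ m, harmBar_hochBar, natCast_zsmul,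
      ← Nat.cast_smul_eq_nsmul k, smul_smul, mul_comm]

theorem invFacZ_smul_dBar {p q : ℤ} {x : OmegaBar k A} (hx : x ∈ degBar k A p)
    (hq : q = p + 1) :
    invFacZ k p • dBar k A (harmBar k A x) = invFacZ k q • harmBar k A (connesBar k A x) := by
  rcases lt_or_ge p 0 with h | h
  · rw [eq_zero_of_neg hx h]
    simp only [map_zero, smul_zero]
  · obtain ⟨m, rfl⟩ := Int.eq_ofNat_of_zero_le h
    obtain rfl : q = (m + 1 : ℕ) := by push_cast; omega
    have e : ((m : ℤ) + 1) = ((m + 1 : ℕ) : ℤ) := by push_cast; rfl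
    rw [connesBar_eq hx, ← invFacZ_natCast_succ m, map_zsmul, harmBar_dBar, harmBar_harmBar, e,
      natCast_zsmul, ← Nat.cast_smul_eq_nsmul k, smul_smul, mul_comm]

theorem facZ_smul_contrBar {p q : ℤ} {x : OmegaBar k A} (hx : x ∈ degBar k A p)
    (hq : q = p - 1) :
    facZ k q • harmBar k A (contrBar k A x) = facZ k p • hochBar k A (harmBar k A x) := by
  have h0 := hochBar_mem hx hq
  rcases lt_or_ge q 0 with h | h
  · rw [contrBar_eq hx, ← harmBar_hochBar, eq_zero_of_neg h0 h]
    simp only [map_zero, smul_zero]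
  · obtain ⟨m, rfl⟩ := Int.eq_ofNat_of_zero_le h
    obtain rfl : p = (m + 1 : ℕ) := by push_cast; omega
    rw [harmBar_contrBar, contrBar_eq hx, facZ_natCast_succ, natCast_zsmul,
      ← Nat.cast_smul_eq_nsmul k, smul_smul, mul_comm]

theorem facZ_smul_dBar {p q : ℤ} {x : OmegaBar k A} (hx : x ∈ degBar k A p)
    (hq : q = p + 1) :
    facZ k q • harmBar k A (dBar k A x) = facZ k p • connesBar k A (harmBar k A x) := by
  rcases lt_or_ge p 0 with h | h
  · rw [eq_zero_of_neg hx h]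
    simp only [map_zero, smul_zero]
  · obtain ⟨m, rfl⟩ := Int.eq_ofNat_of_zero_le h
    obtain rfl : q = (m + 1 : ℕ) := by push_cast; omega
    have e : ((m : ℤ) + 1) = ((m + 1 : ℕ) : ℤ) := by push_cast; rfl
    rw [connesBar_eq (harmBar_mem hx), facZ_natCast_succ, harmBar_dBar, harmBar_harmBar, e,
      natCast_zsmul, ← Nat.cast_smul_eq_nsmul k, smul_smul, mul_comm]

variable (k A) in
/-- On series of total degree `n`: apply `harm` and divide the component of degree `p` by `p!`. -/
def harmDiv (n : ℤ) : (ℤ → OmegaBar k A) →ₗ[k] (ℤ → OmegaBar k A) :=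
  LinearMap.pi fun j => invFacZ k (n + 2 * j) • (harmBar k A ∘ₗ LinearMap.proj j)

variable (k A) in
/-- On series of total degree `n`: apply `harm` and multiply the component of degree `p` by `p!`. -/
def harmMul (n : ℤ) : (ℤ → OmegaBar k A) →ₗ[k] (ℤ → OmegaBar k A) :=
  LinearMap.pi fun j => facZ k (n + 2 * j) • (harmBar k A ∘ₗ LinearMap.proj j)

theorem harmDiv_apply (n : ℤ) (f : ℤ → OmegaBar k A) (j : ℤ) :
    harmDiv k A n f j = invFacZ k (n + 2 * j) • harmBar k A (f j) := rfl

theorem harmMul_apply (n : ℤ) (f : ℤ → OmegaBar k A) (j : ℤ) :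
    harmMul k A n f j = facZ k (n + 2 * j) • harmBar k A (f j) := rfl

theorem harmDiv_mem_laurent {n : ℤ} {f : ℤ → OmegaBar k A} (hf : f ∈ laurent k A n) :
    harmDiv k A n f ∈ laurent k A n := fun j => Submodule.smul_mem _ _ (harmBar_mem (hf j))

theorem harmMul_mem_laurent {n : ℤ} {f : ℤ → OmegaBar k A} (hf : f ∈ laurent k A n) :
    harmMul k A n f ∈ laurent k A n := fun j => Submodule.smul_mem _ _ (harmBar_mem (hf j))

theorem harmDiv_mem_power {n : ℤ} {f : ℤ → OmegaBar k A} (hf : f ∈ power k A n) :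
    harmDiv k A n f ∈ power k A n := ⟨harmDiv_mem_laurent hf.1, fun j hj => by
  rw [harmDiv_apply, hf.2 j hj, map_zero, smul_zero]⟩

theorem harmMul_mem_power {n : ℤ} {f : ℤ → OmegaBar k A} (hf : f ∈ power k A n) :
    harmMul k A n f ∈ power k A n := ⟨harmMul_mem_laurent hf.1, fun j hj => by
  rw [harmMul_apply, hf.2 j hj, map_zero, smul_zero]⟩

theorem harmMul_mem_polar {n : ℤ} {f : ℤ → OmegaBar k A} (hf : f ∈ polar k A n) :
    harmMul k A n f ∈ polar k A n := ⟨harmMul_mem_laurent hf.1, fun j hj => by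
  rw [harmMul_apply, hf.2 j hj, map_zero, smul_zero]⟩

theorem harmMul_harmDiv (n : ℤ) (f : ℤ → OmegaBar k A) :
    harmMul k A n (harmDiv k A n f) = fun j => harmBar k A (f j) := by
  funext j
  rw [harmMul_apply, harmDiv_apply, map_smul, harmBar_harmBar, smul_smul, facZ_mul_invFacZ,
    one_smul]

theorem harmDiv_harmMul (n : ℤ) (f : ℤ → OmegaBar k A) :
    harmDiv k A n (harmMul k A n f) = fun j => harmBar k A (f j) := by
  funext j
  rw [harmDiv_apply, harmMul_apply, map_smul, harmBar_harmBar, smul_smul, mul_comm,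
    facZ_mul_invFacZ, one_smul]

/-- With `diffBB_harmMul`, this gives chain maps in both directions between the two complexes.
Either composite is `P`, so only the complement of `P` remains to be compared. -/
theorem diffID_harmDiv {n m : ℤ} (hm : m = n - 1) {f : ℤ → OmegaBar k A}
    (hf : f ∈ laurent k A n) : diffID k A (harmDiv k A n f) = harmDiv k A m (diffBB k A f) := by
  funext j
  rw [diffID_apply, harmDiv_apply, harmDiv_apply, harmDiv_apply, diffBB_apply, map_smul, map_smul,
    contrBar_harmBar, invFacZ_smul_contrBar (hf j) (q := m + 2 * j) (by omega),
    invFacZ_smul_dBar (hf (j - 1)) (q := m + 2 * j) (by omega), map_sub, smul_sub]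

theorem diffBB_harmMul {n m : ℤ} (hm : m = n - 1) {f : ℤ → OmegaBar k A}
    (hf : f ∈ laurent k A n) : diffBB k A (harmMul k A n f) = harmMul k A m (diffID k A f) := by
  funext j
  rw [diffBB_apply, harmMul_apply, harmMul_apply, harmMul_apply, diffID_apply, map_smul, map_smul,
    ← facZ_smul_contrBar (hf j) (q := m + 2 * j) (by omega),
    ← facZ_smul_dBar (hf (j - 1)) (q := m + 2 * j) (by omega), map_sub, smul_sub]

variable (k A) in
/-- The homotopy trivializing the complement of the image of `harm`, coefficientwise. -/
def greenSer : (ℤ → OmegaBar k A) →ₗ[k] (ℤ → OmegaBar k A) :=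
  (dBar k A ∘ₗ greenBar k A).compLeft ℤ

theorem greenSer_apply (f : ℤ → OmegaBar k A) (j : ℤ) :
    greenSer k A f j = dBar k A (greenBar k A (f j)) := rfl

theorem greenSer_mem_laurent {n m : ℤ} (hm : m = n + 1) {f : ℤ → OmegaBar k A}
    (hf : f ∈ laurent k A n) : greenSer k A f ∈ laurent k A m := fun j => by
  rw [greenSer_apply]
  exact dBar_mem (greenBar_mem (hf j))

/-- `dG` is a homotopy from `P` to the identity on cycles. In `1 - P = bdG + dbG` the last term
dies: `b f_j = B f_{j-1}` is a multiple of `dP f_{j-1}`, so `d` kills `G b f_j`. Moreover `B dG =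
0`. The cycle condition is needed only at the coefficient in question, so truncated series are
covered too. -/
theorem diffBB_greenSer {n : ℤ} {f : ℤ → OmegaBar k A} (hf : f ∈ laurent k A n) {j : ℤ}
    (h : diffBB k A f j = 0) :
    diffBB k A (greenSer k A f) j = f j - harmBar k A (f j) := by
  have h1 : connesBar k A (greenSer k A f (j - 1)) = 0 := by
    rw [greenSer_apply, connesBar_eq (dBar_mem (greenBar_mem (hf (j - 1))) rfl), harmBar_dBar,
      dBar_dBar, smul_zero]
  have h2 : dBar k A (hochBar k A (greenBar k A (f j))) = 0 := by
    rw [diffBB_apply, sub_eq_zero] at h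
    rw [← greenBar_hochBar, h, connesBar_eq (hf (j - 1)), map_zsmul, greenBar_dBar, map_zsmul,
      dBar_dBar, smul_zero]
  rw [diffBB_apply, h1, sub_zero, sub_harmBar, h2, add_zero, greenSer_apply]

/-- A cycle killed by `harm` is a boundary, up to its constant term. -/
theorem exists_diffID_eq {s : OmegaBar k A →ₗ[k] OmegaBar k A} (hs : IsContraction s) {n m : ℤ}
    (hm : m = n + 1) {f : ℤ → OmegaBar k A} (hf : f ∈ laurent k A n) (h : diffID k A f = 0)
    (h' : ∀ j, harmBar k A (f j) = 0) :
    (∀ j, dBar k A (f j) = 0) ∧ (∃ g ∈ laurent k A m, diffID k A g = f) ∧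
      ((∀ j < 0, f j = 0) → ∃ g ∈ power k A m, diffID k A g + const k A (f 0) = f) := by
  -- Since `i = iP`, the equation `i f_{j+1} = d f_j` forces every coefficient to be closed.
  have hi : ∀ j, contrBar k A (f j) = 0 := fun j => by
    rw [← contrBar_harmBar, h' j, map_zero]
  have hd : ∀ j, dBar k A (f j) = 0 := fun j => by
    have h1 := congrFun h (j + 1)
    rw [diffID_apply, hi, zero_sub, add_sub_cancel_right] at h1
    exact neg_eq_zero.1 h1
  -- Take the primitive `s f_{j+1}` and project it off the image of `P`. It stays a primitive
  -- because `P f_{j+1} = 0`, and it is now killed by `i`. For power series `v_{-1}` is not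
  -- available, which leaves `f_0` unbounded.
  have hv : ∀ j, ∃ v ∈ degBar k A (m + 2 * j), contrBar k A v = 0 ∧
      dBar k A v = -f (j + 1) := fun j => by
    refine ⟨-(s (f (j + 1)) - harmBar k A (s (f (j + 1)))), ?_, ?_, ?_⟩
    · have h1 : s (f (j + 1)) ∈ degBar k A (m + 2 * j) := hs.mem (hf (j + 1))
      exact neg_mem (sub_mem h1 (harmBar_mem h1))
    · rw [map_neg, map_sub, contrBar_harmBar, sub_self, neg_zero]
    · rw [map_neg, map_sub, ← harmBar_dBar, hs.d_eq (hd _), h', sub_zero]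
  choose v hv1 hv2 hv3 using hv
  refine ⟨hd, ⟨v, hv1, ?_⟩, fun hneg => ⟨fun j => if 0 ≤ j then v j else 0,
    ⟨fun j => ?_, fun j hj => ?_⟩, ?_⟩⟩
  · funext j
    rw [diffID_apply, hv2, hv3, zero_sub, neg_neg, sub_add_cancel]
  · dsimp only
    split_ifs with hj
    · exact hv1 j
    · exact zero_mem _
  · exact if_neg (not_le.2 hj)
  · funext j
    rw [Pi.add_apply, diffID_apply]
    rcases lt_trichotomy j 0 with hj | rfl | hj
    · rw [if_neg (by omega), if_neg (by omega), const_ne _ hj.ne, hneg j hj]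
      simp only [map_zero, sub_zero, add_zero]
    · rw [if_pos le_rfl, if_neg (by omega), const_zero, hv2]
      simp only [map_zero, sub_zero, zero_add]
    · rw [if_pos hj.le, if_pos (by omega), hv2, hv3, const_ne _ hj.ne', zero_sub, neg_neg,
        sub_add_cancel, add_zero]

/-- The denominator of the de Rham model of negative cyclic homology. -/
theorem mem_negBoundary_iff {s : OmegaBar k A →ₗ[k] OmegaBar k A} (hs : IsContraction s) {n : ℤ}
    {f : ℤ → OmegaBar k A} :
    f ∈ (power k A (n + 1)).map (diffID k A) ⊔ (dcommBar k A ⊓ degBar k A n).map (const k A) ↔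
      ∃ g ∈ power k A (n + 1), ∃ w ∈ degBar k A n, dBar k A w = 0 ∧ harmBar k A w = 0 ∧
        f = diffID k A g + const k A w := by
  rw [Submodule.mem_sup]
  constructor
  · rintro ⟨_, ⟨g, hg, rfl⟩, _, ⟨w, hw, rfl⟩, rfl⟩
    obtain ⟨h1, h2⟩ := (mem_dcommBar_iff hs hw.2).1 hw.1
    exact ⟨g, hg, w, hw.2, h1, h2, rfl⟩
  · rintro ⟨g, hg, w, hw, h1, h2, rfl⟩
    exact ⟨_, ⟨g, hg, rfl⟩, _, ⟨w, ⟨(mem_dcommBar_iff hs hw).2 ⟨h1, h2⟩, hw⟩, rfl⟩, rfl⟩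

/-- The leftover constant term is closed and killed by `P`, so it lies in the reduced `[dΩ, dΩ]`. -/
theorem mem_negBoundary_of_harm {s : OmegaBar k A →ₗ[k] OmegaBar k A} (hs : IsContraction s) {n : ℤ}
    {f : ℤ → OmegaBar k A} (hf : f ∈ power k A n) (h : diffID k A f = 0)
    (h' : ∀ j, harmBar k A (f j) = 0) :
    f ∈ (power k A (n + 1)).map (diffID k A) ⊔
      (dcommBar k A ⊓ degBar k A n).map (const k A) := by
  obtain ⟨hd, -, hg⟩ := exists_diffID_eq hs rfl hf.1 h h'
  obtain ⟨g, hg, hgf⟩ := hg hf.2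
  exact (mem_negBoundary_iff hs).2 ⟨g, hg, f 0, laurent_mem hf.1 0, hd 0, h' 0, hgf.symm⟩

end

/-! ### The identifications with the de Rham models -/

section

variable {k : Type*} [CommRing k] {M N : Type*} [AddCommGroup M] [Module k M]
  [AddCommGroup N] [Module k N]

theorem mem_inf_ker {Z : Submodule k M} {T : M →ₗ[k] N} {x : M} :
    x ∈ Z ⊓ LinearMap.ker T ↔ x ∈ Z ∧ T x = 0 := Iff.rfl

theorem mem_inf_comap {Z : Submodule k M} {Y : Submodule k N} {T : M →ₗ[k] N} {x : M} :
    x ∈ Z ⊓ Y.comap T ↔ x ∈ Z ∧ T x ∈ Y := Iff.rfl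

end

section

variable {k : Type u} [CommRing k] [Algebra ℚ k] {A : Type v} [Ring A] [Algebra k A]

theorem zsmul_eq_zero_of_degBar {n : ℤ} (hn : n ≠ 0) {x : OmegaBar k A} (h : n • x = 0) :
    x = 0 := by
  have h' : n.natAbs • x = 0 := by
    rcases Int.natAbs_eq n with e | e
    · rw [e, natCast_zsmul] at h
      exact h
    · rw [e, neg_smul, natCast_zsmul, neg_eq_zero] at h
      exact h
  exact nsmul_eq_zero_of_rat (k := k) (Int.natAbs_ne_zero.2 hn) h'

/-- Since `i = n bP`, the condition `if = 0` says that the harmonic representative `Pf` is a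
`b`-cycle; for `n = 0` this is automatic. For injectivity, a `b`-cycle satisfies `f = Pf + bdGf`,
and `Pf` in the image of `i` is a `b`-boundary. -/
theorem exists_equiv_HH (n : ℤ) : ∃ e : HHStd k A n ≃ₗ[k] HH k A n,
    ∀ f q, Represents f q → (e q : DRBar k A) = nat k A f := by
  have hb : ∀ f ∈ degBar k A n, contrBar k A f = 0 → hochBar k A (harmBar k A f) = 0 := by
    intro f hf h
    by_cases hn : n = 0
    · exact eq_zero_of_neg (hochBar_mem (harmBar_mem hf) rfl) (by omega)
    · rw [contrBar_eq hf] at h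
      exact zsmul_eq_zero_of_degBar hn h
  refine exists_subQuot_equiv' (nat k A) ?_ ?_ ?_
  · intro f hfh
    obtain ⟨hf, h⟩ := mem_inf_ker.1 hfh
    refine mem_inf_ker.2 ⟨⟨f, hf, rfl⟩, ?_⟩
    rw [contrDR_nat, contrBar_eq hf, ← harmBar_hochBar, h, map_zero, smul_zero]
  · intro f hfh
    obtain ⟨hf, h⟩ := mem_inf_ker.1 hfh
    constructor
    · intro h0
      obtain ⟨y, hy, e⟩ := (nat_eq_zero_iff hf).1 h0
      have e1 := sub_harmBar f
      rw [← greenBar_hochBar, h, map_zero, map_zero, add_zero, e, contrBar_eq hy, ← map_zsmul,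
        sub_eq_iff_eq_add, ← map_add] at e1
      exact ⟨_, add_mem (dBar_mem (greenBar_mem hf))
        (zsmul_mem (harmBar_mem hy) _), e1.symm⟩
    · rintro ⟨y, -, rfl⟩
      exact nat_hochBar y
  · rintro _ ⟨⟨f, hf, rfl⟩, h⟩
    exact ⟨harmBar k A f, ⟨harmBar_mem hf, hb f hf h⟩, nat_harmBar f⟩

theorem rescale_apply (n : ℤ) (f : ℤ → OmegaBar k A) (j : ℤ) :
    rescale k A n f j = invFacZ k (n + 2 * j) • f j := rfl

theorem rescale_mem_laurent {n : ℤ} {f : ℤ → OmegaBar k A} (hf : f ∈ laurent k A n) :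
    rescale k A n f ∈ laurent k A n := fun j => Submodule.smul_mem _ _ (hf j)

theorem rescale_mem_power {n : ℤ} {f : ℤ → OmegaBar k A} (hf : f ∈ power k A n) :
    rescale k A n f ∈ power k A n := ⟨rescale_mem_laurent hf.1, fun j hj => by
  rw [rescale_apply, hf.2 j hj, smul_zero]⟩

theorem harmBar_harmDiv_sub_rescale (n : ℤ) (f : ℤ → OmegaBar k A) (j : ℤ) :
    harmBar k A ((harmDiv k A n f - rescale k A n f) j) = 0 := by
  rw [Pi.sub_apply, harmDiv_apply, rescale_apply, map_sub, map_smul, map_smul, harmBar_harmBar,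
    sub_self]

theorem harmBar_harmDiv_harmMul_sub (n : ℤ) (f : ℤ → OmegaBar k A) (j : ℤ) :
    harmBar k A ((harmDiv k A n (harmMul k A n f) - f) j) = 0 := by
  rw [harmDiv_harmMul, Pi.sub_apply, map_sub, harmBar_harmBar, sub_self]

/-- Reconstructs a primitive for `b - uB` from one for `i - ud`: `harmMul` recovers `Pf` and
`greenSer` supplies `f - Pf`. It is stated for one coefficient so that it also serves the truncated
complex. -/
theorem diffBB_of_harmDiv_boundary {n : ℤ} {f g : ℤ → OmegaBar k A} (hf : f ∈ laurent k A n)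
    (hg : g ∈ laurent k A (n + 1)) {j : ℤ} (h : diffBB k A f j = 0)
    (e : harmBar k A (harmDiv k A n f j) = harmBar k A (diffID k A g j)) :
    diffBB k A (harmMul k A (n + 1) g + greenSer k A f) j = f j := by
  have h1 : diffBB k A (harmMul k A (n + 1) g) j = harmBar k A (f j) := by
    rw [diffBB_harmMul (m := n) (by omega) hg, harmMul_apply, ← e, ← harmMul_apply,
      harmMul_harmDiv]
  rw [map_add, Pi.add_apply, h1, diffBB_greenSer hf h, add_sub_cancel]

/-- The isomorphism is induced by `harmDiv`, since `rescale` alone need not produce cycles. When it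
does, the two differ by a cycle killed by `P`, which bounds. -/
theorem exists_equiv_HCPer {s : OmegaBar k A →ₗ[k] OmegaBar k A} (hs : IsContraction s) (n : ℤ) :
    ∃ e : HCPerStd k A n ≃ₗ[k] HCPer k A n, ∀ f (q : HCPerStd k A n), Represents f q →
      diffID k A (rescale k A n f) = 0 → Represents (rescale k A n f) (e q) := by
  have hker : ∀ f ∈ laurent k A n, diffID k A f = 0 → (∀ j, harmBar k A (f j) = 0) →
      f ∈ (laurent k A (n + 1)).map (diffID k A) := fun f hf h h' => by
    obtain ⟨-, ⟨g, hg, e⟩, -⟩ := exists_diffID_eq hs rfl hf h h'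
    exact ⟨g, hg, e⟩
  have hcyc : ∀ f ∈ laurent k A n ⊓ LinearMap.ker (diffBB k A),
      harmDiv k A n f ∈ laurent k A n ⊓ LinearMap.ker (diffID k A) := by
    intro f hfh
    obtain ⟨hf, h⟩ := mem_inf_ker.1 hfh
    refine mem_inf_ker.2 ⟨harmDiv_mem_laurent hf, ?_⟩
    rw [diffID_harmDiv rfl hf, h, map_zero]
  refine Exists.elim (exists_subQuot_equiv (harmDiv k A n)
    (Z := laurent k A n ⊓ LinearMap.ker (diffBB k A))
    (W := (laurent k A (n + 1)).map (diffBB k A))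
    (Z' := laurent k A n ⊓ LinearMap.ker (diffID k A))
    (W' := (laurent k A (n + 1)).map (diffID k A)) hcyc ?_ ?_) fun e he =>
      ⟨e, fun f q hq h => (he f q hq).congr ⟨rescale_mem_laurent hq.mem.1, h⟩ ?_⟩
  · intro f hfh
    obtain ⟨hf, h⟩ := mem_inf_ker.1 hfh
    constructor
    · rintro ⟨g, hg, e⟩
      refine ⟨_, add_mem (harmMul_mem_laurent hg) (greenSer_mem_laurent rfl hf), ?_⟩
      exact funext fun j => diffBB_of_harmDiv_boundary hf hg (congrFun h j) (by rw [e])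
    · rintro ⟨g, hg, rfl⟩
      exact ⟨_, harmDiv_mem_laurent hg, diffID_harmDiv (by omega) hg⟩
  · intro f hfh
    obtain ⟨hf, h⟩ := mem_inf_ker.1 hfh
    have h1 : harmMul k A n f ∈ laurent k A n ⊓ LinearMap.ker (diffBB k A) := by
      refine mem_inf_ker.2 ⟨harmMul_mem_laurent hf, ?_⟩
      rw [diffBB_harmMul rfl hf, h, map_zero]
    refine ⟨_, h1, hker _ (sub_mem (hcyc _ h1).1 hf) ?_ (harmBar_harmDiv_harmMul_sub n f)⟩
    rw [map_sub, h, sub_zero]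
    exact (hcyc _ h1).2
  · refine hker _ (sub_mem (harmDiv_mem_laurent hq.mem.1) (rescale_mem_laurent hq.mem.1)) ?_
      (harmBar_harmDiv_sub_rescale n f)
    rw [map_sub, h, sub_zero]
    exact (hcyc f hq.mem).2

/-- As in the periodic case, except that a cycle killed by `P` bounds only modulo `[dΩ, dΩ]` in the
constant term. -/
theorem exists_equiv_HCNeg {s : OmegaBar k A →ₗ[k] OmegaBar k A} (hs : IsContraction s) (n : ℤ) :
    ∃ e : HCNegStd k A n ≃ₗ[k] HCNeg k A n, ∀ f (q : HCNegStd k A n), Represents f q →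
      diffID k A (rescale k A n f) = 0 → Represents (rescale k A n f) (e q) := by
  have hcyc : ∀ f ∈ power k A n ⊓ LinearMap.ker (diffBB k A),
      harmDiv k A n f ∈ power k A n ⊓ LinearMap.ker (diffID k A) := by
    intro f hfh
    obtain ⟨hf, h⟩ := mem_inf_ker.1 hfh
    refine mem_inf_ker.2 ⟨harmDiv_mem_power hf, ?_⟩
    rw [diffID_harmDiv rfl hf.1, h, map_zero]
  refine Exists.elim (exists_subQuot_equiv (harmDiv k A n)
    (Z := power k A n ⊓ LinearMap.ker (diffBB k A))
    (W := (power k A (n + 1)).map (diffBB k A))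
    (Z' := power k A n ⊓ LinearMap.ker (diffID k A))
    (W' := (power k A (n + 1)).map (diffID k A) ⊔
      (dcommBar k A ⊓ degBar k A n).map (const k A)) hcyc ?_ ?_) fun e he =>
      ⟨e, fun f q hq h => (he f q hq).congr ⟨rescale_mem_power hq.mem.1, h⟩ ?_⟩
  · intro f hfh
    obtain ⟨hf, h⟩ := mem_inf_ker.1 hfh
    constructor
    · intro hfW
      obtain ⟨g, hg, w, hw, -, hw', e⟩ := (mem_negBoundary_iff hs).1 hfW
      refine ⟨_, add_mem (harmMul_mem_power hg) ⟨greenSer_mem_laurent rfl hf.1, fun j hj => ?_⟩, ?_⟩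
      · rw [greenSer_apply, hf.2 j hj, map_zero, map_zero]
      · refine funext fun j => diffBB_of_harmDiv_boundary hf.1 hg.1 (congrFun h j) ?_
        rw [e, Pi.add_apply, map_add, add_eq_left]
        by_cases hj : j = 0
        · subst hj
          rw [const_zero, hw']
        · rw [const_ne _ hj, map_zero]
    · rintro ⟨g, hg, rfl⟩
      exact Submodule.mem_sup_left ⟨_, harmDiv_mem_power hg, diffID_harmDiv (by omega) hg.1⟩
  · intro f hfh
    obtain ⟨hf, h⟩ := mem_inf_ker.1 hfh
    have h1 : harmMul k A n f ∈ power k A n ⊓ LinearMap.ker (diffBB k A) := by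
      refine mem_inf_ker.2 ⟨harmMul_mem_power hf, ?_⟩
      rw [diffBB_harmMul rfl hf.1, h, map_zero]
    refine ⟨_, h1, mem_negBoundary_of_harm hs (sub_mem (hcyc _ h1).1 hf) ?_
      (harmBar_harmDiv_harmMul_sub n f)⟩
    rw [map_sub, h, sub_zero]
    exact (hcyc _ h1).2
  · refine mem_negBoundary_of_harm hs
      (sub_mem (harmDiv_mem_power hq.mem.1) (rescale_mem_power hq.mem.1)) ?_
      (harmBar_harmDiv_sub_rescale n f)
    rw [map_sub, h, sub_zero]
    exact (hcyc f hq.mem).2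

/-- With only nonpositive powers of `u`, the constant term determines a class: the equations for
lower coefficients are solved downwards by exactness of `d`. No factorial appears in the map, as the
factor `n!` on the constant term can be cleared. -/
theorem exists_equiv_HC {s : OmegaBar k A →ₗ[k] OmegaBar k A} (hs : IsContraction s) (n : ℤ) :
    ∃ e : HCStd k A n ≃ₗ[k] HC k A n,
      ∀ f q, Represents f q → Represents (constTerm k A f) (e q) := by
  have hcyc : ∀ f ∈ polar k A n ⊓ LinearMap.ker (truncate k A ∘ₗ diffBB k A), ∀ j ≤ 0,
      diffBB k A f j = 0 := by
    intro f hfh j hj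
    obtain ⟨hf, h⟩ := mem_inf_ker.1 hfh
    rw [LinearMap.comp_apply] at h
    rw [← truncate_of_nonpos (diffBB k A f) hj, h, Pi.zero_apply]
  have hcyc' : ∀ f ∈ polar k A n ⊓ LinearMap.ker (truncate k A ∘ₗ diffBB k A), ∀ j ≤ 0,
      contrBar k A (harmDiv k A n f j) = dBar k A (harmDiv k A n f (j - 1)) := by
    intro f hf j hj
    have h := congrFun (diffID_harmDiv rfl hf.1.1) j
    rw [harmDiv_apply (n - 1), hcyc f hf j hj, map_zero, smul_zero, diffID_apply] at h
    exact sub_eq_zero.1 h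
  refine exists_subQuot_equiv (constTerm k A) ?_ ?_ ?_
  · intro f hf
    refine mem_inf_comap.2 ⟨⟨_, laurent_mem hf.1.1 0, rfl⟩, ?_⟩
    rw [constTerm_apply, contrDR_nat]
    have h := hcyc' f hf 0 le_rfl
    rw [harmDiv_apply, map_smul, contrBar_harmBar] at h
    have h2 := congrArg (fun x => facZ k (n + 2 * 0) • x) h
    simp only [smul_smul, facZ_mul_invFacZ, one_smul] at h2
    rw [h2, ← map_smul]
    exact ⟨_, Submodule.smul_mem _ _ (laurent_mem (harmDiv_mem_laurent hf.1.1) _), rfl⟩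
  · intro f hf
    constructor
    · rintro ⟨_, ⟨h, hh, rfl⟩, e⟩
      rw [dDR_nat, constTerm_apply, eq_comm, ← sub_eq_zero, ← map_sub] at e
      have hf0 : f 0 ∈ degBar k A n := laurent_mem hf.1.1 0
      obtain ⟨y, hy, e⟩ := (nat_eq_zero_iff (sub_mem hf0 (dBar_mem hh))).1 e
      rw [map_sub, harmBar_dBar, sub_eq_iff_eq_add] at e
      have hF0 : harmDiv k A n f 0 = contrBar k A (invFacZ k n • y) +
          dBar k A (invFacZ k n • harmBar k A h) := by
        rw [harmDiv_apply, e, mul_zero, add_zero, smul_add, map_smul, map_smul]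
      -- The constant term of the rescaled series is `(i y + dPh)/n!`. A primitive must start with
      -- `y/n!` at `u⁰` and `-Ph/n!` at `u⁻¹`; the rest is descended from the latter.
      obtain ⟨g, hg, hg0, hgpos, hgeq⟩ := exists_descending hs (n := n) (m := n + 1) rfl (j₀ := -1)
        (f := harmDiv k A n f) (harmDiv_mem_laurent hf.1.1)
        (fun j hj => hcyc' f hf j (by omega)) (a := -(invFacZ k n • harmBar k A h))
        (neg_mem (Submodule.smul_mem _ _ (degBar_cast (harmBar_mem hh)))) (by
          have h1 := hcyc' f hf 0 le_rfl
          rw [zero_sub] at h1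
          rw [← h1, hF0, map_add, contrBar_contrBar, zero_add, contrBar_dBar, map_neg, map_neg])
      have hG : g + const k A (invFacZ k n • y) ∈ polar k A (n + 1) :=
        ⟨add_mem hg (const_mem_power (Submodule.smul_mem _ _ hy)).1, fun j hj => by
          rw [Pi.add_apply, hgpos j (by omega), const_ne _ hj.ne', add_zero]⟩
      have hGr : greenSer k A f ∈ polar k A (n + 1) :=
        ⟨greenSer_mem_laurent rfl hf.1.1, fun j hj => by
          rw [greenSer_apply, hf.1.2 j hj, map_zero, map_zero]⟩
      refine ⟨_, add_mem (harmMul_mem_polar hG) hGr, funext fun j => ?_⟩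
      rw [LinearMap.comp_apply]
      rcases lt_or_ge 0 j with hj | hj
      · rw [truncate_of_pos _ hj, hf.1.2 j hj]
      · rw [truncate_of_nonpos _ hj]
        refine diffBB_of_harmDiv_boundary hf.1.1 hG.1 (hcyc f hf j hj) ?_
        congr 1
        rw [diffID_apply, Pi.add_apply, Pi.add_apply, const_ne (j := j - 1) _ (by omega), add_zero]
        rcases hj.lt_or_eq with hj' | rfl
        · rw [const_ne _ hj'.ne, add_zero, hgeq j (by omega)]
        · rw [hF0, hgpos 0 (by omega), const_zero, zero_add, zero_sub, hg0, map_neg,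
            sub_neg_eq_add]
    · rintro ⟨g, hg, rfl⟩
      rw [constTerm_apply, LinearMap.comp_apply, truncate_of_nonpos _ le_rfl, diffBB_apply,
        map_sub, nat_hochBar, zero_sub, connesBar_eq (hg.1 _), ← map_zsmul, ← map_neg, ← map_neg,
        ← dDR_nat]
      exact ⟨_, ⟨_, neg_mem (zsmul_mem (harmBar_mem (laurent_mem hg.1 _)) _), rfl⟩, rfl⟩
  · rintro _ ⟨⟨f, hf, rfl⟩, w, -, hw⟩
    rw [contrDR_nat] at hw
    obtain ⟨g, hg, hg0, hgpos, hgeq⟩ := exists_descending hs (n := n - 1) (m := n) (by omega)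
      (j₀ := 0) (f := 0) (zero_mem _) (fun j hj => by simp only [Pi.zero_apply, map_zero])
      (a := harmBar k A f) (degBar_cast (harmBar_mem hf)) (by
        rw [contrBar_harmBar, ← hw, dBar_dBar, Pi.zero_apply, map_zero])
    have hgp : g ∈ polar k A n := ⟨hg, hgpos⟩
    -- The factor `1/n!` cancels the `n!` that `harmMul` puts on the constant term, so that this
    -- term becomes `Pf`.
    refine ⟨invFacZ k n • harmMul k A n g,
      mem_inf_ker.2 ⟨Submodule.smul_mem _ _ (harmMul_mem_polar hgp), ?_⟩, ?_⟩
    · rw [map_smul, LinearMap.comp_apply, diffBB_harmMul rfl hg]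
      convert smul_zero _
      funext j
      rcases lt_or_ge 0 j with hj | hj
      · rw [truncate_of_pos _ hj]; rfl
      · rw [truncate_of_nonpos _ hj, harmMul_apply, diffID_apply, hgeq j hj, Pi.zero_apply,
          map_zero, smul_zero]
    · rw [map_smul, constTerm_apply, harmMul_apply, hg0, harmBar_harmBar, map_smul, smul_smul,
        mul_zero, add_zero, mul_comm, facZ_mul_invFacZ, one_smul, nat_harmBar, sub_self]
      exact zero_mem _

end

/-! ### Representatives -/

section

variable {k : Type u} [CommRing k] {A : Type v} [Ring A] [Algebra k A]

/-- Exactness of `d` on `Ω̄` turns the condition that `if` be exact into the equation `d i f = 0`.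
-/
theorem nat_mem_HC_iff {s : OmegaBar k A →ₗ[k] OmegaBar k A} (hs : IsContraction s) {n : ℤ}
    {f : OmegaBar k A} (hf : f ∈ degBar k A n) :
    nat k A f ∈ degDR k A n ⊓ ((degBar k A (n - 2)).map (dBar k A)).comap (contrDR k A) ↔
      dBar k A (contrBar k A f) = 0 := by
  rw [mem_inf_comap, contrDR_nat]
  constructor
  · rintro ⟨-, w, -, hw⟩
    rw [← hw, dBar_dBar]
  · intro h
    exact ⟨⟨f, hf, rfl⟩, _, hs.mem (contrBar_mem hf rfl), hs.d_eq h⟩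

theorem exists_rep_HC {s : OmegaBar k A →ₗ[k] OmegaBar k A} (hs : IsContraction s) {n : ℤ}
    (q : HC k A n) :
    ∃ f ∈ degBar k A n, dBar k A (contrBar k A f) = 0 ∧ Represents (nat k A f) q := by
  obtain ⟨x, hx⟩ := exists_represents q
  obtain ⟨f, hf, rfl⟩ := hx.mem.1
  exact ⟨f, hf, (nat_mem_HC_iff hs hf).1 hx.mem, hx⟩

theorem nat_mem_HH_iff {n : ℤ} {f : OmegaBar k A} (hf : f ∈ degBar k A n) :
    nat k A f ∈ HH k A n ↔ contrBar k A f = 0 :=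
  ⟨fun h => h.2, fun h => ⟨⟨f, hf, rfl⟩, h⟩⟩

theorem exists_rep_HH {n : ℤ} (x : HH k A n) :
    ∃ f ∈ degBar k A n, contrBar k A f = 0 ∧ nat k A f = x := by
  obtain ⟨_, ⟨f, hf, rfl⟩, h⟩ := x
  exact ⟨f, hf, h, rfl⟩

theorem mem_HD'_iff {n : ℤ} {q : HD k A n} :
    q ∈ HD' k A n ↔ ∃ f ∈ Zser k A n, Represents (constTerm k A f) q := by
  constructor
  · rintro ⟨⟨_, hx⟩, ⟨f, hf, rfl⟩, rfl⟩
    exact ⟨f, hf, hx, rfl⟩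
  · rintro ⟨f, hf, hx, rfl⟩
    exact ⟨⟨_, hx⟩, ⟨f, hf, rfl⟩, rfl⟩

theorem mem_HH'_iff {n : ℤ} {x : HH k A n} :
    x ∈ HH' k A n ↔ ∃ f ∈ power k A n, diffID k A f = 0 ∧ constTerm k A f = x := by
  constructor
  · rintro ⟨f, ⟨hf, h⟩, e⟩
    exact ⟨f, hf, h, e⟩
  · rintro ⟨f, hf, h, e⟩
    exact ⟨f, ⟨hf, h⟩, e⟩

theorem contrBar_zero_of_power {n : ℤ} {f : ℤ → OmegaBar k A} (hf : f ∈ power k A n) :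
    diffID k A f 0 = contrBar k A (f 0) := by
  rw [diffID_apply, hf.2 (0 - 1) (by norm_num), map_zero, sub_zero]

theorem contrBar_eq_dBar {f : ℤ → OmegaBar k A} {j : ℤ} (h : diffID k A f j = 0) {i : ℤ}
    (hi : i = j - 1 := by omega) : contrBar k A (f j) = dBar k A (f i) := by
  subst hi
  exact sub_eq_zero.1 h

theorem mulU_mem_laurent {n m : ℤ} (hm : m = n - 2) {f : ℤ → OmegaBar k A}
    (hf : f ∈ laurent k A n) : mulU k A f ∈ laurent k A m := fun j => by
  rw [mulU_apply]
  exact laurent_mem hf _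

theorem mulU_mem_power {n m : ℤ} (hm : m = n - 2) {f : ℤ → OmegaBar k A}
    (hf : f ∈ power k A n) : mulU k A f ∈ power k A m :=
  ⟨mulU_mem_laurent hm hf.1, fun j hj => by rw [mulU_apply, hf.2 _ (by omega)]⟩

variable (k A) in
/-- Division by `u`. -/
def divU : (ℤ → OmegaBar k A) →ₗ[k] (ℤ → OmegaBar k A) :=
  LinearMap.funLeft k (OmegaBar k A) fun j => j + 1

theorem divU_apply (f : ℤ → OmegaBar k A) (j : ℤ) : divU k A f j = f (j + 1) := rfl

theorem mulU_divU (f : ℤ → OmegaBar k A) : mulU k A (divU k A f) = f := by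
  funext j
  rw [mulU_apply, divU_apply, sub_add_cancel]

theorem divU_mulU (f : ℤ → OmegaBar k A) : divU k A (mulU k A f) = f := by
  funext j
  rw [divU_apply, mulU_apply, add_sub_cancel_right]

theorem diffID_divU (f : ℤ → OmegaBar k A) :
    diffID k A (divU k A f) = divU k A (diffID k A f) := by
  funext j
  rw [diffID_apply, divU_apply, divU_apply, divU_apply, diffID_apply, add_sub_cancel_right,
    sub_add_cancel]

theorem divU_mem_laurent {n m : ℤ} (hm : m = n + 2) {f : ℤ → OmegaBar k A}
    (hf : f ∈ laurent k A n) : divU k A f ∈ laurent k A m := fun j => by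
  rw [divU_apply]
  exact laurent_mem hf _

theorem divU_mem_power {n m : ℤ} (hm : m = n + 2) {f : ℤ → OmegaBar k A}
    (hf : f ∈ power k A n) (h0 : f 0 = 0) : divU k A f ∈ power k A m :=
  ⟨divU_mem_laurent hm hf.1, fun j hj => by
    rw [divU_apply]
    rcases (show j + 1 < 0 ∨ j + 1 = 0 by omega) with h | h
    · exact hf.2 _ h
    · rw [h, h0]⟩

/-- Discarding the negative powers of `u`. -/
def posPart (f : ℤ → OmegaBar k A) : ℤ → OmegaBar k A := fun j => if j < 0 then 0 else f j

theorem posPart_of_neg (f : ℤ → OmegaBar k A) {j : ℤ} (hj : j < 0) : posPart f j = 0 := if_pos hj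

theorem posPart_of_nonneg (f : ℤ → OmegaBar k A) {j : ℤ} (hj : 0 ≤ j) : posPart f j = f j :=
  if_neg (not_lt.2 hj)

theorem posPart_mem {n : ℤ} {f : ℤ → OmegaBar k A} (hf : f ∈ laurent k A n) :
    posPart f ∈ power k A n := by
  refine ⟨fun j => ?_, fun j hj => posPart_of_neg f hj⟩
  rcases lt_or_ge j 0 with hj | hj
  · rw [posPart_of_neg f hj]
    exact zero_mem _
  · rw [posPart_of_nonneg f hj]
    exact hf j

/-- Truncation removes the contribution `-d f_{-1}` to the constant term and alters no other
nonnegative coefficient. -/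
theorem diffID_posPart (f : ℤ → OmegaBar k A) :
    diffID k A (posPart f) = posPart (diffID k A f) + const k A (dBar k A (f (-1))) := by
  funext j
  rw [Pi.add_apply, diffID_apply]
  rcases lt_trichotomy j 0 with hj | rfl | hj
  · rw [posPart_of_neg _ hj, posPart_of_neg _ hj, posPart_of_neg _ (by omega), const_ne _ hj.ne]
    simp only [map_zero, sub_zero, add_zero]
  · rw [posPart_of_nonneg _ le_rfl, posPart_of_nonneg _ le_rfl, posPart_of_neg _ (by norm_num),
      const_zero, diffID_apply, map_zero, sub_zero, zero_sub, sub_add_cancel]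
  · rw [posPart_of_nonneg _ hj.le, posPart_of_nonneg _ hj.le, posPart_of_nonneg _ (by omega),
      const_ne _ hj.ne', diffID_apply, add_zero]

theorem posPart_mem_Zser {n : ℤ} {f : ℤ → OmegaBar k A} (hf : f ∈ laurent k A n)
    (h : diffID k A f = 0) : posPart f ∈ Zser k A n := by
  refine ⟨posPart_mem hf, fun j hj => ?_⟩
  rw [diffID_posPart, h, Pi.add_apply, const_ne _ hj, add_zero]
  rcases lt_or_ge j 0 with hj | hj
  · rw [posPart_of_neg _ hj]
  · rw [posPart_of_nonneg _ hj, Pi.zero_apply]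

theorem exists_HH_to_HC (n : ℤ) : ∃ I : HH k A n →ₗ[k] HC k A n,
    ∀ x : HH k A n, Represents (x : DRBar k A) (I x) := by
  obtain ⟨l, hl⟩ := exists_submodule_rel_map (HH k A n) LinearMap.id LinearMap.id
    (Z' := degDR k A n ⊓ ((degBar k A (n - 2)).map (dBar k A)).comap (contrDR k A))
    (W' := (degDR k A (n - 1)).map (dDR k A)) (fun _ h => h) (fun x hx => by
      refine mem_inf_comap.2 ⟨hx.1, ?_⟩
      rw [LinearMap.id_apply, show contrDR k A x = 0 from hx.2]
      exact zero_mem _) (fun z hz => ⟨z, hz, rfl⟩) fun x _ h => by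
      rw [h]
      exact zero_mem _
  exact ⟨l, fun x => hl x x.2 x rfl⟩

theorem diffID_const_of_cycle {x : OmegaBar k A} (h1 : dBar k A x = 0) (h2 : contrBar k A x = 0) :
    diffID k A (const k A x) = 0 := by
  rw [diffID_const, h1, h2, map_zero, map_zero, sub_zero]

end

section

variable {k : Type u} [CommRing k] [Algebra ℚ k] {A : Type v} [Ring A] [Algebra k A]

/-- Apply `nat_eq_zero_iff` to `f - dh`; exactness in the de Rham quotient becomes an equation in
`Ω̄`. -/
theorem nat_mem_dDR_iff {n : ℤ} {f : OmegaBar k A} (hf : f ∈ degBar k A n) :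
    nat k A f ∈ (degDR k A (n - 1)).map (dDR k A) ↔
      ∃ h ∈ degBar k A (n - 1), ∃ y ∈ degBar k A (n + 1),
        harmBar k A f = dBar k A h + contrBar k A y := by
  constructor
  · rintro ⟨_, ⟨h, hh, rfl⟩, e⟩
    rw [dDR_nat, eq_comm, ← sub_eq_zero, ← map_sub] at e
    obtain ⟨y, hy, e⟩ := (nat_eq_zero_iff (sub_mem hf (dBar_mem hh))).1 e
    rw [map_sub, harmBar_dBar, sub_eq_iff_eq_add'] at e
    exact ⟨_, harmBar_mem hh, y, hy, e⟩
  · rintro ⟨h, hh, y, -, e⟩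
    refine ⟨_, ⟨h, hh, rfl⟩, ?_⟩
    rw [dDR_nat, ← nat_harmBar f, e, map_add, nat_contrBar, add_zero]

theorem nat_mem_HD_iff {n : ℤ} {f : OmegaBar k A} (hf : f ∈ degBar k A n) :
    nat k A f ∈ degDR k A n ⊓ LinearMap.ker (dDR k A) ↔
      ∃ y ∈ degBar k A (n + 2), dBar k A (harmBar k A f) = contrBar k A y := by
  rw [mem_inf_ker, dDR_nat, nat_eq_zero_iff (dBar_mem hf rfl), harmBar_dBar,
    show n + 1 + 1 = n + 2 by ring]
  exact ⟨fun h => h.2, fun h => ⟨⟨f, hf, rfl⟩, h⟩⟩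

theorem exists_rep_HD {n : ℤ} (q : HD k A n) :
    ∃ f ∈ degBar k A n, ∃ y ∈ degBar k A (n + 2),
      dBar k A (harmBar k A f) = contrBar k A y ∧ Represents (nat k A f) q := by
  obtain ⟨x, hx⟩ := exists_represents q
  obtain ⟨f, hf, rfl⟩ := hx.mem.1
  obtain ⟨y, hy, e⟩ := (nat_mem_HD_iff hf).1 hx.mem
  exact ⟨f, hf, y, hy, e, hx⟩

/-- The cycle equation at `u¹` reads `d f_0 = i f_1`, and the image of `i` vanishes in the de Rham
quotient. -/
theorem constTerm_mem_HD {n : ℤ} {f : ℤ → OmegaBar k A} (hf : f ∈ laurent k A n)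
    (h : diffID k A f 1 = 0) :
    constTerm k A f ∈ degDR k A n ⊓ LinearMap.ker (dDR k A) := by
  rw [constTerm_apply, nat_mem_HD_iff (laurent_mem hf 0)]
  refine ⟨f 1, laurent_mem hf 1, ?_⟩
  rw [← harmBar_dBar, ← contrBar_eq_dBar h, harmBar_contrBar]

/-! ### The maps between the homology groups -/

theorem exists_HH'_to_HD' (n : ℤ) : ∃ J : HH' k A n →ₗ[k] HD' k A n,
    ∀ x : HH' k A n, Represents ((x : HH k A n) : DRBar k A) (J x : HD k A n) := by
  obtain ⟨l, hl⟩ := exists_submodule_rel_map ((power k A n ⊓ LinearMap.ker (diffID k A)).map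
      (constTerm k A)) LinearMap.id LinearMap.id
    (Z' := degDR k A n ⊓ LinearMap.ker (dDR k A))
    (W' := (degDR k A (n - 1)).map (dDR k A)) (fun _ h => h) (by
      rintro _ ⟨f, ⟨hf, h⟩, rfl⟩
      exact constTerm_mem_HD hf.1 (congrFun h 1)) (fun z hz => ⟨z, hz, rfl⟩) fun x _ h => by
      rw [h]
      exact zero_mem _
  refine ⟨(l ∘ₗ ((HH k A n).subtype ∘ₗ (HH' k A n).subtype).codRestrict _ fun x => x.2).codRestrict
    (HD' k A n) fun x => ?_, fun x => hl _ x.2 _ rfl⟩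
  obtain ⟨f, hf, h, e⟩ := mem_HH'_iff.1 x.2
  refine mem_HD'_iff.2 ⟨f, ⟨hf, fun j _ => congrFun h j⟩, ?_⟩
  rw [e]
  exact hl _ x.2 _ rfl

theorem exists_HC_to_HD {s : OmegaBar k A →ₗ[k] OmegaBar k A} (hs : IsContraction s) (n : ℤ) :
    ∃ S : HC k A (n + 1) →ₗ[k] HD k A (n - 1),
      ∀ f ∈ degBar k A (n + 1), ∀ g ∈ degBar k A (n - 1), ∀ q : HC k A (n + 1),
        Represents (nat k A f) q → dBar k A g = contrBar k A f → Represents (nat k A g) (S q) := by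
  -- The map is defined through the linear correspondence of pairs `(f, g)` with `dg = if`, so that
  -- independence of the choice of `g` is part of well-definedness.
  refine Exists.elim (exists_subQuot_rel_map
    ((degBar k A (n + 1)).prod (degBar k A (n - 1)) ⊓ LinearMap.ker
      (dBar k A ∘ₗ LinearMap.snd k (OmegaBar k A) (OmegaBar k A) - contrBar k A ∘ₗ
        LinearMap.fst k (OmegaBar k A) (OmegaBar k A)))
    (nat k A ∘ₗ LinearMap.fst k (OmegaBar k A) (OmegaBar k A))
    (nat k A ∘ₗ LinearMap.snd k (OmegaBar k A) (OmegaBar k A))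
    (Z := degDR k A (n + 1) ⊓ ((degBar k A (n + 1 - 2)).map (dBar k A)).comap (contrDR k A))
    (W := (degDR k A (n + 1 - 1)).map (dDR k A))
    (Z' := degDR k A (n - 1) ⊓ LinearMap.ker (dDR k A))
    (W' := (degDR k A (n - 1 - 1)).map (dDR k A)) ?_ ?_ ?_ ?_) fun l hl =>
      ⟨l, fun f hf g hg q hq e => hl (f, g) (mem_inf_ker.2 ⟨⟨hf, hg⟩, sub_eq_zero.2 e⟩) q hq⟩
  · rintro ⟨f, g⟩ hp
    obtain ⟨⟨hf, hg⟩, e⟩ := mem_inf_ker.1 hp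
    refine (nat_mem_HC_iff hs hf).2 ?_
    have e' : dBar k A g = contrBar k A f := sub_eq_zero.1 e
    change dBar k A (contrBar k A f) = 0
    rw [← e', dBar_dBar]
  · rintro ⟨f, g⟩ hp
    obtain ⟨⟨hf, hg⟩, e⟩ := mem_inf_ker.1 hp
    refine (nat_mem_HD_iff hg).2 ⟨f, degBar_cast hf, ?_⟩
    have e' : dBar k A g = contrBar k A f := sub_eq_zero.1 e
    change dBar k A (harmBar k A g) = _
    rw [← harmBar_dBar, e', harmBar_contrBar]
  · intro z hz
    obtain ⟨f, hf, rfl⟩ := hz.1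
    refine ⟨(f, s (contrBar k A f)), mem_inf_ker.2 ⟨⟨hf, ?_⟩, sub_eq_zero.2 ?_⟩, rfl⟩
    · exact hs.mem (contrBar_mem hf rfl)
    · exact hs.d_eq ((nat_mem_HC_iff hs hf).1 hz)
  · rintro ⟨f, g⟩ hp hW
    obtain ⟨⟨hf, hg⟩, e⟩ := mem_inf_ker.1 hp
    have e' : dBar k A g = contrBar k A f := sub_eq_zero.1 e
    obtain ⟨h, hh, y, hy, e1⟩ := (nat_mem_dDR_iff hf).1 hW
    refine (nat_mem_dDR_iff hg).2 ?_
    change ∃ h ∈ _, ∃ y ∈ _, harmBar k A g = _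
    have hh' : contrBar k A h ∈ degBar k A (n - 1) := contrBar_mem hh
    -- Applying `i` to `Pf = dh + iy` gives `if = -d i h`. Thus `g + ih` is closed, hence exact, and
    -- `Pg` is exact up to `-ih`.
    have e2 : dBar k A (g + contrBar k A h) = 0 := by
      have e3 := congrArg (contrBar k A) e1
      rw [contrBar_harmBar, map_add, contrBar_contrBar, add_zero, contrBar_dBar, ← e'] at e3
      rw [map_add, e3, neg_add_cancel]
    have e4 := hs.d_eq e2
    refine ⟨harmBar k A (s (g + contrBar k A h)), harmBar_mem (hs.mem (add_mem hg hh')),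
      -h, neg_mem (degBar_cast hh), ?_⟩
    rw [← harmBar_dBar, e4, map_add, harmBar_contrBar, map_neg, add_neg_cancel_right]

theorem exists_HD_to_HC {s : OmegaBar k A →ₗ[k] OmegaBar k A} (hs : IsContraction s) (n : ℤ) :
    ∃ S : HD k A n →ₗ[k] HC k A n, ∀ x (q : HD k A n), Represents x q → Represents x (S q) := by
  refine exists_subQuot_map LinearMap.id ?_ fun _ _ h => h
  intro x hx
  obtain ⟨f, hf, rfl⟩ := hx.1
  obtain ⟨y, hy, e⟩ := (nat_mem_HD_iff hf).1 hx
  refine (nat_mem_HC_iff hs hf).2 ?_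
  -- `d i f = d i P f = -i d P f = -i i y = 0`.
  rw [← contrBar_harmBar, ← neg_eq_zero, ← contrBar_dBar, e, contrBar_contrBar]

theorem exists_HC_to_HH {s : OmegaBar k A →ₗ[k] OmegaBar k A} (hs : IsContraction s) (n : ℤ) :
    ∃ B : HC k A n →ₗ[k] HH k A (n + 1), ∀ f ∈ degBar k A n, ∀ q : HC k A n,
      Represents (nat k A f) q → (B q : DRBar k A) = nat k A (dBar k A f) := by
  refine Exists.elim (exists_subQuot_rel_map'
    (degDR k A n ⊓ ((degBar k A (n - 2)).map (dBar k A)).comap (contrDR k A)) LinearMap.id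
    (dDR k A) (W := (degDR k A (n - 1)).map (dDR k A)) (Z' := HH k A (n + 1))
    (fun _ h => h) ?_ (fun z hz => ⟨z, hz, rfl⟩) ?_) fun l hl =>
      ⟨l, fun f hf q hq => hl _ hq.mem q hq⟩
  · intro x hx
    obtain ⟨f, hf, rfl⟩ := hx.1
    rw [dDR_nat, nat_mem_HH_iff (dBar_mem hf), contrBar_dBar, (nat_mem_HC_iff hs hf).1 hx, neg_zero]
  · rintro _ - ⟨_, ⟨f, hf, rfl⟩, e⟩
    rw [LinearMap.id_apply] at e
    rw [← e, dDR_nat, dDR_nat, dBar_dBar, map_zero]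

theorem exists_HC_to_HCNeg {s : OmegaBar k A →ₗ[k] OmegaBar k A} (hs : IsContraction s) (n : ℤ) :
    ∃ B' : HC k A n →ₗ[k] HCNeg k A (n + 1), ∀ f ∈ degBar k A n, ∀ q : HC k A n,
      Represents (nat k A f) q → Represents (const k A (dBar k A f)) (B' q) := by
  refine Exists.elim (exists_subQuot_rel_map
    (degBar k A n ⊓ LinearMap.ker (dBar k A ∘ₗ contrBar k A)) (nat k A) (const k A ∘ₗ dBar k A)
    (Z := degDR k A n ⊓ ((degBar k A (n - 2)).map (dBar k A)).comap (contrDR k A))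
    (W := (degDR k A (n - 1)).map (dDR k A))
    (Z' := power k A (n + 1) ⊓ LinearMap.ker (diffID k A))
    (W' := (power k A (n + 1 + 1)).map (diffID k A) ⊔
      (dcommBar k A ⊓ degBar k A (n + 1)).map (const k A)) ?_ ?_ ?_ ?_) fun l hl =>
      ⟨l, fun f hf q hq => hl f (mem_inf_ker.2 ⟨hf, (nat_mem_HC_iff hs hf).1 hq.mem⟩) q hq⟩
  · intro f hf
    exact (nat_mem_HC_iff hs hf.1).2 hf.2
  · intro f hf
    obtain ⟨hf, h⟩ := mem_inf_ker.1 hf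
    refine mem_inf_ker.2 ⟨const_mem_power (dBar_mem hf), diffID_const_of_cycle (dBar_dBar f) ?_⟩
    rw [contrBar_dBar, neg_eq_zero]
    exact h
  · intro z hz
    obtain ⟨f, hf, rfl⟩ := hz.1
    exact ⟨f, mem_inf_ker.2 ⟨hf, (nat_mem_HC_iff hs hf).1 hz⟩, rfl⟩
  · intro f hf hW
    obtain ⟨hf, h⟩ := mem_inf_ker.1 hf
    obtain ⟨v, hv, y, hy, e⟩ := (nat_mem_dDR_iff hf).1 hW
    -- With `Pf = dv + iy`, write `df = dPf + d(f - Pf)`. Here `dPf = d i y = -i d y` is the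
    -- boundary of the constant `-dy`, and `d(f - Pf)` is closed and killed by `P`.
    refine (mem_negBoundary_iff hs).2 ⟨-const k A (dBar k A y), neg_mem (const_mem_power
      (dBar_mem hy)), dBar k A (f - harmBar k A f), dBar_mem (sub_mem hf (harmBar_mem hf)),
      dBar_dBar _, ?_, ?_⟩
    · rw [harmBar_dBar, map_sub, harmBar_harmBar, sub_self, map_zero]
    · rw [map_neg, diffID_const, dBar_dBar, map_zero, map_zero, sub_zero, ← map_neg, ← map_add,
        contrBar_dBar, neg_neg, ← map_add, LinearMap.comp_apply, map_add (dBar k A),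
        map_sub (dBar k A), e, map_add (dBar k A), dBar_dBar, zero_add, add_sub_cancel]

theorem exists_shift_HCNeg {s : OmegaBar k A →ₗ[k] OmegaBar k A} (hs : IsContraction s) (n : ℤ) :
    ∃ S : HCNeg k A (n + 1) →ₗ[k] HCNeg k A (n - 1), ∀ f (q : HCNeg k A (n + 1)),
      Represents f q → Represents (mulU k A f) (S q) := by
  refine exists_subQuot_map (mulU k A) ?_ ?_
  · intro f hf
    obtain ⟨hf, h⟩ := mem_inf_ker.1 hf
    refine mem_inf_ker.2 ⟨mulU_mem_power (by omega) hf, ?_⟩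
    rw [diffID_mulU, h, map_zero]
  · intro f _ hW
    obtain ⟨g, hg, w, hw, h1, h2, rfl⟩ := (mem_negBoundary_iff hs).1 hW
    -- `u` annihilates `[dΩ, dΩ]`: the form `v = (1 - P) s w` has `iv = 0` and `dv = w`, so `uw =
    -- -(i - ud)v`.
    have h3 : s w - harmBar k A (s w) ∈ degBar k A n :=
      sub_mem (hs.mem hw) (harmBar_mem (hs.mem hw))
    refine Submodule.mem_sup_left ⟨mulU k A g - const k A (s w - harmBar k A (s w)),
      sub_mem (mulU_mem_power (by omega) hg) (const_mem_power (degBar_cast h3)), ?_⟩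
    rw [map_sub, diffID_mulU, diffID_const, map_sub (contrBar k A), contrBar_harmBar, sub_self,
      map_zero, zero_sub, sub_neg_eq_add, map_sub (dBar k A), ← harmBar_dBar, hs.d_eq h1, h2,
      sub_zero, map_add]

theorem exists_HCNeg_to_HH' {s : OmegaBar k A →ₗ[k] OmegaBar k A} (hs : IsContraction s) (n : ℤ) :
    ∃ Im : HCNeg k A n →ₗ[k] HH' k A n, ∀ f (q : HCNeg k A n), Represents f q →
      ((Im q : HH k A n) : DRBar k A) = constTerm k A f := by
  refine Exists.elim (exists_subQuot_rel_map'
    (power k A n ⊓ LinearMap.ker (diffID k A)) LinearMap.id (constTerm k A)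
    (W := (power k A (n + 1)).map (diffID k A) ⊔
      (dcommBar k A ⊓ degBar k A n).map (const k A)) (Z' := HH k A n)
    (fun _ h => h) ?_ (fun z hz => ⟨z, hz, rfl⟩) ?_) fun l hl =>
      ⟨l.codRestrict _ fun q => ?_, fun f q hq => hl _ hq.mem q hq⟩
  · intro f hf
    obtain ⟨hf, h⟩ := mem_inf_ker.1 hf
    rw [constTerm_apply, nat_mem_HH_iff (laurent_mem hf.1 0), ← contrBar_zero_of_power hf, h,
      Pi.zero_apply]
  · intro f _ hW
    obtain ⟨g, hg, w, hw, h1, h2, e⟩ := (mem_negBoundary_iff hs).1 hW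
    rw [LinearMap.id_apply] at e
    rw [e, constTerm_apply, Pi.add_apply, contrBar_zero_of_power hg, const_zero, map_add,
      nat_contrBar, ← nat_harmBar w, h2, map_zero, add_zero]
  · obtain ⟨f, hf⟩ := exists_represents q
    exact mem_HH'_iff.2 ⟨f, hf.mem.1, hf.mem.2, (hl f hf.mem q hf).symm⟩

theorem exists_HCNeg_to_HCPer {s : OmegaBar k A →ₗ[k] OmegaBar k A} (hs : IsContraction s) (n : ℤ) :
    ∃ p : HCNeg k A n →ₗ[k] HCPer k A n, ∀ f (q : HCNeg k A n), Represents f q →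
      Represents f (p q) := by
  refine exists_subQuot_map LinearMap.id (fun f hf => ⟨hf.1.1, hf.2⟩) ?_
  intro f _ hW
  obtain ⟨g, hg, w, hw, h1, h2, rfl⟩ := (mem_negBoundary_iff hs).1 hW
  have h3 : s w - harmBar k A (s w) ∈ degBar k A (n - 1) :=
    sub_mem (hs.mem hw) (harmBar_mem (hs.mem hw))
  -- In Laurent series `w` itself bounds: `w = -(i - ud)(u⁻¹ v)` for `v = (1 - P) s w`.
  refine ⟨g - divU k A (const k A (s w - harmBar k A (s w))),
    sub_mem hg.1 (divU_mem_laurent (by omega) (const_mem_power h3).1), ?_⟩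
  rw [map_sub, diffID_divU, diffID_const, map_sub (contrBar k A), contrBar_harmBar, sub_self,
    map_zero, zero_sub, map_neg, sub_neg_eq_add, divU_mulU, map_sub (dBar k A), ← harmBar_dBar,
    hs.d_eq h1, h2, sub_zero, LinearMap.id_apply]

theorem exists_HCPer_to_HD' (n : ℤ) :
    ∃ p : HCPer k A n →ₗ[k] HD' k A n, ∀ f (q : HCPer k A n), Represents f q →
      Represents (constTerm k A f) (p q : HD k A n) := by
  refine Exists.elim (exists_subQuot_map (constTerm k A)
    (Z := laurent k A n ⊓ LinearMap.ker (diffID k A))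
    (W := (laurent k A (n + 1)).map (diffID k A))
    (Z' := degDR k A n ⊓ LinearMap.ker (dDR k A))
    (W' := (degDR k A (n - 1)).map (dDR k A)) ?_ ?_) fun l hl =>
      ⟨l.codRestrict _ fun q => ?_, fun f q hq => hl f q hq⟩
  · intro f hf
    exact constTerm_mem_HD hf.1 (congrFun hf.2 1)
  · rintro _ - ⟨g, hg, rfl⟩
    rw [constTerm_apply, diffID_apply, map_sub, nat_contrBar, zero_sub, ← map_neg, ← map_neg]
    exact ⟨_, ⟨_, neg_mem (laurent_mem hg (0 - 1)), rfl⟩, rfl⟩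
  · obtain ⟨f, hf⟩ := exists_represents q
    -- Membership must be witnessed by a power series. Truncation keeps `f_0`, and its defect is
    -- constant in `u`.
    refine mem_HD'_iff.2 ⟨posPart f, posPart_mem_Zser hf.mem.1 hf.mem.2, ?_⟩
    rw [constTerm_apply, posPart_of_nonneg f le_rfl]
    exact hl f q hf

end

section

variable {k : Type u} [CommRing k] {A : Type v} [Ring A] [Algebra k A]

theorem exists_shift_HCPer (n : ℤ) :
    ∃ U : HCPer k A (n + 1) ≃ₗ[k] HCPer k A (n - 1), ∀ f (q : HCPer k A (n + 1)),
      Represents f q → Represents (mulU k A f) (U q) := by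
  refine exists_subQuot_equiv (mulU k A) ?_ ?_ ?_
  · intro f hf
    obtain ⟨hf, h⟩ := mem_inf_ker.1 hf
    refine mem_inf_ker.2 ⟨mulU_mem_laurent (by omega) hf, ?_⟩
    rw [diffID_mulU, h, map_zero]
  · intro f hf
    constructor
    · rintro ⟨g, hg, e⟩
      refine ⟨divU k A g, divU_mem_laurent (by omega) hg, ?_⟩
      rw [diffID_divU, e, divU_mulU]
    · rintro ⟨g, hg, rfl⟩
      exact ⟨mulU k A g, mulU_mem_laurent (by omega) hg, rfl⟩
  · intro f hf
    obtain ⟨hf, h⟩ := mem_inf_ker.1 hf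
    refine ⟨divU k A f, mem_inf_ker.2 ⟨divU_mem_laurent (by omega) hf, ?_⟩, ?_⟩
    · rw [diffID_divU, h, map_zero]
    · rw [mulU_divU, sub_self]
      exact zero_mem _

end

/-! ### Exactness of the row of Hochschild, cyclic and de Rham homology -/

section

variable {k : Type u} [CommRing k] {A : Type v} [Ring A] [Algebra k A]
  {s : OmegaBar k A →ₗ[k] OmegaBar k A} {n : ℤ}

theorem injective_of_represents {M : Type*} [AddCommGroup M] [Module k M]
    {Z Z' W : Submodule k M} {S : SubQuot Z W →ₗ[k] SubQuot Z' W}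
    (hS : ∀ x q, Represents x q → Represents x (S q)) : Function.Injective S := by
  refine (injective_iff_map_eq_zero S).2 fun q hq => ?_
  obtain ⟨x, hx⟩ := exists_represents q
  rwa [(hS x q hx).eq_zero_iff, ← hx.eq_zero_iff] at hq

theorem surjective_HCNeg_HH' {Im : HCNeg k A n →ₗ[k] HH' k A n}
    (hIm : ∀ f q, Represents f q → ((Im q : HH k A n) : DRBar k A) = constTerm k A f) :
    Function.Surjective Im := by
  rintro ⟨x, hx⟩
  obtain ⟨f, hf, h, e⟩ := mem_HH'_iff.1 hx
  have hq := represents_mk (W := (power k A (n + 1)).map (diffID k A) ⊔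
    (dcommBar k A ⊓ degBar k A n).map (const k A)) (mem_inf_ker.2 ⟨hf, h⟩)
  exact ⟨_, Subtype.ext (Subtype.ext ((hIm _ _ hq).trans e))⟩

theorem exact_HD_HC_HH (hs : IsContraction s) {S₂ : HD k A n →ₗ[k] HC k A n}
    {B : HC k A n →ₗ[k] HH k A (n + 1)}
    (hS₂ : ∀ x q, Represents x q → Represents x (S₂ q))
    (hB : ∀ f ∈ degBar k A n, ∀ q, Represents (nat k A f) q →
      (B q : DRBar k A) = nat k A (dBar k A f)) : Function.Exact S₂ B := by
  intro q
  constructor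
  · intro hq
    obtain ⟨f, hf, -, hfq⟩ := exists_rep_HC hs q
    have h := hB f hf q hfq
    rw [hq] at h
    have h' : nat k A f ∈ degDR k A n ⊓ LinearMap.ker (dDR k A) := ⟨⟨f, hf, rfl⟩, h.symm⟩
    exact ⟨_, (hS₂ _ _ (represents_mk h')).eq hfq⟩
  · rintro ⟨q, rfl⟩
    obtain ⟨x, hx⟩ := exists_represents q
    obtain ⟨f, hf, rfl⟩ := hx.mem.1
    refine Subtype.ext ?_
    rw [hB f hf _ (hS₂ _ _ hx)]
    exact hx.mem.2

/-- The tail `(g - g_0)/u` is the primitive, as `(i - ud)(g - g_0) = u d g_0`. This is the vanishing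
half of exactness at cyclic and Hochschild homology. -/
theorem exists_power_of_Zser {g : ℤ → OmegaBar k A} (hg : g ∈ Zser k A n) :
    ∃ h ∈ power k A (n + 1 + 1), diffID k A h = const k A (dBar k A (g 0)) := by
  have e : diffID k A g = const k A (contrBar k A (g 0)) := by
    funext j
    by_cases hj : j = 0
    · subst hj
      rw [const_zero, contrBar_zero_of_power hg.1]
    · rw [const_ne _ hj, hg.2 j hj]
  refine ⟨divU k A (g - const k A (g 0)), divU_mem_power (by omega) (sub_mem hg.1
    (const_mem_power (laurent_mem hg.1.1 0))) ?_, ?_⟩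
  · rw [Pi.sub_apply, const_zero, sub_self]
  · rw [diffID_divU, map_sub, e, diffID_const, sub_sub_cancel, divU_mulU]

end

section

variable {k : Type u} [CommRing k] [Algebra ℚ k] {A : Type v} [Ring A] [Algebra k A]
  {s : OmegaBar k A →ₗ[k] OmegaBar k A} {n : ℤ}

theorem exact_HC_HH_HC (hs : IsContraction s) {B : HC k A n →ₗ[k] HH k A (n + 1)}
    {I : HH k A (n + 1) →ₗ[k] HC k A (n + 1)}
    (hB : ∀ f ∈ degBar k A n, ∀ q, Represents (nat k A f) q →
      (B q : DRBar k A) = nat k A (dBar k A f))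
    (hI : ∀ x : HH k A (n + 1), Represents (x : DRBar k A) (I x)) : Function.Exact B I := by
  intro x
  constructor
  · intro hx
    obtain ⟨f, hf, hif, hfx⟩ := exists_rep_HH x
    have h := (hI x).eq_zero_iff.1 hx
    rw [← hfx] at h
    obtain ⟨h, hh, y, hy, e⟩ := (nat_mem_dDR_iff hf).1 h
    have hh' : h ∈ degBar k A n := degBar_cast hh
    -- Applying `i` to `Pf = dh + iy` yields `d i h = 0`, so `h` defines a cyclic class, and `dh`
    -- and `f` agree in the de Rham quotient.
    have e1 := congrArg (contrBar k A) e
    rw [contrBar_harmBar, hif, map_add, contrBar_contrBar, add_zero, contrBar_dBar, eq_comm,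
      neg_eq_zero] at e1
    have hq := represents_mk (W := (degDR k A (n - 1)).map (dDR k A))
      ((nat_mem_HC_iff hs hh').2 e1)
    refine ⟨_, Subtype.ext ((hB h hh' _ hq).trans ?_)⟩
    rw [← hfx, ← nat_harmBar f, e, map_add, nat_contrBar, add_zero]
  · rintro ⟨q, rfl⟩
    obtain ⟨f, hf, -, hfq⟩ := exists_rep_HC hs q
    rw [(hI _).eq_zero_iff, hB f hf q hfq]
    exact ⟨_, ⟨f, degBar_cast hf, rfl⟩, rfl⟩

theorem exact_HH_HC_HD (hs : IsContraction s) {I : HH k A (n + 1) →ₗ[k] HC k A (n + 1)}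
    {S₁ : HC k A (n + 1) →ₗ[k] HD k A (n - 1)}
    (hI : ∀ x : HH k A (n + 1), Represents (x : DRBar k A) (I x))
    (hS₁ : ∀ f ∈ degBar k A (n + 1), ∀ g ∈ degBar k A (n - 1), ∀ q : HC k A (n + 1),
      Represents (nat k A f) q → dBar k A g = contrBar k A f → Represents (nat k A g) (S₁ q)) :
    Function.Exact I S₁ := by
  intro q
  constructor
  · intro hq
    obtain ⟨f, hf, hdif, hfq⟩ := exists_rep_HC hs q
    have hg : s (contrBar k A f) ∈ degBar k A (n - 1) := hs.mem (contrBar_mem hf rfl)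
    have h := (hS₁ f hf _ hg q hfq (hs.d_eq hdif)).eq_zero_iff.1 hq
    obtain ⟨h, hh, y, hy, e⟩ := (nat_mem_dDR_iff hg).1 h
    have hy' : y ∈ degBar k A n := degBar_cast hy
    -- Applying `d` to `Pg = dh + iy`, where `dg = if`, gives `if = d i y = -i d y`. So `f + dy` is
    -- killed by `i` and has the same cyclic class.
    have e1 := congrArg (dBar k A) e
    rw [← harmBar_dBar, hs.d_eq hdif, harmBar_contrBar, map_add, dBar_dBar, zero_add,
      ← neg_eq_iff_eq_neg.2 (contrBar_dBar y)] at e1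
    have hf' : f + dBar k A y ∈ degBar k A (n + 1) := add_mem hf (dBar_mem hy')
    have h0 : contrBar k A (f + dBar k A y) = 0 := by rw [map_add, e1, neg_add_cancel]
    refine ⟨⟨_, (nat_mem_HH_iff hf').2 h0⟩, (hI _).eq (hfq.congr (hI _).mem ?_)⟩
    change nat k A f - nat k A (f + dBar k A y) ∈ _
    rw [map_add, sub_add_cancel_left, ← dDR_nat, ← map_neg]
    exact ⟨_, neg_mem ⟨y, degBar_cast hy', rfl⟩, rfl⟩
  · rintro ⟨x, rfl⟩
    obtain ⟨f, hf, hif, hfx⟩ := exists_rep_HH x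
    have h := hI x
    rw [← hfx] at h
    rw [(hS₁ f hf 0 (zero_mem _) _ h (by rw [hif, map_zero])).eq_zero_iff, map_zero]
    exact zero_mem _

theorem surjective_HC_HD (hs : IsContraction s) {S₁ : HC k A (n + 1) →ₗ[k] HD k A (n - 1)}
    (hS₁ : ∀ f ∈ degBar k A (n + 1), ∀ g ∈ degBar k A (n - 1), ∀ q : HC k A (n + 1),
      Represents (nat k A f) q → dBar k A g = contrBar k A f → Represents (nat k A g) (S₁ q)) :
    Function.Surjective S₁ := by
  intro q
  obtain ⟨g, hg, y, hy, e, hgq⟩ := exists_rep_HD q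
  have hy' : y ∈ degBar k A (n + 1) := degBar_cast hy
  -- The form `y` witnessing that `g_♮` is closed, `dPg = iy`, is itself the preimage.
  have hq := represents_mk (W := (degDR k A (n + 1 - 1)).map (dDR k A))
    ((nat_mem_HC_iff hs hy').2 (by rw [← e, dBar_dBar]))
  have h := hS₁ y hy' _ (harmBar_mem hg) _ hq e
  rw [nat_harmBar] at h
  exact ⟨_, h.eq hgq⟩

/-! ### Constructions of series -/

/-- Converse to `exists_power_of_Zser`. If `df = (i - ud)g + w`, then `P` of the constant term gives
`dPf = i g_0 = df - w`. The `u`-terms of `(i - ud)(Pf + ug)` therefore cancel. -/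
theorem exists_power_of_boundary (hs : IsContraction s) {f : OmegaBar k A}
    (hf : f ∈ degBar k A n)
    (h : const k A (dBar k A f) ∈ (power k A (n + 1 + 1)).map (diffID k A) ⊔
      (dcommBar k A ⊓ degBar k A (n + 1)).map (const k A)) :
    ∃ g ∈ power k A n, g 0 = harmBar k A f ∧ diffID k A g = const k A (contrBar k A f) := by
  obtain ⟨g, hg, w, hw, -, h2, e⟩ := (mem_negBoundary_iff hs).1 h
  have e0 := congrFun e 0
  rw [const_zero, Pi.add_apply, contrBar_zero_of_power hg, const_zero] at e0
  have e1 := congrArg (harmBar k A) e0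
  rw [map_add, harmBar_contrBar, h2, add_zero, harmBar_dBar] at e1
  refine ⟨const k A (harmBar k A f) + mulU k A g,
    add_mem (const_mem_power (harmBar_mem hf)) (mulU_mem_power (by omega) hg), ?_, ?_⟩
  · rw [Pi.add_apply, const_zero, mulU_apply, hg.2 _ (by norm_num), add_zero]
  · rw [map_add, diffID_mulU, eq_sub_of_add_eq e.symm, diffID_const, contrBar_harmBar, e1, e0,
      ← map_sub (const k A), add_sub_cancel_right, sub_add_cancel]

/-- Extend `f` downwards; as nothing lies above it, the only uncancelled term is `-u df`. -/
theorem exists_laurent_of_const (hs : IsContraction s) {f : OmegaBar k A} (hf : f ∈ degBar k A n)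
    (h : dBar k A (contrBar k A f) = 0) :
    ∃ g ∈ laurent k A n, g 0 = f ∧ diffID k A g = -mulU k A (const k A (dBar k A f)) := by
  obtain ⟨g, hg, hg0, hgpos, hgeq⟩ := exists_descending hs (n := n - 1) (m := n) (by omega)
    (j₀ := 0) (f := 0) (zero_mem _) (fun j hj => by simp only [Pi.zero_apply, map_zero])
    (a := f) (degBar_cast hf) (by rw [h, Pi.zero_apply, map_zero])
  refine ⟨g, hg, hg0, ?_⟩
  funext j
  rw [Pi.neg_apply, mulU_apply]
  rcases le_or_gt j 0 with hj | hj
  · rw [diffID_apply, hgeq j hj, const_ne _ (by omega), neg_zero, Pi.zero_apply]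
  · rw [diffID_apply, hgpos j hj, map_zero, zero_sub]
    by_cases hj' : j - 1 = 0
    · rw [hj', const_zero, hg0]
    · rw [const_ne _ hj', hgpos _ (by omega), map_zero]

/-- `d f_0 = i f_1` is fixed by `P`, while `P d f_0 = d P f_0 = 0`. -/
theorem dBar_constTerm_eq_zero {f : ℤ → OmegaBar k A} (h : diffID k A f = 0)
    (h0 : harmBar k A (f 0) = 0) : dBar k A (f 0) = 0 := by
  rw [← contrBar_eq_dBar (congrFun h 1), ← harmBar_contrBar, contrBar_eq_dBar (congrFun h 1)
    (i := 0), harmBar_dBar, h0, map_zero]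

theorem diffID_diffID (f : ℤ → OmegaBar k A) : diffID k A (diffID k A f) = 0 := by
  funext j
  rw [diffID_apply, diffID_apply, diffID_apply, map_sub, map_sub, contrBar_contrBar, dBar_dBar,
    contrBar_dBar, zero_sub, neg_neg, sub_zero, sub_self, Pi.zero_apply]

/-- Boundaries are subtracted until the constant term is zero. The series then splits into two
cycles: the positive one is `ug`, and the negative one bounds by descent. -/
theorem exists_decomp_of_constTerm (hs : IsContraction s) {f : ℤ → OmegaBar k A}
    (hf : f ∈ laurent k A n) (h : diffID k A f = 0)
    (h0 : nat k A (f 0) ∈ (degDR k A (n - 1)).map (dDR k A)) :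
    ∃ g ∈ power k A (n + 2), diffID k A g = 0 ∧
      f - mulU k A g ∈ (laurent k A (n + 1)).map (diffID k A) := by
  have hf0 : f 0 ∈ degBar k A n := laurent_mem hf 0
  obtain ⟨v, hv, y, hy, e⟩ := (nat_mem_dDR_iff hf0).1 h0
  -- As `P f_0 = iy + dv`, subtracting the boundary of `y - u⁻¹v`, whose constant term is `iy + dv`,
  -- removes the harmonic part of `f_0`.
  obtain ⟨f₁, hf₁, hd₁, he₁, ho₁⟩ : ∃ f₁ ∈ laurent k A n, diffID k A f₁ = 0 ∧
      f - f₁ ∈ (laurent k A (n + 1)).map (diffID k A) ∧ harmBar k A (f₁ 0) = 0 := by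
    have hp : const k A y - divU k A (const k A v) ∈ laurent k A (n + 1) :=
      sub_mem (const_mem_power hy).1 (divU_mem_laurent (by omega) (const_mem_power hv).1)
    have h1 : diffID k A (const k A y - divU k A (const k A v)) 0 =
        contrBar k A y + dBar k A v := by
      rw [diffID_apply, Pi.sub_apply, Pi.sub_apply, divU_apply, divU_apply, const_zero,
        const_ne _ (by norm_num), const_ne _ (by norm_num), zero_sub (const k A v _), sub_add_cancel, const_zero,
        sub_zero, map_neg, sub_neg_eq_add]
    have e1 := congrArg (harmBar k A) e
    rw [harmBar_harmBar, map_add, harmBar_dBar, harmBar_contrBar] at e1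
    refine ⟨f - diffID k A (const k A y - divU k A (const k A v)), fun j => ?_, ?_,
      ⟨_, hp, (sub_sub_cancel _ _).symm⟩, ?_⟩
    · rw [Pi.sub_apply, diffID_apply]
      exact sub_mem (hf j) (sub_mem (contrBar_mem (hp j)) (dBar_mem (hp (j - 1))))
    · rw [map_sub, h, diffID_diffID, sub_zero]
    · rw [Pi.sub_apply, h1, map_sub, map_add, harmBar_contrBar, harmBar_dBar, e1, add_comm, sub_self]
  have hf₁0 : f₁ 0 ∈ degBar k A n := laurent_mem hf₁ 0
  have hdx := dBar_constTerm_eq_zero hd₁ ho₁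
  have hix : contrBar k A (f₁ 0) = 0 := by rw [← contrBar_harmBar, ho₁, map_zero]
  -- The remaining constant term is closed and killed by `P`, so it bounds after division by `u`,
  -- through the primitive `(1 - P) s f_0`.
  obtain ⟨f₂, hf₂, hd₂, he₂, ho₂⟩ : ∃ f₂ ∈ laurent k A n, diffID k A f₂ = 0 ∧
      f₁ - f₂ ∈ (laurent k A (n + 1)).map (diffID k A) ∧ f₂ 0 = 0 := by
    have hw : s (f₁ 0) - harmBar k A (s (f₁ 0)) ∈ degBar k A (n - 1) :=
      sub_mem (hs.mem hf₁0) (harmBar_mem (hs.mem hf₁0))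
    refine ⟨f₁ - const k A (f₁ 0), sub_mem hf₁ (const_mem_power hf₁0).1, ?_,
      ⟨-divU k A (const k A (s (f₁ 0) - harmBar k A (s (f₁ 0)))),
        neg_mem (divU_mem_laurent (by omega) (const_mem_power hw).1), ?_⟩, ?_⟩
    · rw [map_sub, hd₁, diffID_const_of_cycle hdx hix, sub_zero]
    · rw [map_neg, diffID_divU, diffID_const, map_sub (contrBar k A), contrBar_harmBar, sub_self,
        map_zero, zero_sub, map_neg, neg_neg, divU_mulU, map_sub (dBar k A), ← harmBar_dBar,
        hs.d_eq hdx, ho₁, sub_zero, sub_sub_cancel]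
    · rw [Pi.sub_apply, const_zero, sub_self]
  -- The truncation defect `d f_{-1}` equals `i f_0`, which is now zero.
  have hpos : diffID k A (posPart f₂) = 0 := by
    rw [diffID_posPart, hd₂, ← contrBar_eq_dBar (congrFun hd₂ 0), ho₂, map_zero, map_zero, add_zero]
    funext j
    exact ite_self 0
  have hpm := posPart_mem hf₂
  have hp0 : posPart f₂ 0 = 0 := by rw [posPart_of_nonneg _ le_rfl, ho₂]
  refine ⟨divU k A (posPart f₂), divU_mem_power rfl hpm hp0, ?_, ?_⟩
  · rw [diffID_divU, hpos, map_zero]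
  · rw [mulU_divU]
    have e3 : f - posPart f₂ = (f - f₁) + ((f₁ - f₂) + (f₂ - posPart f₂)) := by abel
    rw [e3]
    refine add_mem he₁ (add_mem he₂ ?_)
    have hcyc : diffID k A (f₂ - posPart f₂) = 0 := by rw [map_sub, hd₂, hpos, sub_zero]
    have hneg : ∀ j, 0 ≤ j → (f₂ - posPart f₂) j = 0 := fun j hj => by
      rw [Pi.sub_apply, posPart_of_nonneg _ hj, sub_self]
    -- Starting the descent with coefficient 0 at `u⁻¹` leaves the constant term of the boundary
    -- zero. This start is allowed since `d f_{-1} = i f_0 = 0`.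
    obtain ⟨g, hg, hg0, hgpos, hgeq⟩ := exists_descending hs (n := n) (m := n + 1) rfl (j₀ := -1)
      (f := f₂ - posPart f₂) (sub_mem hf₂ hpm.1)
      (fun j _ => contrBar_eq_dBar (congrFun hcyc j)) (a := 0) (zero_mem _) (by
        rw [map_zero, map_zero, ← contrBar_eq_dBar (congrFun hcyc 0), hneg 0 le_rfl, map_zero])
    refine ⟨g, hg, funext fun j => ?_⟩
    rw [diffID_apply]
    rcases le_or_gt j (-1) with hj | hj
    · exact hgeq j hj
    · have h1 : g (j - 1) = 0 := by
        rcases (show j - 1 = -1 ∨ -1 < j - 1 by omega) with h | h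
        · rw [h, hg0]
        · exact hgpos _ h
      rw [hgpos j hj, h1, hneg j (by omega), map_zero, map_zero, sub_zero]

/-- The power series counterpart. Negative powers of `u` being unavailable, the constant term left
after subtracting the boundary of `y` is not bounded away but absorbed into `[dΩ, dΩ]`. -/
theorem exists_power_decomp_of_constTerm (hs : IsContraction s) {f : ℤ → OmegaBar k A}
    (hf : f ∈ power k A n) (h : diffID k A f = 0) (h0 : nat k A (f 0) = 0) :
    ∃ g ∈ power k A (n + 2), diffID k A g = 0 ∧
      f - mulU k A g ∈ (power k A (n + 1)).map (diffID k A) ⊔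
        (dcommBar k A ⊓ degBar k A n).map (const k A) := by
  have hf0 : f 0 ∈ degBar k A n := laurent_mem hf.1 0
  obtain ⟨y, hy, e⟩ := (nat_eq_zero_iff hf0).1 h0
  have hcy := const_mem_power hy
  set f₁ := f - diffID k A (const k A y) with hf₁
  have hfz : f₁ 0 = f 0 - contrBar k A y := by
    rw [hf₁, Pi.sub_apply, contrBar_zero_of_power hcy, const_zero]
  have hd₁ : diffID k A f₁ = 0 := by rw [hf₁, map_sub, h, diffID_diffID, sub_zero]
  have ho₁ : harmBar k A (f₁ 0) = 0 := by rw [hfz, map_sub, harmBar_contrBar, e, sub_self]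
  have hm0 : f₁ 0 ∈ degBar k A n := by
    rw [hfz]
    exact sub_mem hf0 (contrBar_mem hy)
  have hdx := dBar_constTerm_eq_zero hd₁ ho₁
  have hix : contrBar k A (f₁ 0) = 0 := by rw [← contrBar_harmBar, ho₁, map_zero]
  have hmem : f₁ - const k A (f₁ 0) ∈ power k A n := by
    refine sub_mem (sub_mem hf ⟨fun j => ?_, fun j hj => ?_⟩) (const_mem_power hm0)
    · rw [diffID_apply]
      exact sub_mem (contrBar_mem (hcy.1 j)) (dBar_mem (hcy.1 (j - 1)))
    · rw [diffID_apply, hcy.2 j hj, hcy.2 (j - 1) (by omega), map_zero, map_zero, sub_zero]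
  refine ⟨divU k A (f₁ - const k A (f₁ 0)), divU_mem_power rfl hmem ?_, ?_, ?_⟩
  · rw [Pi.sub_apply, const_zero, sub_self]
  · rw [diffID_divU, map_sub, hd₁, diffID_const_of_cycle hdx hix, sub_zero, map_zero]
  · refine (mem_negBoundary_iff hs).2 ⟨_, hcy, f₁ 0, hm0, hdx, ho₁, ?_⟩
    rw [mulU_divU, hf₁]
    abel

end

/-! ### Exactness of the rows of negative cyclic homology -/

section

variable {k : Type u} [CommRing k] [Algebra ℚ k] {A : Type v} [Ring A] [Algebra k A]
  {s : OmegaBar k A →ₗ[k] OmegaBar k A} {n : ℤ}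

theorem exact_HH'_HH_HCNeg (hs : IsContraction s) {Bm : HH k A n →ₗ[k] HCNeg k A (n + 1)}
    (hBm : ∀ f ∈ degBar k A n, ∀ x : HH k A n, nat k A f = x →
      Represents (const k A (dBar k A f)) (Bm x)) :
    Function.Exact (HH' k A n).subtype Bm := by
  intro x
  constructor
  · intro hx
    obtain ⟨f, hf, hif, hfx⟩ := exists_rep_HH x
    obtain ⟨g, hg, hg0, hdg⟩ :=
      exists_power_of_boundary hs hf ((hBm f hf x hfx).eq_zero_iff.1 hx)
    refine ⟨⟨x, mem_HH'_iff.2 ⟨g, hg, ?_, ?_⟩⟩, rfl⟩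
    · rw [hdg, hif, map_zero]
    · rw [constTerm_apply, hg0, nat_harmBar, hfx]
  · rintro ⟨⟨x, hx⟩, rfl⟩
    obtain ⟨f, hf, h, e⟩ := mem_HH'_iff.1 hx
    obtain ⟨g, hg, e'⟩ := exists_power_of_Zser (g := f) ⟨hf, fun j _ => congrFun h j⟩
    exact (hBm (f 0) (laurent_mem hf.1 0) x e).eq_zero_iff.2 (Submodule.mem_sup_left ⟨g, hg, e'⟩)

theorem exact_HH_HCNeg_HCNeg (hs : IsContraction s) {Bm : HH k A n →ₗ[k] HCNeg k A (n + 1)}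
    {Sm : HCNeg k A (n + 1) →ₗ[k] HCNeg k A (n - 1)}
    (hBm : ∀ f ∈ degBar k A n, ∀ x : HH k A n, nat k A f = x →
      Represents (const k A (dBar k A f)) (Bm x))
    (hSm : ∀ f q, Represents f q → Represents (mulU k A f) (Sm q)) : Function.Exact Bm Sm := by
  intro q
  constructor
  · intro hq
    obtain ⟨f, hfq⟩ := exists_represents q
    obtain ⟨g, hg, w, hw, -, h2, e⟩ := (mem_negBoundary_iff hs).1 ((hSm f q hfq).eq_zero_iff.1 hq)
    have e0 := congrFun e 0
    rw [mulU_apply, hfq.mem.1.2 _ (by norm_num), Pi.add_apply, contrBar_zero_of_power hg,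
      const_zero] at e0
    -- From `uf = (i - ud)g + w` the constant term gives `i g_0 + w = 0`. Since `P` fixes `i g_0`
    -- and kills `w`, both vanish. Then `f` differs from `-d g_0` by the boundary of `(g - g_0)/u`.
    have hig : contrBar k A (g 0) = 0 := by
      have := congrArg (harmBar k A) e0
      rw [map_zero, map_add, harmBar_contrBar, h2, add_zero] at this
      exact this.symm
    rw [hig, zero_add] at e0
    rw [← e0, map_zero, add_zero] at e
    have hg0 : g 0 ∈ degBar k A n := laurent_mem hg.1 0
    have hx : nat k A (-g 0) ∈ HH k A n :=
      (nat_mem_HH_iff (neg_mem hg0)).2 (by rw [map_neg, hig, neg_zero])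
    have hB := hBm (-g 0) (neg_mem hg0) ⟨_, hx⟩ rfl
    refine ⟨⟨_, hx⟩, (hB.eq (hfq.congr hB.mem (Submodule.mem_sup_left
      ⟨divU k A (g - const k A (g 0)), divU_mem_power (by omega)
        (sub_mem hg (const_mem_power (laurent_mem hg.1 0))) ?_, ?_⟩)))⟩
    · rw [Pi.sub_apply, const_zero, sub_self]
    · rw [diffID_divU, map_sub, ← e, diffID_const, hig, map_zero, zero_sub, sub_neg_eq_add,
        map_add, divU_mulU, divU_mulU, map_neg, map_neg, sub_neg_eq_add]
  · rintro ⟨x, rfl⟩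
    obtain ⟨f, hf, hif, hfx⟩ := exists_rep_HH x
    refine (hSm _ _ (hBm f hf x hfx)).eq_zero_iff.2 (Submodule.mem_sup_left ⟨-const k A f,
      neg_mem (const_mem_power (degBar_cast hf)), ?_⟩)
    rw [map_neg, diffID_const, hif, map_zero, zero_sub, neg_neg]

theorem exact_HCNeg_HCNeg_HH' (hs : IsContraction s)
    {Sm : HCNeg k A (n + 1) →ₗ[k] HCNeg k A (n - 1)} {Im : HCNeg k A (n - 1) →ₗ[k] HH' k A (n - 1)}
    (hSm : ∀ f q, Represents f q → Represents (mulU k A f) (Sm q))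
    (hIm : ∀ f q, Represents f q → ((Im q : HH k A (n - 1)) : DRBar k A) = constTerm k A f) :
    Function.Exact Sm Im := by
  intro q
  constructor
  · intro hq
    obtain ⟨f, hfq⟩ := exists_represents q
    have h := hIm f q hfq
    rw [hq] at h
    obtain ⟨g, hg, hdg, e⟩ := exists_power_decomp_of_constTerm hs hfq.mem.1 hfq.mem.2 h.symm
    have hg' : g ∈ power k A (n + 1) := by
      have e : n - 1 + 2 = n + 1 := by ring
      rwa [e] at hg
    have hq' := represents_mk (W := (power k A (n + 1 + 1)).map (diffID k A) ⊔
      (dcommBar k A ⊓ degBar k A (n + 1)).map (const k A)) (mem_inf_ker.2 ⟨hg', hdg⟩)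
    exact ⟨_, (hSm _ _ hq').eq (hfq.congr (hSm _ _ hq').mem e)⟩
  · rintro ⟨q, rfl⟩
    obtain ⟨f, hfq⟩ := exists_represents q
    refine Subtype.ext (Subtype.ext ?_)
    rw [hIm _ _ (hSm f q hfq), constTerm_apply, mulU_apply, hfq.mem.1.2 _ (by norm_num), map_zero]
    rfl

/-! ### Exactness of the row of periodic cyclic homology -/

theorem exact_HD'_HC_HCNeg (hs : IsContraction s) {p₂ : HD' k A n →ₗ[k] HC k A n}
    {B' : HC k A n →ₗ[k] HCNeg k A (n + 1)}
    (hp₂ : ∀ x (q : HD' k A n), Represents x (q : HD k A n) → Represents x (p₂ q))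
    (hB' : ∀ f ∈ degBar k A n, ∀ q, Represents (nat k A f) q →
      Represents (const k A (dBar k A f)) (B' q)) : Function.Exact p₂ B' := by
  intro q
  constructor
  · intro hq
    obtain ⟨f, hf, -, hfq⟩ := exists_rep_HC hs q
    obtain ⟨g, hg, hg0, hdg⟩ := exists_power_of_boundary hs hf ((hB' f hf q hfq).eq_zero_iff.1 hq)
    have hz : g ∈ Zser k A n := ⟨hg, fun j hj => by rw [hdg, const_ne _ hj]⟩
    have hr := represents_mk (W := (degDR k A (n - 1)).map (dDR k A))
      (constTerm_mem_HD hg.1 (hz.2 1 one_ne_zero))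
    refine ⟨⟨_, mem_HD'_iff.2 ⟨g, hz, hr⟩⟩, (hp₂ _ _ hr).eq ?_⟩
    rw [constTerm_apply, hg0, nat_harmBar]
    exact hfq
  · rintro ⟨⟨q, hq⟩, rfl⟩
    obtain ⟨g, hg, hr⟩ := mem_HD'_iff.1 hq
    obtain ⟨h, hh, e⟩ := exists_power_of_Zser hg
    exact (hB' (g 0) (laurent_mem hg.1.1 0) _ (hp₂ _ ⟨q, hq⟩ hr)).eq_zero_iff.2
      (Submodule.mem_sup_left ⟨h, hh, e⟩)

theorem exact_HC_HCNeg_HCPer (hs : IsContraction s) {B' : HC k A n →ₗ[k] HCNeg k A (n + 1)}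
    {pm : HCNeg k A (n + 1) →ₗ[k] HCPer k A (n + 1)}
    (hB' : ∀ f ∈ degBar k A n, ∀ q, Represents (nat k A f) q →
      Represents (const k A (dBar k A f)) (B' q))
    (hpm : ∀ f q, Represents f q → Represents f (pm q)) : Function.Exact B' pm := by
  intro q
  constructor
  · intro hq
    obtain ⟨f, hfq⟩ := exists_represents q
    obtain ⟨g, hg, e⟩ := (hpm f q hfq).eq_zero_iff.1 hq
    -- A Laurent primitive `g` of the power series `f` truncates to a primitive of `f + d g_{-1}`,
    -- so `f` is homologous to `d(-g_{-1})`. As `f_{-1} = 0`, `i g_{-1}` is exact and `-g_{-1}`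
    -- defines a cyclic class.
    have hh : -g (-1) ∈ degBar k A n := neg_mem (laurent_mem hg (-1))
    have hz : dBar k A (contrBar k A (-g (-1))) = 0 := by
      have h1 := congrFun e (-1)
      rw [hfq.mem.1.2 _ (by norm_num), diffID_apply, sub_eq_zero] at h1
      rw [map_neg, map_neg, h1, dBar_dBar, neg_zero]
    have hr := hB' _ hh _ (represents_mk ((nat_mem_HC_iff hs hh).2 hz))
    refine ⟨_, hr.eq (hfq.congr hr.mem (Submodule.mem_sup_left ⟨posPart g, posPart_mem hg, ?_⟩))⟩
    have hpos : posPart f = f := by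
      funext j
      rcases lt_or_ge j 0 with hj | hj
      · rw [posPart_of_neg _ hj, hfq.mem.1.2 j hj]
      · rw [posPart_of_nonneg _ hj]
    rw [diffID_posPart, e, hpos, map_neg, map_neg, sub_neg_eq_add]
  · rintro ⟨q, rfl⟩
    obtain ⟨f, hf, h, hfq⟩ := exists_rep_HC hs q
    obtain ⟨g, hg, -, e⟩ := exists_laurent_of_const hs hf h
    refine (hpm _ _ (hB' f hf q hfq)).eq_zero_iff.2 ⟨-divU k A g,
      neg_mem (divU_mem_laurent (by omega) hg), ?_⟩
    rw [map_neg, diffID_divU, e, map_neg, neg_neg, divU_mulU]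

theorem exact_HCNeg_HCPer_HD' (hs : IsContraction s)
    {pm : HCNeg k A (n + 1) →ₗ[k] HCPer k A (n + 1)}
    {U : HCPer k A (n + 1) →ₗ[k] HCPer k A (n - 1)} {p₁ : HCPer k A (n - 1) →ₗ[k] HD' k A (n - 1)}
    (hpm : ∀ f q, Represents f q → Represents f (pm q))
    (hU : ∀ f q, Represents f q → Represents (mulU k A f) (U q))
    (hp₁ : ∀ f q, Represents f q → Represents (constTerm k A f) (p₁ q : HD k A (n - 1))) :
    Function.Exact (U ∘ₗ pm) p₁ := by
  intro q
  constructor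
  · intro hq
    obtain ⟨f, hfq⟩ := exists_represents q
    have h : (p₁ q : HD k A (n - 1)) = 0 := by rw [hq]; rfl
    rw [(hp₁ f q hfq).eq_zero_iff] at h
    obtain ⟨g, hg, hdg, e⟩ := exists_decomp_of_constTerm hs hfq.mem.1 hfq.mem.2 h
    have hg' : g ∈ power k A (n + 1) := by
      have e : n - 1 + 2 = n + 1 := by ring
      rwa [e] at hg
    have hq' := represents_mk (W := (power k A (n + 1 + 1)).map (diffID k A) ⊔
      (dcommBar k A ⊓ degBar k A (n + 1)).map (const k A)) (mem_inf_ker.2 ⟨hg', hdg⟩)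
    have hr := hU _ _ (hpm _ _ hq')
    exact ⟨_, hr.eq (hfq.congr hr.mem e)⟩
  · rintro ⟨q, rfl⟩
    obtain ⟨f, hfq⟩ := exists_represents q
    refine Subtype.ext ((hp₁ _ _ (hU _ _ (hpm f q hfq))).eq_zero_iff.2 ?_)
    rw [constTerm_apply, mulU_apply, hfq.mem.1.2 _ (by norm_num), map_zero]
    exact zero_mem _

theorem surjective_HCPer_HD' (hs : IsContraction s) {p₁ : HCPer k A n →ₗ[k] HD' k A n}
    (hp₁ : ∀ f q, Represents f q → Represents (constTerm k A f) (p₁ q : HD k A n)) :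
    Function.Surjective p₁ := by
  rintro ⟨q, hq⟩
  obtain ⟨f, hf, hr⟩ := mem_HD'_iff.1 hq
  have hf0 : f 0 ∈ degBar k A n := laurent_mem hf.1.1 0
  have h1 : diffID k A f = const k A (contrBar k A (f 0)) := by
    funext j
    by_cases hj : j = 0
    · subst hj
      rw [const_zero, contrBar_zero_of_power hf.1]
    · rw [const_ne _ hj, hf.2 j hj]
  have h2 : dBar k A (contrBar k A (f 0)) = 0 := by
    rw [← neg_eq_zero, ← contrBar_dBar, ← contrBar_eq_dBar (hf.2 1 one_ne_zero), contrBar_contrBar]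
  -- Replace the constant term of `f` by its downward extension `g`. The defect `u d f_0` of `f -
  -- f_0` cancels that of `g`, giving a cycle with the same constant term.
  obtain ⟨g, hg, hg0, hdg⟩ := exists_laurent_of_const hs hf0 h2
  have hm : f - const k A (f 0) + g ∈ laurent k A n ⊓ LinearMap.ker (diffID k A) := by
    refine mem_inf_ker.2 ⟨add_mem (sub_mem hf.1.1 (const_mem_power hf0).1) hg, ?_⟩
    rw [map_add, map_sub, h1, diffID_const, hdg, sub_sub_cancel, add_neg_cancel]
  have hr' := hp₁ _ _ (represents_mk (W := (laurent k A (n + 1)).map (diffID k A)) hm)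
  rw [constTerm_apply, Pi.add_apply, Pi.sub_apply, const_zero, sub_self, zero_add, hg0] at hr'
  exact ⟨_, Subtype.ext (hr'.eq hr)⟩

end

end NCForms

end

/-! ### Assembly of the diagram -/

theorem mainTheorem8 {k : Type*} [CommRing k] [Algebra ℚ k] {A : Type*} [Ring A] [Algebra k A]
    (hsplit : ∃ r : A →ₗ[k] k, r ∘ₗ Algebra.linearMap k A = LinearMap.id) :
    -- The canonical identifications of the homology groups with their de Rham models.
    (∃ eHH : ∀ n : ℤ, HHStd k A n ≃ₗ[k] HH k A n,
      ∀ n f (q : HHStd k A n), Represents f q → (eHH n q : DRBar k A) = nat k A f) ∧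
    (∃ eHC : ∀ n : ℤ, HCStd k A n ≃ₗ[k] HC k A n,
      ∀ n f (q : HCStd k A n), Represents f q → Represents (constTerm k A f) (eHC n q)) ∧
    (∃ eNeg : ∀ n : ℤ, HCNegStd k A n ≃ₗ[k] HCNeg k A n,
      ∀ n f (q : HCNegStd k A n), Represents f q → diffID k A (rescale k A n f) = 0 →
        Represents (rescale k A n f) (eNeg n q)) ∧
    (∃ ePer : ∀ n : ℤ, HCPerStd k A n ≃ₗ[k] HCPer k A n,
      ∀ n f (q : HCPerStd k A n), Represents f q → diffID k A (rescale k A n f) = 0 →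
        Represents (rescale k A n f) (ePer n q)) ∧
    -- The maps of the diagram.
    ∃ (I : ∀ n : ℤ, HH k A n →ₗ[k] HC k A n)
      (J : ∀ n : ℤ, HH' k A n →ₗ[k] HD' k A n)
      (S₁ : ∀ n : ℤ, HC k A (n + 1) →ₗ[k] HD k A (n - 1))
      (S₂ : ∀ n : ℤ, HD k A n →ₗ[k] HC k A n)
      (B : ∀ n : ℤ, HC k A n →ₗ[k] HH k A (n + 1))
      (B' : ∀ n : ℤ, HC k A n →ₗ[k] HCNeg k A (n + 1))
      (Bm : ∀ n : ℤ, HH k A n →ₗ[k] HCNeg k A (n + 1))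
      (Sm : ∀ n : ℤ, HCNeg k A (n + 1) →ₗ[k] HCNeg k A (n - 1))
      (Im : ∀ n : ℤ, HCNeg k A n →ₗ[k] HH' k A n)
      (pm : ∀ n : ℤ, HCNeg k A n →ₗ[k] HCPer k A n)
      (U : ∀ n : ℤ, HCPer k A (n + 1) ≃ₗ[k] HCPer k A (n - 1))
      (p₁ : ∀ n : ℤ, HCPer k A n →ₗ[k] HD' k A n)
      (p₂ : ∀ n : ℤ, HD' k A n →ₗ[k] HC k A n)
      (p : ∀ n : ℤ, HCPer k A n →ₗ[k] HC k A n),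
      -- The assignments that define them.
      (∀ n (x : HH k A n), Represents (x : DRBar k A) (I n x)) ∧
      (∀ n (x : HH' k A n), Represents ((x : HH k A n) : DRBar k A) (J n x : HD k A n)) ∧
      (∀ n, ∀ f ∈ degBar k A (n + 1), ∀ g ∈ degBar k A (n - 1), ∀ q : HC k A (n + 1),
        Represents (nat k A f) q → dBar k A g = contrBar k A f →
          Represents (nat k A g) (S₁ n q)) ∧
      (∀ n x (q : HD k A n), Represents x q → Represents x (S₂ n q)) ∧
      (∀ n, ∀ f ∈ degBar k A n, ∀ q : HC k A n, Represents (nat k A f) q →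
        (B n q : DRBar k A) = nat k A (dBar k A f)) ∧
      (∀ n, ∀ f ∈ degBar k A n, ∀ q : HC k A n, Represents (nat k A f) q →
        Represents (const k A (dBar k A f)) (B' n q)) ∧
      (∀ n, ∀ f ∈ degBar k A n, ∀ x : HH k A n, nat k A f = x →
        Represents (const k A (dBar k A f)) (Bm n x)) ∧
      (∀ n f (q : HCNeg k A (n + 1)), Represents f q → Represents (mulU k A f) (Sm n q)) ∧
      (∀ n f (q : HCNeg k A n), Represents f q →
        ((Im n q : HH k A n) : DRBar k A) = constTerm k A f) ∧
      (∀ n f (q : HCNeg k A n), Represents f q → Represents f (pm n q)) ∧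
      (∀ n f (q : HCPer k A (n + 1)), Represents f q → Represents (mulU k A f) (U n q)) ∧
      (∀ n f (q : HCPer k A n), Represents f q →
        Represents (constTerm k A f) (p₁ n q : HD k A n)) ∧
      (∀ n x (q : HD' k A n), Represents x (q : HD k A n) → Represents x (p₂ n q)) ∧
      (∀ n, p n = p₂ n ∘ₗ p₁ n) ∧
      -- The squares between the first and the second row commute.
      (∀ n, p₂ n ∘ₗ J n = I n ∘ₗ (HH' k A n).subtype) ∧
      (∀ n, B' n ∘ₗ I n = Bm n) ∧
      (∀ n, (U n).toLinearMap ∘ₗ pm (n + 1) = pm (n - 1) ∘ₗ Sm n) ∧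
      (∀ n, p₁ n ∘ₗ pm n = J n ∘ₗ Im n) ∧
      -- The squares between the second and the third row commute.
      (∀ n, S₂ n ∘ₗ (HD' k A n).subtype = p₂ n) ∧
      (∀ n, (HH' k A (n + 1)).subtype ∘ₗ Im (n + 1) ∘ₗ B' n = B n) ∧
      (∀ n, p n ∘ₗ pm n = I n ∘ₗ (HH' k A n).subtype ∘ₗ Im n) ∧
      (∀ n, S₁ n ∘ₗ p (n + 1) =
        (HD' k A (n - 1)).subtype ∘ₗ p₁ (n - 1) ∘ₗ (U n).toLinearMap) ∧
      -- The first row is exact.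
      (∀ n, Function.Injective (HH' k A n).subtype ∧
        Function.Exact (HH' k A n).subtype (Bm n) ∧
        Function.Exact (Bm n) (Sm n) ∧
        Function.Exact (Sm n) (Im (n - 1)) ∧
        Function.Surjective (Im (n - 1))) ∧
      -- The second row is exact.
      (∀ n, Function.Injective (p₂ n) ∧
        Function.Exact (p₂ n) (B' n) ∧
        Function.Exact (B' n) (pm (n + 1)) ∧
        Function.Exact ((U n).toLinearMap ∘ₗ pm (n + 1)) (p₁ (n - 1)) ∧
        Function.Surjective (p₁ (n - 1))) ∧
      -- The third row is exact.
      (∀ n, Function.Injective (S₂ n) ∧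
        Function.Exact (S₂ n) (B n) ∧
        Function.Exact (B n) (I (n + 1)) ∧
        Function.Exact (I (n + 1)) (S₁ n) ∧
        Function.Surjective (S₁ n)) := by
  obtain ⟨s, hs⟩ := exists_contraction hsplit
  choose eHH hHH using fun n => exists_equiv_HH (k := k) (A := A) n
  choose eHC hHC using fun n => exists_equiv_HC hs n
  choose eNeg hNeg using fun n => exists_equiv_HCNeg hs n
  choose ePer hPer using fun n => exists_equiv_HCPer hs n
  choose I hI using fun n => exists_HH_to_HC (k := k) (A := A) n
  choose J hJ using fun n => exists_HH'_to_HD' (k := k) (A := A) n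
  choose S₁ hS₁ using fun n => exists_HC_to_HD hs n
  choose S₂ hS₂ using fun n => exists_HD_to_HC hs n
  choose B hB using fun n => exists_HC_to_HH hs n
  choose B' hB' using fun n => exists_HC_to_HCNeg hs n
  choose Sm hSm using fun n => exists_shift_HCNeg hs n
  choose Im hIm using fun n => exists_HCNeg_to_HH' hs n
  choose pm hpm using fun n => exists_HCNeg_to_HCPer hs n
  choose U hU using fun n => exists_shift_HCPer (k := k) (A := A) n
  choose p₁ hp₁ using fun n => exists_HCPer_to_HD' (k := k) (A := A) n
  -- `B⁻` is taken to be `B' ∘ I`, and `p₂` the restriction of `S₂`, so two of the squares commute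
  -- by definition.
  have hBm : ∀ n, ∀ f ∈ degBar k A n, ∀ x : HH k A n, nat k A f = x →
      Represents (const k A (dBar k A f)) ((B' n ∘ₗ I n) x) := fun n f hf x hx =>
    hB' n f hf (I n x) (by rw [hx]; exact hI n x)
  have hp₂ : ∀ n x (q : HD' k A n), Represents x (q : HD k A n) →
      Represents x ((S₂ n ∘ₗ (HD' k A n).subtype) q) := fun n x q h => hS₂ n x q h
  refine ⟨⟨eHH, hHH⟩, ⟨eHC, hHC⟩, ⟨eNeg, hNeg⟩, ⟨ePer, hPer⟩, I, J, S₁, S₂, B, B',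
    fun n => B' n ∘ₗ I n, Sm, Im, pm, U, p₁, fun n => S₂ n ∘ₗ (HD' k A n).subtype,
    fun n => (S₂ n ∘ₗ (HD' k A n).subtype) ∘ₗ p₁ n, hI, hJ, hS₁, hS₂, hB, hB', hBm, hSm, hIm, hpm,
    hU, hp₁, hp₂, fun _ => rfl, fun n => LinearMap.ext fun x => ?_, fun _ => rfl,
    fun n => LinearMap.ext fun q => ?_, fun n => LinearMap.ext fun q => ?_, fun _ => rfl,
    fun n => LinearMap.ext fun q => ?_, fun n => LinearMap.ext fun q => ?_,
    fun n => LinearMap.ext fun q => ?_,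
    fun n => ⟨Subtype.val_injective, exact_HH'_HH_HCNeg hs (hBm n),
      exact_HH_HCNeg_HCNeg hs (hBm n) (hSm n), exact_HCNeg_HCNeg_HH' hs (hSm n) (hIm (n - 1)),
      surjective_HCNeg_HH' (hIm (n - 1))⟩,
    fun n => ⟨(injective_of_represents (hS₂ n)).comp Subtype.val_injective,
      exact_HD'_HC_HCNeg hs (hp₂ n) (hB' n), exact_HC_HCNeg_HCPer hs (hB' n) (hpm (n + 1)),
      exact_HCNeg_HCPer_HD' hs (hpm (n + 1)) (hU n) (hp₁ (n - 1)),
      surjective_HCPer_HD' hs (hp₁ (n - 1))⟩,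
    fun n => ⟨injective_of_represents (hS₂ n), exact_HD_HC_HH hs (hS₂ n) (hB n),
      exact_HC_HH_HC hs (hB n) (hI (n + 1)), exact_HH_HC_HD hs (hI (n + 1)) (hS₁ n),
      surjective_HC_HD hs (hS₁ n)⟩⟩
  · exact (hp₂ n _ _ (hJ n x)).eq (hI n x)
  · obtain ⟨f, hf⟩ := exists_represents q
    exact (hU n _ _ (hpm _ _ _ hf)).eq (hpm _ _ _ (hSm n _ _ hf))
  · obtain ⟨f, hf⟩ := exists_represents q
    have h := hJ n (Im n q)
    rw [hIm n f q hf] at h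
    exact Subtype.ext ((hp₁ n _ _ (hpm n _ _ hf)).eq h)
  · obtain ⟨f, hf, -, hq⟩ := exists_rep_HC hs q
    refine Subtype.ext ((hIm _ _ _ (hB' n f hf q hq)).trans ?_)
    rw [constTerm_apply, const_zero, hB n f hf q hq]
  · obtain ⟨f, hf⟩ := exists_represents q
    have h := hI n (Im n q)
    rw [hIm n f q hf] at h
    exact (hp₂ n _ _ (hp₁ n _ _ (hpm n _ _ hf))).eq h
  · obtain ⟨f, hf⟩ := exists_represents q
    have h := hp₁ _ _ _ (hU n _ _ hf)
    rw [constTerm_apply, mulU_apply] at h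
    -- The cycle equation at `u⁰` is `i f_0 = d f_{-1}`. So `f_{-1}`, the constant term of `uf`, is
    -- an admissible choice in the definition of `S₁`.
    exact (hS₁ n (f 0) (laurent_mem hf.mem.1 0) (f (0 - 1)) (laurent_mem hf.mem.1 (0 - 1)) _
      (hp₂ _ _ _ (hp₁ _ _ _ hf)) (contrBar_eq_dBar (congrFun hf.mem.2 0)).symm).eq h
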